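/- Let $(X,d)$ be a locally compact separable metric space, $\mu$ a nonnegative Radon measure on $X$ with $\mu(U)>0$ for every nonempty open $U\subset X$, and $(\mathcal{E},\mathcal{F})$ a regular symmetric Dirichlet form on $L_2(X,\mu)$. Put $\mathcal{C}:=C_c(X)\cap\mathcal{F}$ and $\mathcal{E}_1(u):=\mathcal{E}(u,u)+\|u\|_{L_2(X,\mu)}^2$. Assume that $(\mathcal{E},\mathcal{F})$ is strongly local: $\mathcal{E}(f,g)=0$ whenever $f,g\in\mathcal{C}$ and $f$ is constant on a neighbourhood of the support of $g$. *Energy measures.* For $f\in\mathcal{C}$ let $\Gamma(f)$ be the Radon measure with $\int\varphi\,d\Gamma(f)=\mathcal{E}(\varphi f,f)-\tfrac12\mathcal{E}(\varphi,f^2)$ for all $\varphi\in\mathcal{C}$, let $\Gamma(f,g):=\frac14(\Gamma(f+g)-\Gamma(f-g))$, and for $u\in\mathcal{F}$ let $\Gamma(u)(A):=\lim_n\Gamma(f_n)(A)$ for Borel $A$, where $f_n\in\mathcal{C}$ and $\mathcal{E}_1(u-f_n)\to0$. Write $\nu\le\mu$ if $\nu\ll\mu$ and $d\nu/d\mu\le1$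 $\mu$-a.e. Assume that $\mu$ is energy dominant, i.e. $\Gamma(f)\ll\mu$ for all $f\in\mathcal{C}$, and that there is a point separating coordinate sequence with respect to $\mu$: a sequence $(f_n)_n\subset\mathcal{C}$ that separates the points of $X$, whose linear span is $\mathcal{E}_1$-dense in $\mathcal{F}$, and with $\Gamma(f_n)\le\mu$ for all $n$. *Intrinsic metric.* Let $\mathcal{F}_{loc}$ be the set of functions that on every compact $K$ agree $\mu$-a.e. with some $u\in\mathcal{F}$, and let $\Gamma(f)$, for $f\in\mathcal{F}_{loc}$, be the measure that on $K$ equals $\Gamma(u)$ for such $u$. Put $$d_{\Gamma,\mu}(x,y):=\sup\{f(x)-f(y): f\in\mathcal{F}_{loc}\cap C(X)\text{ real-valued},\ \Gamma(f)\le\mu\}\in[0,\infty].$$ *Dirac operator.* Let $\mathcal{H}$ be the Hilbert space obtained from $\mathcal{C}\otimes\mathcal{C}$ with $\langle a\otimes b,c\otimes d\rangle=\int bd\,d\Gamma(a,c)$ by factoring out null elements and completing, with the action of $c\in\mathcal{C}$ on $\mathcal{H}$ determined by $c(a\otimes b)=(ca)\otimes b-c\otimes(ab)$ and continuity. Let $\partial:\mathcal{F}\to\mathcal{H}$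 be the $\mathcal{E}$-continuous linear map with $\partial a=a\otimes\mathbf 1$ for $a\in\mathcal{C}$, in the sense that $\langle\partial a,c\otimes d\rangle=\int d\,d\Gamma(a,c)$ for all $c,d\in\mathcal{C}$, and let $\partial^*$ be the adjoint of the unbounded operator $\partial:L_2(X,\mu)\to\mathcal{H}$ with domain $\mathcal{F}$. On the complexification $\mathbb{H}$ of $L_2(X,\mu)\oplus\mathcal{H}$ let $\mathbb{D}(f,\omega):=(\partial^*\omega,\partial f)$ with domain the complexification of $\mathcal{F}\oplus\mathrm{dom}\,\partial^*$. Complexify $\mathcal{C}$ and put $\Gamma(u+iv):=\Gamma(u)+\Gamma(v)$ for real $u,v\in\mathcal{C}$. Let $\mathbb{A}_0$ be the set of all $a$ in the complexified $\mathcal{C}$ such that $\Gamma(a)$ has a density in $L_\infty(X,\mu)$ with respect to $\mu$ (again denoted $\Gamma(a)$), acting on $\mathbb{H}$ by $a(f,\omega)=(af,a\omega)$. Put $$d_{\mathbb{D}}(x,y):=\sup\{|a(x)-a(y)|: a\in\mathbb{A}_0,\ [\mathbb{D},a]\text{ is bounded and }\|[\mathbb{D},a]\|\le1\}\in[0,\infty].$$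 **Theorem.** Under these assumptions: 1. for every $a\in\mathbb{A}_0$, multiplication by $a$ maps $\mathrm{dom}\,\mathbb{D}$ into itself, the commutator $[\mathbb{D},a]$ extends from $\mathrm{dom}\,\mathbb{D}$ to a bounded linear operator on $\mathbb{H}$, and $\|[\mathbb{D},a]\|^2=\|\Gamma(a)\|_{L_\infty(X,\mu)}$; 2. $d_{\mathbb{D}}$ is a metric in the wide sense on $X$ (it satisfies the axioms of a metric but may take the value $+\infty$); 3. $d_{\mathbb{D}}(x,y)\le d_{\Gamma,\mu}(x,y)$ for all $x,y\in X$; 4. if $X$ is compact, then $d_{\mathbb{D}}=d_{\Gamma,\mu}$. -/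

import Mathlib

open MeasureTheory Filter Topology
open scoped ENNReal TensorProduct CompactlySupported

noncomputable section

/-! ### Complexification of real vector spaces and real Hilbert spaces -/

/-- The complexification `V ⊕ iV` of a real vector space `V`. -/
@[ext] structure Cplx (V : Type*) where
  re : V
  im : V

namespace Cplx

variable {V : Type*}

section Algebra
variable [AddCommGroup V]

instance : Zero (Cplx V) := ⟨⟨0, 0⟩⟩
instance : Add (Cplx V) := ⟨fun x y => ⟨x.re + y.re, x.im + y.im⟩⟩
instance : Neg (Cplx V) := ⟨fun x => ⟨-x.re, -x.im⟩⟩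
instance : Sub (Cplx V) := ⟨fun x y => ⟨x.re - y.re, x.im - y.im⟩⟩

@[simp] theorem zero_re : (0 : Cplx V).re = 0 := rfl
@[simp] theorem zero_im : (0 : Cplx V).im = 0 := rfl
@[simp] theorem add_re (x y : Cplx V) : (x + y).re = x.re + y.re := rfl
@[simp] theorem add_im (x y : Cplx V) : (x + y).im = x.im + y.im := rfl
@[simp] theorem neg_re (x : Cplx V) : (-x).re = -x.re := rfl
@[simp] theorem neg_im (x : Cplx V) : (-x).im = -x.im := rfl
@[simp] theorem sub_re (x y : Cplx V) : (x - y).re = x.re - y.re := rfl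
@[simp] theorem sub_im (x y : Cplx V) : (x - y).im = x.im - y.im := rfl

instance : AddCommGroup (Cplx V) where
  add_assoc x y z := by ext <;> simp [add_assoc]
  zero_add x := by ext <;> simp
  add_zero x := by ext <;> simp
  add_comm x y := by ext <;> simp [add_comm]
  neg_add_cancel x := by ext <;> simp
  sub_eq_add_neg x y := by ext <;> simp [sub_eq_add_neg]
  nsmul := nsmulRec
  zsmul := zsmulRec

variable [Module ℝ V]

instance : SMul ℂ (Cplx V) :=
  ⟨fun z x => ⟨z.re • x.re - z.im • x.im, z.re • x.im + z.im • x.re⟩⟩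

@[simp] theorem smul_re (z : ℂ) (x : Cplx V) : (z • x).re = z.re • x.re - z.im • x.im := rfl
@[simp] theorem smul_im (z : ℂ) (x : Cplx V) : (z • x).im = z.re • x.im + z.im • x.re := rfl

instance : Module ℂ (Cplx V) where
  one_smul x := by ext <;> simp
  mul_smul z w x := by
    ext <;> simp only [smul_re, smul_im, Complex.mul_re, Complex.mul_im] <;> module
  smul_zero z := by ext <;> simp
  smul_add z x y := by ext <;> simp only [smul_re, smul_im, add_re, add_im] <;> module
  add_smul z w x := by
    ext <;> simp only [smul_re, smul_im, add_re, add_im, Complex.add_re, Complex.add_im] <;> module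
  zero_smul x := by ext <;> simp

end Algebra

section Hilbert
variable [NormedAddCommGroup V] [InnerProductSpace ℝ V]

/-- The sesquilinear extension (conjugate linear in the first slot) of the real inner product. -/
@[reducible] def innerCore : InnerProductSpace.Core ℂ (Cplx V) where
  inner x y := ⟨inner ℝ x.re y.re + inner ℝ x.im y.im, inner ℝ x.re y.im - inner ℝ x.im y.re⟩
  conj_inner_symm x y := by
    apply Complex.ext
    · simp [real_inner_comm]
    · simp [real_inner_comm]
  re_inner_nonneg x := by
    simpa using add_nonneg (real_inner_self_nonneg (x := x.re)) (real_inner_self_nonneg (x := x.im))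
  add_left x y z := by
    apply Complex.ext
    · simp [inner_add_left]; ring
    · simp [inner_add_left]; ring
  smul_left x y z := by
    apply Complex.ext
    · simp [inner_add_left, inner_sub_left, real_inner_smul_left]; ring
    · simp [inner_add_left, inner_sub_left, real_inner_smul_left]; ring
  definite x h := by
    have h1 : inner ℝ x.re x.re + inner ℝ x.im x.im = 0 := congrArg Complex.re h
    have h2 := real_inner_self_nonneg (x := x.re)
    have h3 := real_inner_self_nonneg (x := x.im)
    ext
    · exact inner_self_eq_zero (𝕜 := ℝ).1 (by linarith)
    · exact inner_self_eq_zero (𝕜 := ℝ).1 (by linarith)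

instance : NormedAddCommGroup (Cplx V) := innerCore.toNormedAddCommGroup
instance : InnerProductSpace ℂ (Cplx V) := InnerProductSpace.ofCore innerCore.toCore

end Hilbert

/-- The complex linear extension of a real unbounded operator, with domain `dom T ⊕ i dom T`. -/
def extendPMap [NormedAddCommGroup V] [InnerProductSpace ℝ V] (T : V →ₗ.[ℝ] V) :
    Cplx V →ₗ.[ℂ] Cplx V where
  domain :=
    { carrier := {v | v.re ∈ T.domain ∧ v.im ∈ T.domain}
      add_mem' := fun ha hb => ⟨T.domain.add_mem ha.1 hb.1, T.domain.add_mem ha.2 hb.2⟩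
      zero_mem' := ⟨T.domain.zero_mem, T.domain.zero_mem⟩
      smul_mem' := fun z _ hv =>
        ⟨T.domain.sub_mem (T.domain.smul_mem z.re hv.1) (T.domain.smul_mem z.im hv.2),
          T.domain.add_mem (T.domain.smul_mem z.re hv.2) (T.domain.smul_mem z.im hv.1)⟩ }
  toFun :=
    { toFun := fun v => ⟨T ⟨v.1.re, v.2.1⟩, T ⟨v.1.im, v.2.2⟩⟩
      map_add' := fun v w => by
        ext
        · exact T.toFun.map_add ⟨v.1.re, v.2.1⟩ ⟨w.1.re, w.2.1⟩
        · exact T.toFun.map_add ⟨v.1.im, v.2.2⟩ ⟨w.1.im, w.2.2⟩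
      map_smul' := fun z v => by
        ext
        · exact (T.toFun.map_sub (z.re • ⟨v.1.re, v.2.1⟩) (z.im • ⟨v.1.im, v.2.2⟩)).trans
            (by simp only [T.toFun.map_smul]; rfl)
        · exact (T.toFun.map_add (z.re • ⟨v.1.im, v.2.2⟩) (z.im • ⟨v.1.re, v.2.1⟩)).trans
            (by simp only [T.toFun.map_smul]; rfl) }

end Cplx

/-! ### Dirichlet forms -/

section Dirichlet

variable {X : Type*} [MetricSpace X] [MeasurableSpace X] [BorelSpace X]

/-- A symmetric Dirichlet form on `L²(X, μ)`. -/
structure DirichletForm (μ : Measure X) where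
  /-- The domain `ℱ`. -/
  dom : Submodule ℝ (Lp ℝ 2 μ)
  /-- The form `ℰ`. -/
  form : dom →ₗ[ℝ] dom →ₗ[ℝ] ℝ
  dense_dom : Dense (dom : Set (Lp ℝ 2 μ))
  symm : ∀ u v, form u v = form v u
  nonneg : ∀ u, 0 ≤ form u u
  /-- `ℱ` is complete for the norm of `ℰ₁(u) = ℰ(u, u) + ‖u‖²`. -/
  closed : ∀ u : ℕ → dom,
    (∀ ε > 0, ∃ N, ∀ j ≥ N, ∀ k ≥ N,
      form (u j - u k) (u j - u k) + ‖((u j - u k : dom) : Lp ℝ 2 μ)‖ ^ 2 < ε) →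
    ∃ v : dom, Tendsto
      (fun k => form (u k - v) (u k - v) + ‖((u k - v : dom) : Lp ℝ 2 μ)‖ ^ 2) atTop (𝓝 0)
  /-- The Markov property for the unit contraction `(0 ∨ u) ∧ 1`. -/
  markov : ∀ u : dom, ∃ v : dom,
    (((v : Lp ℝ 2 μ) : X → ℝ) =ᵐ[μ] fun x => min (max 0 (((u : Lp ℝ 2 μ) : X → ℝ) x)) 1) ∧
      form v v ≤ form u u

/-- The class in `L²(X, μ)` of a compactly supported continuous function. -/
def ccToLp (μ : Measure X) [μ.Regular] : C_c(X, ℝ) →ₗ[ℝ] Lp ℝ 2 μ where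
  toFun f := MemLp.toLp f (f.continuous.memLp_of_hasCompactSupport f.hasCompactSupport)
  map_add' _ _ := rfl
  map_smul' _ _ := rfl

/-- Multiplication by a compactly supported continuous function, as an operator on `L²(X, μ)`. -/
def mulLp (μ : Measure X) [μ.Regular] (a : C_c(X, ℝ)) : Lp ℝ 2 μ →ₗ[ℝ] Lp ℝ 2 μ where
  toFun f := MemLp.toLp (fun x => a x * f x)
    ((Lp.memLp f).mul' (r := 2) (p := ∞) (q := 2)
      (a.continuous.memLp_of_hasCompactSupport a.hasCompactSupport))
  map_add' f g := by
    rw [← MemLp.toLp_add]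
    refine MemLp.toLp_congr _ _ ?_
    filter_upwards [Lp.coeFn_add f g] with x hx
    exact (congrArg (a x * ·) hx).trans (mul_add _ _ _)
  map_smul' c f := by
    rw [RingHom.id_apply, ← MemLp.toLp_const_smul]
    refine MemLp.toLp_congr _ _ ?_
    filter_upwards [Lp.coeFn_smul c f] with x hx
    exact (congrArg (a x * ·) hx).trans (mul_left_comm _ _ _)

namespace DirichletForm

variable {μ : Measure X} [μ.Regular] (E : DirichletForm μ)

/-- `ℰ₁(u) = ℰ(u, u) + ‖u‖²`. -/
def formOne (u : E.dom) : ℝ := E.form u u + ‖(u : Lp ℝ 2 μ)‖ ^ 2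

/-- The space `𝒞 = C_c(X) ∩ ℱ`. -/
def core : Submodule ℝ C_c(X, ℝ) := E.dom.comap (ccToLp μ)

/-- The inclusion of `𝒞` into `ℱ`. -/
def coreToDom : E.core →ₗ[ℝ] E.dom :=
  ((ccToLp μ).comp E.core.subtype).codRestrict E.dom (fun f => f.2)

/-- `ℰ(f, g)` for `f, g ∈ 𝒞`. -/
def coreForm (f g : E.core) : ℝ := E.form (E.coreToDom f) (E.coreToDom g)

/-- Regularity: `𝒞` is uniformly dense in `C_c(X)` and `ℰ₁`-dense in `ℱ`. -/
def IsRegular : Prop :=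
  (∀ g : C_c(X, ℝ), ∀ ε > 0, ∃ f : E.core, ∀ x, |f.1 x - g x| < ε) ∧
  (∀ u : E.dom, ∀ ε > 0, ∃ f : E.core, E.formOne (u - E.coreToDom f) < ε)

/-- Strong locality: `ℰ(f, g) = 0` for `f, g ∈ 𝒞` whenever `f` is constant on a neighbourhood of
the support of `g`. -/
def IsStronglyLocal : Prop :=
  ∀ f g : E.core, (∃ U : Set X, IsOpen U ∧ tsupport g.1 ⊆ U ∧ ∃ c : ℝ, ∀ x ∈ U, f.1 x = c) →
    E.coreForm f g = 0

/-! ### Energy measures -/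

/-- `ν` is the energy measure of `f ∈ 𝒞`: it is a Radon measure and
`∫ φ dν = ℰ(φf, f) - ½ ℰ(φ, f²)` for all `φ ∈ 𝒞`. (`𝒞` is an algebra for every Dirichlet form;
`p` and `q` are the elements `φf` and `f²` of `𝒞`.) -/
def IsEnergyMeasure (f : E.core) (ν : Measure X) : Prop :=
  ν.Regular ∧ ∀ φ p q : E.core, p.1 = φ.1 * f.1 → q.1 = f.1 * f.1 →
    ∫ x, φ.1 x ∂ν = E.coreForm p f - (1 / 2) * E.coreForm φ q

open Classical in
/-- The energy measure `Γ(f)` of `f ∈ 𝒞`. For a regular form it exists and is unique. -/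
def energyMeasure (f : E.core) : Measure X :=
  if h : ∃ ν, E.IsEnergyMeasure f ν then h.choose else 0

/-- `ν` is the energy measure of `u ∈ ℱ`: `Γ(fₙ)(A) → ν(A)` for every Borel set `A` and all
`fₙ ∈ 𝒞` that converge to `u` in `ℱ`. -/
def IsEnergyMeasureDom (u : E.dom) (ν : Measure X) : Prop :=
  ∀ f : ℕ → E.core, Tendsto (fun n => E.formOne (u - E.coreToDom (f n))) atTop (𝓝 0) →
    ∀ A, MeasurableSet A → Tendsto (fun n => E.energyMeasure (f n) A) atTop (𝓝 (ν A))

open Classical in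
/-- The energy measure `Γ(u)` of `u ∈ ℱ`. For a regular form it exists and is unique. -/
def energyMeasureDom (u : E.dom) : Measure X :=
  if h : ∃ ν, E.IsEnergyMeasureDom u ν then h.choose else 0

/-- `∫ φ dΓ(a, c)`, the integral against the mutual energy measure
`Γ(a, c) = ¼ (Γ(a + c) - Γ(a - c))` of `a, c ∈ 𝒞`. -/
def mutualEnergy (a c : E.core) (φ : X → ℝ) : ℝ :=
  (1 / 4) * (∫ x, φ x ∂(E.energyMeasure (a + c)) - ∫ x, φ x ∂(E.energyMeasure (a - c)))

/-- `ν ≤ m`: `ν` is absolutely continuous with respect to `m` with density at most one `m`-a.e. -/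
def DensityLEOne (ν m : Measure X) : Prop :=
  ν ≪ m ∧ ∀ᵐ x ∂m, ν.rnDeriv m x ≤ 1

/-- `m` is energy dominant: a Radon measure of full support such that `Γ(f) ≪ m` for all
`f ∈ 𝒞`. -/
def IsEnergyDominant (m : Measure X) : Prop :=
  m.Regular ∧ m.IsOpenPosMeasure ∧ ∀ f : E.core, E.energyMeasure f ≪ m

/-- `f` is a coordinate sequence with respect to `m`: the linear span of the `fₙ ∈ 𝒞` is
`ℰ₁`-dense in `ℱ` and `Γ(fₙ) ≤ m` for all `n`. -/
def IsCoordinateSequence (m : Measure X) (f : ℕ → E.core) : Prop :=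
  (∀ u : E.dom, ∀ ε > 0, ∃ g ∈ Submodule.span ℝ (Set.range f),
    E.formOne (u - E.coreToDom g) < ε) ∧
  ∀ n, DensityLEOne (E.energyMeasure (f n)) m

/-! ### The intrinsic metric -/

/-- `f ∈ ℱ_loc` and `ν` is its energy measure: for every compact `K` there is `u ∈ ℱ` with `u = f`
`μ`-a.e. on `K`, and `ν` agrees with `Γ(u)` on `K`. -/
def IsLocalEnergyMeasure (f : X → ℝ) (ν : Measure X) : Prop :=
  ∀ K : Set X, IsCompact K → ∃ u : E.dom,
    (∀ᵐ x ∂(μ.restrict K), ((u : Lp ℝ 2 μ) : X → ℝ) x = f x) ∧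
      ν.restrict K = (E.energyMeasureDom u).restrict K

/-- The intrinsic metric `d_{Γ,m}(x, y)`: the supremum of `f(x) - f(y)` over all
`f ∈ ℱ_loc ∩ C(X)` with `Γ(f) ≤ m`. -/
def intrinsicDist (m : Measure X) (x y : X) : ℝ≥0∞ :=
  ⨆ (f : C(X, ℝ)) (ν : Measure X) (_ : E.IsLocalEnergyMeasure f ν) (_ : DensityLEOne ν m),
    ENNReal.ofReal (f x - f y)

/-! ### Differential one-forms -/

/-- `B` is the nonnegative definite symmetric bilinear form on `𝒞 ⊗ 𝒞` determined by
`⟨a ⊗ b, c ⊗ d⟩ = ∫ b d dΓ(a, c)`. -/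
def IsTensorForm (B : (E.core ⊗[ℝ] E.core) →ₗ[ℝ] (E.core ⊗[ℝ] E.core) →ₗ[ℝ] ℝ) : Prop :=
  (∀ v w, B v w = B w v) ∧ (∀ v, 0 ≤ B v v) ∧
    ∀ a b c d : E.core,
      B (a ⊗ₜ[ℝ] b) (c ⊗ₜ[ℝ] d) = E.mutualEnergy a c (fun x => b.1 x * d.1 x)

open Classical in
/-- The bilinear form on `𝒞 ⊗ 𝒞`. For a regular form it exists and is unique. -/
def tensorForm : (E.core ⊗[ℝ] E.core) →ₗ[ℝ] (E.core ⊗[ℝ] E.core) →ₗ[ℝ] ℝ :=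
  if h : ∃ B, E.IsTensorForm B then h.choose else 0

theorem tensorForm_symm (v w : E.core ⊗[ℝ] E.core) : E.tensorForm v w = E.tensorForm w v := by
  unfold tensorForm
  split_ifs with h
  · exact h.choose_spec.1 v w
  · rfl

theorem tensorForm_nonneg (v : E.core ⊗[ℝ] E.core) : 0 ≤ E.tensorForm v v := by
  unfold tensorForm
  split_ifs with h
  · exact h.choose_spec.2.1 v
  · exact le_rfl

/-- `𝒞 ⊗ 𝒞`, with the semi-inner product `tensorForm`. -/
def PreOneForms : Type _ := E.core ⊗[ℝ] E.core

instance : AddCommGroup E.PreOneForms :=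
  Module.addCommMonoidToAddCommGroup ℝ (M := E.core ⊗[ℝ] E.core)
instance : Module ℝ E.PreOneForms := inferInstanceAs (Module ℝ (E.core ⊗[ℝ] E.core))

/-- The semi-inner product on `𝒞 ⊗ 𝒞`. -/
@[reducible] def preOneFormsCore : PreInnerProductSpace.Core ℝ E.PreOneForms where
  inner v w := E.tensorForm v w
  conj_inner_symm v w := E.tensorForm_symm w v
  re_inner_nonneg v := E.tensorForm_nonneg v
  add_left u v w := by
    exact LinearMap.congr_fun (E.tensorForm.map_add u v) w
  smul_left u v r := by
    exact LinearMap.congr_fun (E.tensorForm.map_smul r u) v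

instance : SeminormedAddCommGroup E.PreOneForms :=
  @InnerProductSpace.Core.toSeminormedAddCommGroup ℝ E.PreOneForms _ _ _ E.preOneFormsCore
instance : InnerProductSpace ℝ E.PreOneForms := InnerProductSpace.ofCore E.preOneFormsCore

/-- The identity map from `𝒞 ⊗ 𝒞` to its copy that carries the semi-inner product. -/
def toPreOneForms : (E.core ⊗[ℝ] E.core) →ₗ[ℝ] E.PreOneForms where
  toFun v := v
  map_add' _ _ := rfl
  map_smul' _ _ := rfl

theorem inner_toPreOneForms (v w : E.core ⊗[ℝ] E.core) :
    inner ℝ (E.toPreOneForms v) (E.toPreOneForms w) = E.tensorForm v w := rfl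

/-- The real Hilbert space `ℋ` of differential one-forms: the Hausdorff completion of `𝒞 ⊗ 𝒞`. -/
abbrev OneForms : Type _ := UniformSpace.Completion E.PreOneForms

/-- The class of `a ⊗ b` in `ℋ`. -/
def tens (a b : E.core) : E.OneForms := (E.toPreOneForms (a ⊗ₜ[ℝ] b) : E.OneForms)

/-- `T` is the left action of `c ∈ 𝒞` on `ℋ`: the continuous linear map with
`c (a ⊗ b) = (c a) ⊗ b - c ⊗ (a b)`. -/
def IsLeftAction (c : E.core) (T : E.OneForms →L[ℝ] E.OneForms) : Prop :=
  ∀ a b p q : E.core, p.1 = c.1 * a.1 → q.1 = a.1 * b.1 →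
    T (E.tens a b) = E.tens p b - E.tens c q

open Classical in
/-- The left action of `c ∈ 𝒞` on `ℋ`. For a regular form it exists and is unique. -/
def leftAction (c : E.core) : E.OneForms →L[ℝ] E.OneForms :=
  if h : ∃ T, E.IsLeftAction c T then h.choose else 0

/-- `T` is the derivation `∂` on `ℱ`: it is continuous for the energy seminorm, and for `a ∈ 𝒞`
the one-form `T a` is `a ⊗ 1`, that is, `⟨T a, c ⊗ d⟩ = ∫ 1 d dΓ(a, c)` for all `c, d ∈ 𝒞`
(which determines `T a`, also when the constant `1` is not in `𝒞`). -/
def IsDerivation (T : E.dom →ₗ[ℝ] E.OneForms) : Prop :=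
  (∀ u, ‖T u‖ ^ 2 ≤ E.form u u) ∧
    ∀ a c d : E.core, inner ℝ (T (E.coreToDom a)) (E.tens c d) = E.mutualEnergy a c d.1

open Classical in
/-- The derivation `∂ : ℱ → ℋ`. For a regular form it exists and is unique. -/
def derivation : E.dom →ₗ[ℝ] E.OneForms :=
  if h : ∃ T, E.IsDerivation T then h.choose else 0

/-- `∂` as an unbounded operator from `L²(X, μ)` to `ℋ` with domain `ℱ`. -/
def partialOp : Lp ℝ 2 μ →ₗ.[ℝ] E.OneForms := ⟨E.dom, E.derivation⟩

/-! ### The Dirac operator -/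

/-- The real Hilbert space `L²(X, μ) ⊕ ℋ`. -/
abbrev RealDiracSpace : Type _ := WithLp 2 (Lp ℝ 2 μ × E.OneForms)

/-- The operator `(f, ω) ↦ (∂* ω, ∂ f)` with domain `ℱ ⊕ dom ∂*`, where `∂*` is the Hilbert space
adjoint of `∂`. -/
def realDirac : E.RealDiracSpace →ₗ.[ℝ] E.RealDiracSpace where
  domain :=
    { carrier := {v | v.fst ∈ E.dom ∧ v.snd ∈ E.partialOp.adjoint.domain}
      add_mem' := fun ha hb => ⟨E.dom.add_mem ha.1 hb.1, Submodule.add_mem _ ha.2 hb.2⟩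
      zero_mem' := ⟨E.dom.zero_mem, Submodule.zero_mem _⟩
      smul_mem' := fun r _ hv => ⟨E.dom.smul_mem r hv.1, Submodule.smul_mem _ r hv.2⟩ }
  toFun :=
    { toFun := fun v => WithLp.toLp 2
        (E.partialOp.adjoint ⟨v.1.snd, v.2.2⟩, E.derivation ⟨v.1.fst, v.2.1⟩)
      map_add' := fun v w => congrArg (WithLp.toLp 2) (Prod.ext
        (E.partialOp.adjoint.toFun.map_add ⟨v.1.snd, v.2.2⟩ ⟨w.1.snd, w.2.2⟩)
        (E.derivation.map_add ⟨v.1.fst, v.2.1⟩ ⟨w.1.fst, w.2.1⟩))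
      map_smul' := fun r v => congrArg (WithLp.toLp 2) (Prod.ext
        (E.partialOp.adjoint.toFun.map_smul r ⟨v.1.snd, v.2.2⟩)
        (E.derivation.map_smul r ⟨v.1.fst, v.2.1⟩)) }

/-- The operator `(f, ω) ↦ (a f, a ω)` of multiplication by a real function `a ∈ 𝒞`. -/
def realMul (a : E.core) (v : E.RealDiracSpace) : E.RealDiracSpace :=
  WithLp.toLp 2 (mulLp μ a.1 v.fst, E.leftAction a v.snd)

/-- The complex Hilbert space `ℍ = L²(X, μ) ⊕ ℋ` (complexified). -/
abbrev DiracSpace : Type _ := Cplx E.RealDiracSpace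

/-- The Dirac operator `𝔻` on `ℍ`. -/
def dirac : E.DiracSpace →ₗ.[ℂ] E.DiracSpace := Cplx.extendPMap E.realDirac

/-- Multiplication by `a = u + i v`, with `u, v ∈ 𝒞`, on `ℍ`. -/
def mulOp (a : Cplx E.core) (v : E.DiracSpace) : E.DiracSpace :=
  ⟨E.realMul a.re v.re - E.realMul a.im v.im, E.realMul a.re v.im + E.realMul a.im v.re⟩

/-- The commutator `[𝔻, a]` is well defined on `dom 𝔻` and extends to the bounded operator `T`
on `ℍ`. (Such a `T` is unique, since `dom 𝔻` is dense.) -/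
def IsCommutator (a : Cplx E.core) (T : E.DiracSpace →L[ℂ] E.DiracSpace) : Prop :=
  ∀ v : E.dirac.domain, ∃ h : E.mulOp a v ∈ E.dirac.domain,
    T v = E.dirac ⟨E.mulOp a v, h⟩ - E.mulOp a (E.dirac v)

/-! ### The Connes distance -/

/-- The complex function `u + i v` on `X` given by an element of the complexification of `𝒞`. -/
def eval (a : Cplx E.core) (x : X) : ℂ := ⟨a.re.1 x, a.im.1 x⟩

/-- The energy measure `Γ(a) = Γ(u) + Γ(v)` of `a = u + i v`. -/
def complexEnergyMeasure (a : Cplx E.core) : Measure X :=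
  E.energyMeasure a.re + E.energyMeasure a.im

/-- `‖Γ(a)‖` in `L^∞(X, μ)`, where `Γ(a)` is identified with its density with respect to `μ`. -/
def energySup (a : Cplx E.core) : ℝ≥0∞ :=
  essSup ((E.complexEnergyMeasure a).rnDeriv μ) μ

/-- The algebra `𝔸₀` of all `a` in the complexification of `𝒞` with `Γ(a) ∈ L^∞(X, μ)`. -/
def connesAlgebra : Set (Cplx E.core) :=
  {a | E.complexEnergyMeasure a ≪ μ ∧ E.energySup a < ∞}

/-- The Connes distance `d_𝔻(x, y)`: the supremum of `|a(x) - a(y)|` over all `a ∈ 𝔸₀` with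
`‖[𝔻, a]‖ ≤ 1`. -/
def connesDist (x y : X) : ℝ≥0∞ :=
  ⨆ (a : Cplx E.core) (_ : a ∈ E.connesAlgebra)
    (_ : ∃ T, E.IsCommutator a T ∧ ‖T‖ ≤ 1), ENNReal.ofReal ‖E.eval a x - E.eval a y‖

end DirichletForm

end Dirichlet

/-- A metric in the wide sense: the value `∞` is allowed. -/
def IsMetricInWideSense {X : Type*} (d : X → X → ℝ≥0∞) : Prop :=
  (∀ x y, d x y = 0 ↔ x = y) ∧ (∀ x y, d x y = d y x) ∧ ∀ x y z, d x z ≤ d x y + d y z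

end

/-! Think of a ⊗ f as f ∂a. The Leibniz rule gives [𝔻, a](f, ω) = (-M* ω, M f), where M f = f ∂a.
Since ‖f ∂a‖² = ∫ f² Γ(a) dμ, the operator M is bounded as soon as Γ(a) has a bounded density, and
the essential supremum of that density is ‖M‖², which is also the squared norm of the off-diagonal
commutator. For a = u + iv the operator M becomes M + iN and the adjoint entry becomes M* + iN*. The
cross terms Γ(u, v) cancel, so the sum Γ(u) + Γ(v) governs both entries (`norm_sq_gradientMul_le`,
`norm_sq_adjoint_gradientMul_le`). The vectors (f, 0) show that the bound is attained
(`density_le_of_isCommutator`).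

The condition ‖[𝔻, a]‖ ≤ 1 thus means Γ(a) ≤ μ. The coordinate functions satisfy it, so they
separate points for the Connes distance. A rotation by a phase replaces a complex a by a real
function with the same difference at two given points and no larger energy, which gives d_𝔻 ≤
d_{Γ,μ}. On a compact space every continuous function in ℱ_loc already lies in 𝒞, which gives the
converse.

Most of the work goes into the objects themselves, since Γ, ℋ, the action and ∂ are given only by
characterising properties. The source is the approximating form (n + 1)⟨u - Pₙu, v⟩ with resolvent
Pₙ. The Markov property makes Pₙ sub-Markovian, so if the increments and values of u are dominated
by those of f and g, then so are its approximate energies (`approxSq_le`). In the limit 𝒞 is an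
algebra stable under Lipschitz maps, φ ↦ ℰ(φf, f) - ½ℰ(φ, f²) is positive, and domination passes to
Γ. Strong locality bounds the functional by ℰ(f, f) sup |φ|, and Hahn-Banach and Riesz then produce
Γ(f). The Leibniz rule follows from domination and locality: near a point, f and g are constants up
to ε, and the error in Γ(fg, h) is O(ε). -/

set_option linter.unusedSectionVars false

noncomputable section

/-! ### Resolvents and approximating forms. -/

namespace DirichletForm

section Resolvent

variable {X : Type*} [MeasurableSpace X] {μ : Measure X}
  (E : DirichletForm μ)

/-- The domain of the form with the inner product `ℰ / (n + 1) + ⟨·, ·⟩`. -/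
def FormSpace (_n : ℕ) : Type _ := E.dom

namespace FormSpace

variable (n : ℕ)

instance : AddCommGroup (FormSpace E n) := inferInstanceAs (AddCommGroup E.dom)
instance : Module ℝ (FormSpace E n) := inferInstanceAs (Module ℝ E.dom)

/-- The identification of the form space with the domain of the form. -/
def equiv : FormSpace E n ≃ₗ[ℝ] E.dom := LinearEquiv.refl ℝ E.dom

/-- The inner product `ℰ / (n + 1) + ⟨·, ·⟩` on the domain. -/
@[reducible] def innerCore : InnerProductSpace.Core ℝ (FormSpace E n) where
  inner u v := E.form (equiv E n u) (equiv E n v) / (n + 1) +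
    inner ℝ (equiv E n u : Lp ℝ 2 μ) (equiv E n v : Lp ℝ 2 μ)
  conj_inner_symm u v := by
    simp only [conj_trivial]
    rw [E.symm, real_inner_comm]
  re_inner_nonneg u := by
    have := E.nonneg (equiv E n u)
    have h2 := real_inner_self_nonneg (x := (equiv E n u : Lp ℝ 2 μ))
    simp only [RCLike.re_to_real]
    positivity
  add_left u v w := by
    simp only [map_add, LinearMap.add_apply, Submodule.coe_add, inner_add_left]
    ring
  smul_left u v r := by
    simp only [map_smul, LinearMap.smul_apply, Submodule.coe_smul, inner_smul_left, smul_eq_mul,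
      conj_trivial]
    ring
  definite u h := by
    have h1 : E.form (equiv E n u) (equiv E n u) / (n + 1) +
      inner ℝ (equiv E n u : Lp ℝ 2 μ) (equiv E n u : Lp ℝ 2 μ) = 0 := h
    have h0 : 0 ≤ E.form (equiv E n u) (equiv E n u) / (n + 1) :=
      div_nonneg (E.nonneg _) (by positivity)
    have h2 := real_inner_self_nonneg (x := (equiv E n u : Lp ℝ 2 μ))
    have h3 : (equiv E n u : Lp ℝ 2 μ) = 0 := inner_self_eq_zero (𝕜 := ℝ).1 (by linarith)
    have h4 : equiv E n u = 0 := by ext1; simpa using h3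
    exact (LinearEquiv.map_eq_zero_iff _).1 h4

instance : NormedAddCommGroup (FormSpace E n) := (innerCore E n).toNormedAddCommGroup
instance : InnerProductSpace ℝ (FormSpace E n) := InnerProductSpace.ofCore (innerCore E n).toCore

theorem inner_def (u v : FormSpace E n) : inner ℝ u v =
    E.form (equiv E n u) (equiv E n v) / (n + 1) +
      inner ℝ (equiv E n u : Lp ℝ 2 μ) (equiv E n v : Lp ℝ 2 μ) := rfl

theorem norm_sq (u : FormSpace E n) : ‖u‖ ^ 2 =
    E.form (equiv E n u) (equiv E n u) / (n + 1) + ‖(equiv E n u : Lp ℝ 2 μ)‖ ^ 2 := by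
  rw [← real_inner_self_eq_norm_sq, inner_def, real_inner_self_eq_norm_sq]

/-- The norm is equivalent to that of ℰ₁: it is at most the ℰ₁ norm, and n + 1 times its square
dominates ℰ₁. Completeness is therefore the closedness of the form. -/
instance : CompleteSpace (FormSpace E n) := by
  have hn : (0 : ℝ) < n + 1 := by positivity
  refine Metric.complete_of_cauchySeq_tendsto fun u hu => ?_
  obtain ⟨v, hv⟩ := E.closed (fun k => equiv E n (u k)) (by
    intro ε hε
    have h0 : 0 < ε / (n + 1) := by positivity
    obtain ⟨N, hN⟩ := Metric.cauchySeq_iff.1 hu (Real.sqrt (ε / (n + 1))) (by positivity)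
    refine ⟨N, fun j hj k hk => ?_⟩
    have h1 := hN j hj k hk
    rw [dist_eq_norm] at h1
    have h2 : ‖u j - u k‖ ^ 2 < ε / (n + 1) := by
      rw [← Real.sq_sqrt h0.le]
      gcongr
    rw [norm_sq, map_sub, lt_div_iff₀ hn, add_mul, div_mul_cancel₀ _ hn.ne'] at h2
    have h3 : ‖((equiv E n (u j) - equiv E n (u k) : E.dom) : Lp ℝ 2 μ)‖ ^ 2 * 1 ≤
        ‖((equiv E n (u j) - equiv E n (u k) : E.dom) : Lp ℝ 2 μ)‖ ^ 2 * (n + 1) := by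
      gcongr
      simp
    linarith)
  refine ⟨(equiv E n).symm v, ?_⟩
  rw [tendsto_iff_norm_sub_tendsto_zero]
  have h1 : Tendsto (fun k => ‖u k - (equiv E n).symm v‖ ^ 2) atTop (𝓝 0) := by
    refine squeeze_zero (fun _ => by positivity) (fun k => ?_) hv
    rw [norm_sq, map_sub, LinearEquiv.apply_symm_apply]
    gcongr
    exact div_le_self (E.nonneg _) (by simp)
  simpa [Real.sqrt_sq] using h1.sqrt

/-- The inclusion of the form space into `L²`. -/
def incl : FormSpace E n →L[ℝ] Lp ℝ 2 μ :=
  LinearMap.mkContinuous (E.dom.subtype ∘ₗ (equiv E n).toLinearMap) 1 (fun u => by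
    rw [one_mul]
    refine le_of_sq_le_sq ?_ (norm_nonneg _)
    rw [norm_sq]
    have := div_nonneg (E.nonneg (equiv E n u)) (by positivity : (0 : ℝ) ≤ n + 1)
    simpa using this)

theorem incl_apply (u : FormSpace E n) : incl E n u = (equiv E n u : Lp ℝ 2 μ) := rfl

end FormSpace

open FormSpace

/-- The resolvent as a map from `L²` into the domain. -/
def resolventDom (n : ℕ) (g : Lp ℝ 2 μ) : E.dom :=
  equiv E n (ContinuousLinearMap.adjoint (incl E n) g)

/-- The resolvent `(1 + L / (n + 1))⁻¹` on `L²`. -/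
def resolvent (n : ℕ) : Lp ℝ 2 μ →L[ℝ] Lp ℝ 2 μ :=
  (incl E n).comp (ContinuousLinearMap.adjoint (incl E n))

theorem coe_resolventDom (n : ℕ) (g : Lp ℝ 2 μ) :
    (E.resolventDom n g : Lp ℝ 2 μ) = E.resolvent n g := rfl

/-- This is the weak form of (1 + L / (n + 1)) Pₙg = g, read off from the adjoint of the inclusion
of the form space in L². -/
theorem resolvent_spec (n : ℕ) (g : Lp ℝ 2 μ) (v : E.dom) :
    E.form (E.resolventDom n g) v / (n + 1) + inner ℝ (E.resolvent n g) (v : Lp ℝ 2 μ) =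
      inner ℝ g (v : Lp ℝ 2 μ) :=
  ContinuousLinearMap.adjoint_inner_left (incl E n) ((equiv E n).symm v) g

theorem resolvent_symm (n : ℕ) (f g : Lp ℝ 2 μ) :
    inner ℝ (E.resolvent n f) g = inner ℝ f (E.resolvent n g) := by
  simp only [resolvent, ContinuousLinearMap.comp_apply]
  rw [← ContinuousLinearMap.adjoint_inner_right, ContinuousLinearMap.adjoint_inner_left]

/-- The approximating form `(n + 1) ⟨u - Pₙ u, v⟩`. -/
def approxForm (n : ℕ) (u v : Lp ℝ 2 μ) : ℝ := (n + 1) * inner ℝ (u - E.resolvent n u) v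

theorem approxForm_eq_form (n : ℕ) (u : Lp ℝ 2 μ) (v : E.dom) :
    E.approxForm n u v = E.form (E.resolventDom n u) v := by
  have h := E.resolvent_spec n u v
  have hn : (0 : ℝ) < n + 1 := by positivity
  rw [approxForm, inner_sub_left, ← h]
  field_simp
  ring

theorem approxForm_self (n : ℕ) (u : Lp ℝ 2 μ) : E.approxForm n u u =
    E.form (E.resolventDom n u) (E.resolventDom n u) + (n + 1) * ‖u - E.resolvent n u‖ ^ 2 := by
  rw [← approxForm_eq_form, coe_resolventDom, approxForm, approxForm, ← mul_add,
    ← real_inner_self_eq_norm_sq, ← inner_add_right]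
  congr 2
  abel

/-- With w = Pₙu - u, the resolvent equation tested against w reads ℰ(w, w) + ℰ(u, w) = -(n +
1)‖w‖². Inserting this into ℰ(u + w, u + w) ≥ 0 gives the claim. It yields both Pₙu → u in L² and an
energy bound uniform in n. -/
theorem form_resolventDom_sub_self (n : ℕ) (u : E.dom) :
    E.form (E.resolventDom n u - u) (E.resolventDom n u - u) +
      2 * ((n + 1) * ‖E.resolvent n (u : Lp ℝ 2 μ) - u‖ ^ 2) ≤ E.form u u := by
  set w := E.resolventDom n (u : Lp ℝ 2 μ) - u with hw
  have hwc : (w : Lp ℝ 2 μ) = E.resolvent n (u : Lp ℝ 2 μ) - u := rfl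
  have h1 := E.approxForm_eq_form n (u : Lp ℝ 2 μ) w
  have h2 : E.approxForm n (u : Lp ℝ 2 μ) w =
      - ((n + 1) * ‖E.resolvent n (u : Lp ℝ 2 μ) - u‖ ^ 2) := by
    rw [approxForm, ← hwc, ← neg_sub (E.resolvent n (u : Lp ℝ 2 μ)), ← hwc, inner_neg_left,
      real_inner_self_eq_norm_sq]
    ring
  have h3 : E.resolventDom n (u : Lp ℝ 2 μ) = w + u := by simp [hw]
  rw [h2, h3, map_add, LinearMap.add_apply] at h1
  have h4 := E.nonneg (u + w)
  simp only [map_add, LinearMap.add_apply] at h4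
  have h5 := E.symm u w
  linarith

theorem tendsto_resolvent (u : E.dom) :
    Tendsto (fun n => E.resolvent n (u : Lp ℝ 2 μ)) atTop (𝓝 (u : Lp ℝ 2 μ)) := by
  rw [tendsto_iff_norm_sub_tendsto_zero]
  have h1 : Tendsto (fun n => ‖E.resolvent n (u : Lp ℝ 2 μ) - u‖ ^ 2) atTop (𝓝 0) := by
    refine squeeze_zero (fun _ => by positivity) (fun n => ?_)
      ((tendsto_one_div_add_atTop_nhds_zero_nat (𝕜 := ℝ)).const_mul (E.form u u) |>.trans
        (by simp))
    have h2 := E.form_resolventDom_sub_self n u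
    have h3 := E.nonneg (E.resolventDom n (u : Lp ℝ 2 μ) - u)
    rw [mul_one_div, le_div_iff₀ (by positivity)]
    have : 0 ≤ (n + 1 : ℝ) * ‖E.resolvent n (u : Lp ℝ 2 μ) - u‖ ^ 2 := by positivity
    linarith
  simpa [Real.sqrt_sq] using h1.sqrt

theorem dense_range_adjoint_incl (n : ℕ) :
    Dense (Set.range (ContinuousLinearMap.adjoint (incl E n))) := by
  have h : (LinearMap.range (ContinuousLinearMap.adjoint (incl E n)).toLinearMap).topologicalClosure = ⊤ := by
    rw [Submodule.topologicalClosure_eq_top_iff, Submodule.eq_bot_iff]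
    intro v hv
    have h1 : incl E n v = 0 := by
      rw [← inner_self_eq_zero (𝕜 := ℝ), ← ContinuousLinearMap.adjoint_inner_left]
      exact (Submodule.mem_orthogonal _ _).1 hv _ ⟨_, rfl⟩
    rw [incl_apply] at h1
    exact (LinearEquiv.map_eq_zero_iff (equiv E n)).1 (Subtype.ext h1)
  rw [← Submodule.dense_iff_topologicalClosure_eq_top] at h
  exact h

/-- A bounded sequence that converges weakly against a dense set converges weakly. -/
theorem tendsto_inner_zero_of_dense {H : Type*} [NormedAddCommGroup H] [InnerProductSpace ℝ H]
    {w : ℕ → H} {C : ℝ} (hw : ∀ n, ‖w n‖ ≤ C) {S : Set H} (hS : Dense S)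
    (h : ∀ s ∈ S, Tendsto (fun n => inner ℝ (w n) s) atTop (𝓝 0)) (v : H) :
    Tendsto (fun n => inner ℝ (w n) v) atTop (𝓝 0) := by
  have hC : 0 ≤ C := (norm_nonneg _).trans (hw 0)
  rw [Metric.tendsto_atTop]
  intro ε hε
  obtain ⟨s, hsv, hs⟩ := Metric.dense_iff.1 hS v (ε / (2 * (C + 1))) (by positivity)
  obtain ⟨N, hN⟩ := Metric.tendsto_atTop.1 (h s hs) (ε / 2) (by positivity)
  refine ⟨N, fun n hn => ?_⟩
  have h1 := hN n hn
  rw [Real.dist_eq, sub_zero] at h1 ⊢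
  have h2 : |inner ℝ (w n) (v - s)| ≤ ε / 2 := by
    refine (abs_real_inner_le_norm _ _).trans ?_
    rw [Metric.mem_ball, dist_comm, dist_eq_norm] at hsv
    calc ‖w n‖ * ‖v - s‖ ≤ (C + 1) * (ε / (2 * (C + 1))) := by
          gcongr
          linarith [hw n]
      _ = ε / 2 := by field_simp
  have h3 : inner ℝ (w n) v = inner ℝ (w n) (v - s) + inner ℝ (w n) s := by
    rw [← inner_add_right, sub_add_cancel]
  rw [h3]
  exact (abs_add_le _ _).trans_lt (by linarith)

/-- The differences Pₙu - u are bounded in the ℰ₁ norm and tend to 0 in L². They therefore tend to 0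
weakly in the form space, because pairing with the dense range of the adjoint inclusion only sees
L². Now ℰ is the ℰ₁ inner product minus the L² one. -/
theorem tendsto_approxForm (u v : E.dom) :
    Tendsto (fun n => E.approxForm n u v) atTop (𝓝 (E.form u v)) := by
  set w : ℕ → FormSpace E 0 := fun n => (equiv E 0).symm (E.resolventDom n u - u) with hw
  have hin : ∀ n, incl E 0 (w n) = E.resolvent n (u : Lp ℝ 2 μ) - u := fun n => rfl
  have hL : Tendsto (fun n => incl E 0 (w n)) atTop (𝓝 0) := by
    simpa [hin] using (E.tendsto_resolvent u).sub_const (u : Lp ℝ 2 μ)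
  have hb : ∀ n, ‖w n‖ ≤ Real.sqrt (E.form u u) := by
    intro n
    apply Real.le_sqrt_of_sq_le
    rw [norm_sq, hw, LinearEquiv.apply_symm_apply]
    refine le_trans ?_ (E.form_resolventDom_sub_self n u)
    rw [Submodule.coe_sub, coe_resolventDom]
    have h0 : (0 : ℝ) ≤ ‖E.resolvent n (u : Lp ℝ 2 μ) - u‖ ^ 2 := by positivity
    have h1 : (0 : ℝ) ≤ n * ‖E.resolvent n (u : Lp ℝ 2 μ) - u‖ ^ 2 := by positivity
    simp only [Nat.cast_zero, zero_add, div_one]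
    linarith
  have h1 := tendsto_inner_zero_of_dense hb (E.dense_range_adjoint_incl 0) (by
    rintro _ ⟨g, rfl⟩
    simp_rw [ContinuousLinearMap.adjoint_inner_right]
    simpa using hL.inner (tendsto_const_nhds (x := g))) ((equiv E 0).symm v)
  have h2 : Tendsto (fun n => inner ℝ (incl E 0 (w n)) (v : Lp ℝ 2 μ)) atTop (𝓝 0) := by
    simpa using hL.inner (tendsto_const_nhds (x := (v : Lp ℝ 2 μ)))
  have h3 := (h1.sub h2).add_const (E.form u v)
  rw [sub_zero, zero_add] at h3
  refine h3.congr fun n => ?_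
  rw [inner_def, approxForm_eq_form, incl_apply, hw]
  simp

/-- An `L²` function along which the approximating forms stay bounded lies in the domain. -/
theorem mem_dom_of_approxForm_le (u : Lp ℝ 2 μ) {C : ℝ} (h : ∀ n, E.approxForm n u u ≤ C) :
    u ∈ E.dom := by
  have hform : ∀ n, E.form (E.resolventDom n u) (E.resolventDom n u) ≤ C := fun n => by
    have h1 := h n
    rw [approxForm_self] at h1
    have : (0 : ℝ) ≤ (n + 1) * ‖u - E.resolvent n u‖ ^ 2 := by positivity
    linarith
  have hC : 0 ≤ C := (E.nonneg _).trans (hform 0)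
  have hdist : ∀ n : ℕ, (n + 1) * ‖E.resolvent n u - u‖ ^ 2 ≤ C := fun n => by
    have h1 := h n
    rw [approxForm_self] at h1
    have := E.nonneg (E.resolventDom n u)
    rw [norm_sub_rev]
    linarith
  have hlim : Tendsto (fun n => E.resolvent n u) atTop (𝓝 u) := by
    rw [tendsto_iff_norm_sub_tendsto_zero]
    have h1 : Tendsto (fun n => ‖E.resolvent n u - u‖ ^ 2) atTop (𝓝 0) := by
      refine squeeze_zero (fun _ => by positivity) (fun n => ?_)
        ((tendsto_one_div_add_atTop_nhds_zero_nat (𝕜 := ℝ)).const_mul C |>.trans (by simp))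
      rw [mul_one_div, le_div_iff₀ (by positivity), mul_comm]
      exact hdist n
    simpa [Real.sqrt_sq] using h1.sqrt
  obtain ⟨M, hM⟩ := (Metric.isBounded_range_of_tendsto _ hlim).exists_norm_le
  set w : ℕ → FormSpace E 0 := fun n => (equiv E 0).symm (E.resolventDom n u) with hw
  have hin : ∀ n, incl E 0 (w n) = E.resolvent n u := fun n => rfl
  have hb : ∀ n, ‖w n‖ ≤ Real.sqrt (C + M ^ 2) := by
    intro n
    apply Real.le_sqrt_of_sq_le
    rw [norm_sq, hw, LinearEquiv.apply_symm_apply, coe_resolventDom]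
    simp only [Nat.cast_zero, zero_add, div_one]
    have := hM _ ⟨n, rfl⟩
    have := hform n
    gcongr
  -- The vectors Pₙu are bounded in the form space, so Banach-Alaoglu gives a weak limit v along an
  -- ultrafilter. Its image in L² must be the strong limit u.
  set f : ℕ → WeakDual ℝ (FormSpace E 0) := fun n =>
    StrongDual.toWeakDual (InnerProductSpace.toDual ℝ (FormSpace E 0) (w n)) with hf
  obtain ⟨ℓ, -, hℓ⟩ := (WeakDual.isCompact_closedBall (𝕜 := ℝ) (E := FormSpace E 0) 0
    (Real.sqrt (C + M ^ 2))).ultrafilter_le_nhds ((hyperfilter ℕ).map f) (by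
      rw [Ultrafilter.coe_map, Filter.le_principal_iff, Filter.mem_map]
      refine Filter.univ_mem' fun n => ?_
      simp only [Set.mem_preimage, mem_closedBall_iff_norm, sub_zero, hf]
      simpa using hb n)
  set v : FormSpace E 0 := (InnerProductSpace.toDual ℝ (FormSpace E 0)).symm
    (WeakDual.toStrongDual ℓ) with hv
  have key : incl E 0 v = u := by
    refine ext_inner_right ℝ fun g => ?_
    rw [← ContinuousLinearMap.adjoint_inner_right, hv, InnerProductSpace.toDual_symm_apply]
    have h1 : Tendsto (fun n => f n (ContinuousLinearMap.adjoint (incl E 0) g))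
        (hyperfilter ℕ : Filter ℕ) (𝓝 (ℓ (ContinuousLinearMap.adjoint (incl E 0) g))) :=
      ((WeakDual.eval_continuous (𝕜 := ℝ) (ContinuousLinearMap.adjoint (incl E 0) g)).tendsto
        ℓ).comp hℓ
    have h2 : Tendsto (fun n => f n (ContinuousLinearMap.adjoint (incl E 0) g))
        atTop (𝓝 (inner ℝ u g)) := by
      refine (hlim.inner (tendsto_const_nhds (x := g))).congr fun n => ?_
      rw [← hin, ← ContinuousLinearMap.adjoint_inner_right]
      rfl
    exact tendsto_nhds_unique h1 (h2.mono_left Nat.hyperfilter_le_atTop)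
  rw [← key, incl_apply]
  exact (equiv E 0 v).2

end Resolvent

end DirichletForm

/-! ### The Markov property of the resolvent. -/

namespace DirichletForm

section Markov

variable {X : Type*} [MeasurableSpace X] {μ : Measure X} (E : DirichletForm μ)

/-- Pₙg is the unique minimiser of w ↦ ℰ(w, w) / (n + 1) + ‖w - g‖². For 0 ≤ g ≤ 1 the unit
contraction increases neither term, so Pₙg coincides with its own contraction. -/
theorem resolvent_mem_unitInterval (n : ℕ) {g : Lp ℝ 2 μ} (h0 : ∀ᵐ x ∂μ, 0 ≤ g x)
    (h1 : ∀ᵐ x ∂μ, g x ≤ 1) :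
    ∀ᵐ x ∂μ, 0 ≤ E.resolvent n g x ∧ E.resolvent n g x ≤ 1 := by
  have hn : (0 : ℝ) < n + 1 := by positivity
  set w := E.resolventDom n g with hw
  have hwc : (w : Lp ℝ 2 μ) = E.resolvent n g := rfl
  obtain ⟨v, hv, hvw⟩ := E.markov w
  have hdist : ‖(v : Lp ℝ 2 μ) - g‖ ≤ ‖(w : Lp ℝ 2 μ) - g‖ := by
    refine Lp.norm_le_norm_of_ae_le ?_
    filter_upwards [h0, h1, hv, Lp.coeFn_sub (v : Lp ℝ 2 μ) g, Lp.coeFn_sub (w : Lp ℝ 2 μ) g]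
      with x h0 h1 hv h2 h3
    rw [h2, h3, Pi.sub_apply, Pi.sub_apply, hv, Real.norm_eq_abs, Real.norm_eq_abs]
    rcases le_total 0 ((w : Lp ℝ 2 μ) x) with h | h
    · rw [max_eq_right h]
      rcases le_total ((w : Lp ℝ 2 μ) x) 1 with h' | h'
      · rw [min_eq_left h']
      · rw [min_eq_right h', abs_of_nonneg (by linarith), abs_of_nonneg (by linarith)]
        linarith
    · rw [max_eq_left h, min_eq_left zero_le_one, abs_of_nonpos (by linarith),
        abs_of_nonpos (by linarith)]
      linarith
  set d := v - w with hd
  have hvd : v = w + d := by simp [hd]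
  have hsp := E.resolvent_spec n g d
  have e1 : E.form v v = E.form w w + 2 * E.form w d + E.form d d := by
    rw [hvd]
    simp only [map_add, LinearMap.add_apply]
    rw [E.symm d w]
    ring
  have e2 : ‖(v : Lp ℝ 2 μ) - g‖ ^ 2 = ‖(w : Lp ℝ 2 μ) - g‖ ^ 2 +
      2 * (inner ℝ (w : Lp ℝ 2 μ) (d : Lp ℝ 2 μ) - inner ℝ g (d : Lp ℝ 2 μ)) +
        ‖(d : Lp ℝ 2 μ)‖ ^ 2 := by
    have : (v : Lp ℝ 2 μ) - g = ((w : Lp ℝ 2 μ) - g) + d := by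
      rw [hvd, Submodule.coe_add]
      abel
    rw [this, norm_add_sq_real, inner_sub_left]
  have e3 : ‖(v : Lp ℝ 2 μ) - g‖ ^ 2 ≤ ‖(w : Lp ℝ 2 μ) - g‖ ^ 2 := by gcongr
  rw [← hwc, ← hw] at hsp
  have e4 : 2 * (E.form w d / (n + 1)) + E.form d d / (n + 1) ≤ 0 := by
    have : 2 * (E.form w d / (n + 1)) + E.form d d / (n + 1) =
      (2 * E.form w d + E.form d d) / (n + 1) := by ring
    rw [this]
    exact div_nonpos_of_nonpos_of_nonneg (by linarith) hn.le
  have e5 : 0 ≤ E.form d d / (n + 1) := div_nonneg (E.nonneg d) hn.le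
  have e6 : ‖(d : Lp ℝ 2 μ)‖ ^ 2 ≤ 0 := by linarith
  have e7 : (d : Lp ℝ 2 μ) = 0 := by
    rw [← norm_eq_zero]
    exact pow_eq_zero_iff two_ne_zero |>.1 (le_antisymm e6 (by positivity))
  have e8 : (v : Lp ℝ 2 μ) = w := by rw [hvd, Submodule.coe_add, e7, add_zero]
  rw [← hwc, ← e8]
  filter_upwards [hv] with x hx
  rw [hx]
  exact ⟨le_min (le_max_left _ _) zero_le_one, min_le_right _ _⟩

theorem resolvent_mem_Icc (n : ℕ) {g : Lp ℝ 2 μ} {K : ℝ} (hK : 0 ≤ K)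
    (h0 : ∀ᵐ x ∂μ, 0 ≤ g x) (h1 : ∀ᵐ x ∂μ, g x ≤ K) :
    ∀ᵐ x ∂μ, 0 ≤ E.resolvent n g x ∧ E.resolvent n g x ≤ K := by
  rcases hK.eq_or_lt with rfl | hK
  · have : g = 0 := by
      apply Lp.ext
      filter_upwards [h0, h1, Lp.coeFn_zero ℝ 2 μ] with x h0 h1 h2
      rw [h2]
      exact le_antisymm h1 h0
    rw [this, map_zero]
    filter_upwards [Lp.coeFn_zero ℝ 2 μ] with x h
    rw [h]
    simp
  · have h2 := E.resolvent_mem_unitInterval n (g := K⁻¹ • g)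
      (by
        filter_upwards [h0, Lp.coeFn_smul K⁻¹ g] with x h0 h
        rw [h, Pi.smul_apply, smul_eq_mul]
        positivity)
      (by
        filter_upwards [h1, Lp.coeFn_smul K⁻¹ g] with x h1 h
        rw [h, Pi.smul_apply, smul_eq_mul, inv_mul_le_iff₀ hK]
        simpa using h1)
    rw [map_smul] at h2
    filter_upwards [h2, Lp.coeFn_smul K⁻¹ (E.resolvent n g)] with x h2 h
    rw [h, Pi.smul_apply, smul_eq_mul, inv_mul_le_iff₀ hK, mul_one] at h2
    exact ⟨nonneg_of_mul_nonneg_right h2.1 (by positivity), h2.2⟩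

theorem approxForm_add_right (n : ℕ) (w u v : Lp ℝ 2 μ) :
    E.approxForm n w (u + v) = E.approxForm n w u + E.approxForm n w v := by
  simp only [approxForm, inner_add_right]
  ring

theorem approxForm_sub_right (n : ℕ) (w u v : Lp ℝ 2 μ) :
    E.approxForm n w (u - v) = E.approxForm n w u - E.approxForm n w v := by
  simp only [approxForm, inner_sub_right]
  ring

theorem approxForm_smul_right (n : ℕ) (c : ℝ) (w u : Lp ℝ 2 μ) :
    E.approxForm n w (c • u) = c * E.approxForm n w u := by
  simp only [approxForm, inner_smul_right]
  ring

end Markov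

/-! ### Dominated functions, the algebra 𝒞 and cutoffs. -/

section Contraction

variable {X : Type*} [MetricSpace X] [MeasurableSpace X] [BorelSpace X] {μ : Measure X}
  [μ.Regular]

theorem coeFn_ccToLp (f : C_c(X, ℝ)) : (ccToLp μ f : X → ℝ) =ᵐ[μ] f :=
  MemLp.coeFn_toLp (f.continuous.memLp_of_hasCompactSupport f.hasCompactSupport)

theorem inner_ccToLp (f : C_c(X, ℝ)) (w : Lp ℝ 2 μ) :
    inner ℝ (ccToLp μ f) w = ∫ x, f x * w x ∂μ := by
  rw [L2.inner_def]
  refine integral_congr_ae ?_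
  filter_upwards [coeFn_ccToLp (μ := μ) f] with x hx
  rw [hx, real_inner_eq_re_inner]
  simp [mul_comm]

theorem integrable_mul_Lp (f : C_c(X, ℝ)) (w : Lp ℝ 2 μ) :
    Integrable (fun x => f x * w x) μ := by
  refine (L2.integrable_inner (𝕜 := ℝ) (ccToLp μ f) w).congr ?_
  filter_upwards [coeFn_ccToLp (μ := μ) f] with x hx
  rw [hx]
  simp [mul_comm]

variable (E : DirichletForm μ)

/-- Constants need not lie in L², so the bound comes from h = h⁺ - h⁻: Pₙh⁺ ≥ 0, and Pₙh⁻ ≤ K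
because h⁻ ≤ K. -/
theorem neg_le_resolvent (n : ℕ) {h : C_c(X, ℝ)} {K : ℝ} (hK : 0 ≤ K) (hh : ∀ x, -K ≤ h x) :
    ∀ᵐ x ∂μ, -K ≤ E.resolvent n (ccToLp μ h) x := by
  obtain ⟨C, hC⟩ := h.hasCompactSupport.exists_bound_of_continuous h.continuous
  have hdec : h = (h ⊔ 0) - ((-h) ⊔ 0) := by
    ext x
    simp only [CompactlySupportedContinuousMap.sub_apply,
      CompactlySupportedContinuousMap.sup_apply, CompactlySupportedContinuousMap.neg_apply,
      CompactlySupportedContinuousMap.zero_apply]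
    rcases le_total 0 (h x) with h | h <;> simp [h]
  have hp := E.resolvent_mem_Icc n (g := ccToLp μ (h ⊔ 0)) (K := |C|) (abs_nonneg _)
    (by
      filter_upwards [coeFn_ccToLp (μ := μ) (h ⊔ 0)] with x hx
      rw [hx]
      simp)
    (by
      filter_upwards [coeFn_ccToLp (μ := μ) (h ⊔ 0)] with x hx
      rw [hx]
      simp only [CompactlySupportedContinuousMap.sup_apply,
        CompactlySupportedContinuousMap.zero_apply]
      exact max_le ((le_abs_self _).trans ((hC x).trans (le_abs_self _))) (abs_nonneg _))
  have hm := E.resolvent_mem_Icc n (g := ccToLp μ ((-h) ⊔ 0)) (K := K) hK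
    (by
      filter_upwards [coeFn_ccToLp (μ := μ) ((-h) ⊔ 0)] with x hx
      rw [hx]
      simp)
    (by
      filter_upwards [coeFn_ccToLp (μ := μ) ((-h) ⊔ 0)] with x hx
      rw [hx]
      simp only [CompactlySupportedContinuousMap.sup_apply,
        CompactlySupportedContinuousMap.zero_apply, CompactlySupportedContinuousMap.neg_apply]
      exact max_le (by linarith [hh x]) hK)
  have e : E.resolvent n (ccToLp μ h) =
      E.resolvent n (ccToLp μ (h ⊔ 0)) - E.resolvent n (ccToLp μ ((-h) ⊔ 0)) := by
    rw [← map_sub, ← map_sub, ← hdec]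
  rw [e]
  filter_upwards [hp, hm, Lp.coeFn_sub (E.resolvent n (ccToLp μ (h ⊔ 0)))
    (E.resolvent n (ccToLp μ ((-h) ⊔ 0)))] with x h1 h2 h3
  rw [h3, Pi.sub_apply]
  linarith [h1.1, h2.2]

/-- The approximate carré du champ `u² - 2 u Pₙ u + Pₙ (u²)`. -/
def approxSq (n : ℕ) (u : C_c(X, ℝ)) (x : X) : ℝ :=
  u x ^ 2 - 2 * (u x * E.resolvent n (ccToLp μ u) x) + E.resolvent n (ccToLp μ (u * u)) x

/-- The squared increments and values of `u` are dominated by those of `f` and `g`. -/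
structure IsDominated (A B : ℝ) (f g u : C_c(X, ℝ)) : Prop where
  nonneg_left : 0 ≤ A
  nonneg_right : 0 ≤ B
  diff_le : ∀ x y, (u x - u y) ^ 2 ≤ A * (f x - f y) ^ 2 + B * (g x - g y) ^ 2
  sq_le : ∀ x, u x ^ 2 ≤ A * f x ^ 2 + B * g x ^ 2

theorem resolvent_sq_sub (n : ℕ) (f : C_c(X, ℝ)) (c : ℝ) :
    ∀ᵐ x ∂μ, E.resolvent n (ccToLp μ (f * f - (2 * c) • f)) x =
      E.resolvent n (ccToLp μ (f * f)) x - 2 * c * E.resolvent n (ccToLp μ f) x := by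
  rw [map_sub, map_smul, map_sub, map_smul]
  filter_upwards [Lp.coeFn_sub (E.resolvent n (ccToLp μ (f * f)))
    ((2 * c) • E.resolvent n (ccToLp μ f)), Lp.coeFn_smul (2 * c) (E.resolvent n (ccToLp μ f))]
    with x h1 h2
  rw [h1, Pi.sub_apply, h2, Pi.smul_apply, smul_eq_mul]

/-- If Pₙ had a kernel p, `approxSq` at x would be ∫ (u(x) - u(y))² p(x, dy) + u(x)² (1 - p(x, X)),
which explains the two conditions of domination. Without a kernel, the value at one argument is
frozen at y: expanding the increment condition bounds a combination of functions below by a constant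
-K, with K ≥ 0 by the condition on values, and Pₙ preserves this bound. The null sets are collected
over a countable dense set of y, and continuity in y then allows y = x. -/
theorem approxSq_le [SecondCountableTopology X] (n : ℕ) {A B : ℝ} {f g u : C_c(X, ℝ)}
    (h : IsDominated A B f g u) :
    ∀ᵐ x ∂μ, E.approxSq n u x ≤ A * E.approxSq n f x + B * E.approxSq n g x := by
  obtain ⟨D, hDc, hD⟩ := TopologicalSpace.exists_countable_dense X
  have key : ∀ y ∈ D, ∀ᵐ x ∂μ,
      u y ^ 2 - 2 * (u y * E.resolvent n (ccToLp μ u) x) + E.resolvent n (ccToLp μ (u * u)) x ≤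
      A * (f y ^ 2 - 2 * (f y * E.resolvent n (ccToLp μ f) x)
        + E.resolvent n (ccToLp μ (f * f)) x) +
      B * (g y ^ 2 - 2 * (g y * E.resolvent n (ccToLp μ g) x)
        + E.resolvent n (ccToLp μ (g * g)) x) := by
    intro y _
    have h1 := E.neg_le_resolvent n
      (h := A • (f * f - (2 * f y) • f) + B • (g * g - (2 * g y) • g) - (u * u - (2 * u y) • u))
      (K := A * f y ^ 2 + B * g y ^ 2 - u y ^ 2) (by linarith [h.sq_le y]) (by
        intro x
        have := h.diff_le x y
        simp only [CompactlySupportedContinuousMap.sub_apply,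
          CompactlySupportedContinuousMap.add_apply, CompactlySupportedContinuousMap.smul_apply,
          CompactlySupportedContinuousMap.mul_apply, smul_eq_mul]
        nlinarith)
    rw [map_sub, map_add, map_smul, map_smul, map_sub, map_add, map_smul, map_smul] at h1
    filter_upwards [h1, E.resolvent_sq_sub n f (f y), E.resolvent_sq_sub n g (g y),
      E.resolvent_sq_sub n u (u y),
      Lp.coeFn_sub (A • E.resolvent n (ccToLp μ (f * f - (2 * f y) • f)) +
        B • E.resolvent n (ccToLp μ (g * g - (2 * g y) • g)))
        (E.resolvent n (ccToLp μ (u * u - (2 * u y) • u))),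
      Lp.coeFn_add (A • E.resolvent n (ccToLp μ (f * f - (2 * f y) • f)))
        (B • E.resolvent n (ccToLp μ (g * g - (2 * g y) • g))),
      Lp.coeFn_smul A (E.resolvent n (ccToLp μ (f * f - (2 * f y) • f))),
      Lp.coeFn_smul B (E.resolvent n (ccToLp μ (g * g - (2 * g y) • g)))]
      with x h1 hf hg hu h2 h3 h4 h5
    rw [h2, Pi.sub_apply, h3, Pi.add_apply, h4, h5, Pi.smul_apply, Pi.smul_apply, hf, hg, hu,
      smul_eq_mul, smul_eq_mul] at h1
    linarith
  filter_upwards [(ae_ball_iff hDc).2 key] with x hx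
  have hcl : IsClosed {y | u y ^ 2 - 2 * (u y * E.resolvent n (ccToLp μ u) x)
        + E.resolvent n (ccToLp μ (u * u)) x ≤
      A * (f y ^ 2 - 2 * (f y * E.resolvent n (ccToLp μ f) x)
        + E.resolvent n (ccToLp μ (f * f)) x) +
      B * (g y ^ 2 - 2 * (g y * E.resolvent n (ccToLp μ g) x)
        + E.resolvent n (ccToLp μ (g * g)) x)} := by
    have := u.continuous
    have := f.continuous
    have := g.continuous
    exact isClosed_le (by fun_prop) (by fun_prop)
  exact hcl.closure_subset_iff.2 (fun y hy => hx y hy) (hD x)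

theorem integrable_mul_approxSq (n : ℕ) (φ u : C_c(X, ℝ)) :
    Integrable (fun x => φ x * E.approxSq n u x) μ := by
  have h1 := integrable_mul_Lp (μ := μ) φ (E.resolvent n (ccToLp μ (u * u)))
  have h2 := integrable_mul_Lp (μ := μ) (φ * u) (E.resolvent n (ccToLp μ u))
  have h3 : Integrable (φ * u * u : C_c(X, ℝ)) μ :=
    (φ * u * u).continuous.integrable_of_hasCompactSupport (φ * u * u).hasCompactSupport
  refine ((h3.sub (h2.const_mul 2)).add h1).congr (ae_of_all _ fun x => ?_)
  simp only [approxSq, Pi.add_apply, Pi.sub_apply, CompactlySupportedContinuousMap.mul_apply]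
  ring

/-- `approxSq` is, up to the factor (n + 1) / 2, the density of the energy measure of the
approximating form. The symmetry of Pₙ moves it from φu and φ onto u and u². -/
theorem approxForm_carre (n : ℕ) (φ u : C_c(X, ℝ)) :
    E.approxForm n (ccToLp μ (φ * u)) (ccToLp μ u)
      - (1 / 2) * E.approxForm n (ccToLp μ φ) (ccToLp μ (u * u)) =
    (n + 1) / 2 * ∫ x, φ x * E.approxSq n u x ∂μ := by
  have h1 := integrable_mul_Lp (μ := μ) φ (E.resolvent n (ccToLp μ (u * u)))
  have h2 := integrable_mul_Lp (μ := μ) (φ * u) (E.resolvent n (ccToLp μ u))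
  have h3 : Integrable (φ * u * u : C_c(X, ℝ)) μ :=
    (φ * u * u).continuous.integrable_of_hasCompactSupport (φ * u * u).hasCompactSupport
  have e1 : inner ℝ (ccToLp μ (φ * u)) (ccToLp μ u) = ∫ x, (φ * u * u) x ∂μ := by
    rw [inner_ccToLp]
    refine integral_congr_ae ?_
    filter_upwards [coeFn_ccToLp (μ := μ) u] with x hx
    rw [hx]
    rfl
  have e2 : inner ℝ (ccToLp μ φ) (ccToLp μ (u * u)) = ∫ x, (φ * u * u) x ∂μ := by
    rw [inner_ccToLp]
    refine integral_congr_ae ?_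
    filter_upwards [coeFn_ccToLp (μ := μ) (u * u)] with x hx
    rw [hx]
    simp only [CompactlySupportedContinuousMap.mul_apply]
    ring
  have e3 : ∫ x, φ x * E.approxSq n u x ∂μ = ∫ x, (φ * u * u) x ∂μ -
      2 * ∫ x, (φ * u) x * E.resolvent n (ccToLp μ u) x ∂μ +
        ∫ x, φ x * E.resolvent n (ccToLp μ (u * u)) x ∂μ := by
    have h4 : Integrable (fun x => (φ * u * u) x -
      2 * ((φ * u) x * E.resolvent n (ccToLp μ u) x)) μ := h3.sub (h2.const_mul 2)
    rw [← integral_const_mul, ← integral_sub h3 (h2.const_mul 2), ← integral_add h4 h1]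
    refine integral_congr_ae (ae_of_all _ fun x => ?_)
    simp only [approxSq, CompactlySupportedContinuousMap.mul_apply]
    ring
  rw [approxForm, approxForm, inner_sub_left, inner_sub_left, resolvent_symm, resolvent_symm, e1,
    e2, inner_ccToLp, inner_ccToLp, e3]
  ring

theorem carre_approx_le [SecondCountableTopology X] (n : ℕ) {A B : ℝ} {f g u φ : C_c(X, ℝ)}
    (h : IsDominated A B f g u) (hφ : ∀ x, 0 ≤ φ x) :
    ∫ x, φ x * E.approxSq n u x ∂μ ≤ A * ∫ x, φ x * E.approxSq n f x ∂μ +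
      B * ∫ x, φ x * E.approxSq n g x ∂μ := by
  rw [← integral_const_mul, ← integral_const_mul, ← integral_add
    ((E.integrable_mul_approxSq n φ f).const_mul A) ((E.integrable_mul_approxSq n φ g).const_mul B)]
  refine integral_mono_ae (E.integrable_mul_approxSq n φ u)
    (((E.integrable_mul_approxSq n φ f).const_mul A).add
      ((E.integrable_mul_approxSq n φ g).const_mul B)) ?_
  filter_upwards [E.approxSq_le n h] with x hx
  have := mul_le_mul_of_nonneg_left hx (hφ x)
  linarith

/-- Wherever k does not vanish, φ = 1 ≥ Pₙφ. This is the killing part of the approximating form. -/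
theorem approxForm_nonneg_of_eq_one (n : ℕ) {φ k : C_c(X, ℝ)} (h0 : ∀ x, 0 ≤ φ x)
    (h1 : ∀ x, φ x ≤ 1) (hk : ∀ x, 0 ≤ k x) (hφk : ∀ x, k x ≠ 0 → φ x = 1) :
    0 ≤ E.approxForm n (ccToLp μ φ) (ccToLp μ k) := by
  rw [approxForm, real_inner_comm, inner_ccToLp]
  refine mul_nonneg (by positivity) (integral_nonneg_of_ae ?_)
  filter_upwards [Lp.coeFn_sub (ccToLp μ φ) (E.resolvent n (ccToLp μ φ)),
    coeFn_ccToLp (μ := μ) φ, E.resolvent_mem_unitInterval n (g := ccToLp μ φ)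
      (by filter_upwards [coeFn_ccToLp (μ := μ) φ] with x hx; rw [hx]; exact h0 x)
      (by filter_upwards [coeFn_ccToLp (μ := μ) φ] with x hx; rw [hx]; exact h1 x)]
    with x h2 h3 h4
  rw [h2, Pi.sub_apply, h3]
  by_cases hx : k x = 0
  · simp [hx]
  · have := hk x
    rw [hφk x hx]
    exact mul_nonneg this (by linarith [h4.2])

/-- A cutoff ψ equal to 1 on the supports replaces the constant 1. Then `approxForm_carre` splits
the form at u into a jump part, compared by `carre_approx_le`, and the killing part ½ (n + 1)⟨ψ -
Pₙψ, u²⟩, compared through A f² + B g² - u² ≥ 0. -/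
theorem approxForm_le [LocallyCompactSpace X] [SecondCountableTopology X] (n : ℕ) {A B : ℝ}
    {f g u : C_c(X, ℝ)} (h : IsDominated A B f g u) :
    E.approxForm n (ccToLp μ u) (ccToLp μ u) ≤ A * E.approxForm n (ccToLp μ f) (ccToLp μ f) +
      B * E.approxForm n (ccToLp μ g) (ccToLp μ g) := by
  obtain ⟨φ, hφ1, -, hφc, hφ⟩ := exists_continuous_one_zero_of_isCompact
    (f.hasCompactSupport.isCompact.union g.hasCompactSupport.isCompact) isClosed_empty
    (Set.disjoint_empty _)
  set ψ : C_c(X, ℝ) := ⟨φ, hφc⟩ with hψ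
  have hψφ : ∀ x, ψ x = φ x := fun x => rfl
  have hf : ∀ x, f x ≠ 0 → ψ x = 1 := fun x hx => hφ1 (Or.inl (subset_tsupport _ hx))
  have hg : ∀ x, g x ≠ 0 → ψ x = 1 := fun x hx => hφ1 (Or.inr (subset_tsupport _ hx))
  have hu : ∀ x, u x ≠ 0 → ψ x = 1 := by
    intro x hx
    by_contra hc
    have h1 : f x = 0 := by
      by_contra h1
      exact hc (hf x h1)
    have h2 : g x = 0 := by
      by_contra h2
      exact hc (hg x h2)
    have h3 := h.sq_le x
    rw [h1, h2] at h3
    have : 0 < u x ^ 2 := by positivity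
    linarith
  have hmul : ∀ w : C_c(X, ℝ), (∀ x, w x ≠ 0 → ψ x = 1) → ψ * w = w := by
    intro w hw
    ext x
    rw [CompactlySupportedContinuousMap.mul_apply]
    by_cases hx : w x = 0
    · simp [hx]
    · rw [hw x hx, one_mul]
  have cf := E.approxForm_carre n ψ f
  have cg := E.approxForm_carre n ψ g
  have cu := E.approxForm_carre n ψ u
  rw [hmul f hf] at cf
  rw [hmul g hg] at cg
  rw [hmul u hu] at cu
  have h1 := E.carre_approx_le n h (φ := ψ) (fun x => (hφ x).1)
  have h2 := E.approxForm_nonneg_of_eq_one n (φ := ψ)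
    (k := A • (f * f) + B • (g * g) - u * u) (fun x => (hφ x).1) (fun x => (hφ x).2)
    (fun x => by
      simp only [CompactlySupportedContinuousMap.sub_apply,
          CompactlySupportedContinuousMap.add_apply, CompactlySupportedContinuousMap.smul_apply,
          CompactlySupportedContinuousMap.mul_apply, smul_eq_mul]
      linarith [h.sq_le x])
    (fun x hx => by
      by_contra hc
      have h1 : f x = 0 := by
        by_contra h1
        exact hc (hf x h1)
      have h2 : g x = 0 := by
        by_contra h2
        exact hc (hg x h2)
      have h3 : u x = 0 := by
        by_contra h3
        exact hc (hu x h3)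
      simp [h1, h2, h3] at hx)
  rw [map_sub, map_add, map_smul, map_smul, approxForm_sub_right, approxForm_add_right,
    approxForm_smul_right, approxForm_smul_right] at h2
  have h3 := mul_le_mul_of_nonneg_left h1 (by positivity : (0 : ℝ) ≤ (n + 1) / 2)
  rw [mul_add, mul_left_comm _ A, mul_left_comm _ B, ← cf, ← cg, ← cu] at h3
  linarith

variable {E} [LocallyCompactSpace X] [SecondCountableTopology X] {A B : ℝ} {f g : E.core}
  {u : C_c(X, ℝ)}

theorem tendsto_approxForm_core (f g : E.core) :
    Tendsto (fun n => E.approxForm n (ccToLp μ f.1) (ccToLp μ g.1)) atTop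
      (𝓝 (E.coreForm f g)) :=
  E.tendsto_approxForm (E.coreToDom f) (E.coreToDom g)

/-- The approximate energies of f and g converge, hence are bounded, and they bound those of u.
Products and Lipschitz images of elements of 𝒞 are special cases. -/
theorem IsDominated.mem_core (h : IsDominated A B f.1 g.1 u) : u ∈ E.core := by
  obtain ⟨F, hF⟩ := (tendsto_approxForm_core f f).bddAbove_range
  obtain ⟨G, hG⟩ := (tendsto_approxForm_core g g).bddAbove_range
  refine E.mem_dom_of_approxForm_le (C := A * F + B * G) _ fun n => ?_
  refine (E.approxForm_le n h).trans ?_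
  have := h.nonneg_left
  have := h.nonneg_right
  have := hF ⟨n, rfl⟩
  have := hG ⟨n, rfl⟩
  gcongr

theorem isDominated_lipschitz (f : C_c(X, ℝ)) {F : C(ℝ, ℝ)} (hF0 : F 0 = 0) {L : ℝ}
    (hF : ∀ s t, |F s - F t| ≤ L * |s - t|) : IsDominated (L ^ 2) 0 f f (f.compLeft F) := by
  have h1 : ∀ s t, (F s - F t) ^ 2 ≤ L ^ 2 * (s - t) ^ 2 := fun s t => by
    rw [← sq_abs, ← sq_abs (s - t), ← mul_pow]
    exact pow_le_pow_left₀ (abs_nonneg _) (hF s t) 2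
  refine ⟨by positivity, le_rfl, fun x y => ?_, fun x => ?_⟩
  · rw [CompactlySupportedContinuousMap.compLeft_apply hF0,
      CompactlySupportedContinuousMap.compLeft_apply hF0]
    simpa using h1 (f x) (f y)
  · rw [CompactlySupportedContinuousMap.compLeft_apply hF0]
    simpa [hF0] using h1 (f x) 0

theorem isDominated_mul {f g : C_c(X, ℝ)} {K L : ℝ} (hf : ∀ x, |f x| ≤ K) (hg : ∀ x, |g x| ≤ L) :
    IsDominated (2 * L ^ 2) (2 * K ^ 2) f g (f * g) := by
  refine ⟨by positivity, by positivity, fun x y => ?_, fun x => ?_⟩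
  · have h1 : f y ^ 2 ≤ K ^ 2 := sq_le_sq' (by linarith [neg_le_of_abs_le (hf y)])
      (le_of_abs_le (hf y))
    have h2 : g x ^ 2 ≤ L ^ 2 := sq_le_sq' (by linarith [neg_le_of_abs_le (hg x)])
      (le_of_abs_le (hg x))
    rw [CompactlySupportedContinuousMap.mul_apply, CompactlySupportedContinuousMap.mul_apply]
    calc (f x * g x - f y * g y) ^ 2 = ((f x - f y) * g x + f y * (g x - g y)) ^ 2 := by ring
      _ ≤ 2 * ((f x - f y) * g x) ^ 2 + 2 * (f y * (g x - g y)) ^ 2 := by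
        nlinarith [sq_nonneg ((f x - f y) * g x - f y * (g x - g y))]
      _ = 2 * (g x ^ 2) * (f x - f y) ^ 2 + 2 * f y ^ 2 * (g x - g y) ^ 2 := by ring
      _ ≤ _ := by gcongr
  · have h2 : g x ^ 2 ≤ L ^ 2 := sq_le_sq' (by linarith [neg_le_of_abs_le (hg x)])
      (le_of_abs_le (hg x))
    rw [CompactlySupportedContinuousMap.mul_apply, mul_pow]
    have := mul_le_mul_of_nonneg_left h2 (sq_nonneg (f x))
    have h3 : 0 ≤ L ^ 2 * f x ^ 2 := by positivity
    have h4 : 0 ≤ K ^ 2 * g x ^ 2 := by positivity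
    linarith

theorem exists_abs_le (f : C_c(X, ℝ)) : ∃ C, 0 ≤ C ∧ ∀ x, |f x| ≤ C := by
  obtain ⟨C, hC⟩ := f.hasCompactSupport.exists_bound_of_continuous f.continuous
  exact ⟨|C|, abs_nonneg _, fun x => (hC x).trans (le_abs_self _)⟩

theorem mul_mem_core {f g : C_c(X, ℝ)} (hf : f ∈ E.core) (hg : g ∈ E.core) : f * g ∈ E.core := by
  obtain ⟨K, -, hK⟩ := exists_abs_le f
  obtain ⟨L, -, hL⟩ := exists_abs_le g
  exact IsDominated.mem_core (f := ⟨f, hf⟩) (g := ⟨g, hg⟩) (isDominated_mul hK hL)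

instance : Mul E.core := ⟨fun f g => ⟨f.1 * g.1, mul_mem_core f.2 g.2⟩⟩

theorem core_ext {f g : E.core} (h : ∀ x, f.1 x = g.1 x) : f = g :=
  Subtype.ext (CompactlySupportedContinuousMap.ext h)

@[simp] theorem core_mul_apply (f g : E.core) (x : X) : (f * g).1 x = f.1 x * g.1 x := rfl
@[simp] theorem core_add_apply (f g : E.core) (x : X) : (f + g).1 x = f.1 x + g.1 x := rfl
@[simp] theorem core_smul_apply (c : ℝ) (g : E.core) (x : X) : (c • g).1 x = c * g.1 x := rfl

/-- The functional `φ ↦ ℰ(φ f, f) - ½ ℰ(φ, f²)`. -/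
def carre (f φ : E.core) : ℝ := E.coreForm (φ * f) f - (1 / 2) * E.coreForm φ (f * f)

/-- This is the limit n → ∞ of `carre_approx_le`. -/
theorem IsDominated.carre_le {u : E.core} (h : IsDominated A B f.1 g.1 u.1) {φ : E.core}
    (hφ : ∀ x, 0 ≤ φ.1 x) : carre u φ ≤ A * carre f φ + B * carre g φ := by
  have key : ∀ w : E.core, Tendsto (fun n : ℕ =>
      ((n : ℝ) + 1) / 2 * ∫ x, φ.1 x * E.approxSq n w.1 x ∂μ) atTop (𝓝 (carre w φ)) := by
    intro w
    refine ((tendsto_approxForm_core (φ * w) w).sub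
      ((tendsto_approxForm_core φ (w * w)).const_mul (1 / 2))).congr fun n => ?_
    exact E.approxForm_carre n φ.1 w.1
  refine le_of_tendsto_of_tendsto' (key u) (((key f).const_mul A).add ((key g).const_mul B))
    fun n => ?_
  have h3 := mul_le_mul_of_nonneg_left (E.carre_approx_le n h hφ)
    (by positivity : (0 : ℝ) ≤ (n + 1) / 2)
  linarith

/-- The zero function is dominated by f. -/
theorem carre_nonneg (f : E.core) {φ : E.core} (hφ : ∀ x, 0 ≤ φ.1 x) : 0 ≤ carre f φ := by
  have h : IsDominated 1 0 f.1 f.1 (0 : E.core).1 :=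
    ⟨zero_le_one, le_rfl, fun x y => by simp; positivity, fun x => by simp; positivity⟩
  have h1 := h.carre_le hφ
  have h2 : carre (0 : E.core) φ = 0 := by
    have e1 : φ * (0 : E.core) = 0 := core_ext fun x => by simp
    have e2 : (0 : E.core) * 0 = 0 := core_ext fun x => by simp
    rw [carre, e1, e2, coreForm, coreForm]
    simp
  linarith

theorem compLeft_mem_core {F : C(ℝ, ℝ)} (hF0 : F 0 = 0) {L : ℝ}
    (hF : ∀ s t, |F s - F t| ≤ L * |s - t|) (f : E.core) : f.1.compLeft F ∈ E.core :=
  (isDominated_lipschitz f.1 hF0 hF).mem_core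

theorem exists_cutoff (hreg : E.IsRegular) {K U : Set X} (hK : IsCompact K) (hU : IsOpen U)
    (hKU : K ⊆ U) : ∃ χ : E.core, (∀ x, 0 ≤ χ.1 x) ∧ (∀ x, χ.1 x ≤ 1) ∧
      (∃ V, IsOpen V ∧ K ⊆ V ∧ ∀ x ∈ V, χ.1 x = 1) ∧ tsupport χ.1 ⊆ U := by
  obtain ⟨K', hK', hKK', hK'U⟩ := exists_compact_between hK hU hKU
  obtain ⟨g, hg1, hgc, hgU, hg⟩ := exists_continuousMap_one_of_isCompact_subset_isOpen hK' hU hK'U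
  obtain ⟨f, hf⟩ := hreg.1 ⟨g, hgc⟩ (1 / 4) (by norm_num)
  replace hf : ∀ x, |f.1 x - g x| < 1 / 4 := hf
  -- Since f is within 1/4 of the Urysohn function g, it exceeds 3/4 where g = 1 and stays below 1/4
  -- where g = 0. The clipped map 2t - 1/2 sends these ranges to 1 and 0, and it fixes 0.
  set F : C(ℝ, ℝ) := ⟨fun t => min (max 0 (2 * t - 1 / 2)) 1, by fun_prop⟩ with hF
  have hF0 : F 0 = 0 := by simp [hF]
  have hFL : ∀ s t, |F s - F t| ≤ 2 * |s - t| := by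
    intro s t
    simp only [hF, ContinuousMap.coe_mk]
    refine (abs_min_sub_min_le_max _ _ _ _).trans (max_le ?_ (by simp))
    refine (abs_max_sub_max_le_max _ _ _ _).trans (max_le (by simp) (le_of_eq ?_))
    rw [← abs_two, ← abs_mul, abs_two]
    congr 1
    ring
  have happ : ∀ x, f.1.compLeft F x = min (max 0 (2 * f.1 x - 1 / 2)) 1 := fun x => by
    rw [CompactlySupportedContinuousMap.compLeft_apply hF0]
    rfl
  refine ⟨⟨f.1.compLeft F, compLeft_mem_core hF0 hFL f⟩, fun x => ?_, fun x => ?_,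
    ⟨interior K', isOpen_interior, hKK', fun x hx => ?_⟩, ?_⟩
  · rw [happ]
    exact le_min (le_max_left _ _) zero_le_one
  · rw [happ]
    exact min_le_right _ _
  · have h1 := abs_lt.1 (hf x)
    have h2 : g x = 1 := hg1 (interior_subset hx)
    rw [happ, min_eq_right]
    exact le_max_of_le_right (by linarith [h1.1])
  · refine (closure_mono fun x hx => ?_).trans hgU
    by_contra h0
    have h1 : g x = 0 := by simpa using h0
    have h2 := abs_lt.1 (hf x)
    apply hx
    rw [happ, max_eq_left (by linarith [h2.2]), min_eq_left zero_le_one]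

end Contraction

end DirichletForm

/-! ### Existence and finiteness of energy measures on 𝒞. -/

namespace DirichletForm

section EnergyMeasure

variable {X : Type*} [MetricSpace X] [MeasurableSpace X] [BorelSpace X] {μ : Measure X}
  [μ.Regular] {E : DirichletForm μ}

theorem coreForm_symm (f g : E.core) : E.coreForm f g = E.coreForm g f := E.symm _ _

theorem coreForm_add_left (f g h : E.core) :
    E.coreForm (f + g) h = E.coreForm f h + E.coreForm g h := by
  simp [coreForm]

theorem coreForm_add_right (f g h : E.core) :
    E.coreForm f (g + h) = E.coreForm f g + E.coreForm f h := by
  simp [coreForm]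

theorem coreToDom_sub (f g : E.core) : E.coreToDom (f - g) = E.coreToDom f - E.coreToDom g := rfl

theorem coreForm_sub_right (f g h : E.core) :
    E.coreForm f (g - h) = E.coreForm f g - E.coreForm f h := by
  rw [coreForm, coreToDom_sub, map_sub]
  rfl

theorem coreForm_sub_left (f g h : E.core) :
    E.coreForm (f - g) h = E.coreForm f h - E.coreForm g h := by
  rw [coreForm_symm, coreForm_sub_right, coreForm_symm f, coreForm_symm g]

theorem coreForm_smul_left (c : ℝ) (f g : E.core) :
    E.coreForm (c • f) g = c * E.coreForm f g := by
  simp [coreForm]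

theorem coreForm_smul_right (c : ℝ) (f g : E.core) :
    E.coreForm f (c • g) = c * E.coreForm f g := by
  simp [coreForm]

variable [LocallyCompactSpace X] [SecondCountableTopology X]

theorem carre_add (f φ ψ : E.core) : carre f (φ + ψ) = carre f φ + carre f ψ := by
  have : (φ + ψ) * f = φ * f + ψ * f := core_ext fun x => by simp [add_mul]
  simp only [carre, this, coreForm_add_left]
  ring

theorem carre_smul (c : ℝ) (f φ : E.core) : carre f (c • φ) = c * carre f φ := by
  have : (c • φ) * f = c • (φ * f) := core_ext fun x => by simp [mul_assoc]
  simp only [carre, this, coreForm_smul_left]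
  ring

theorem tsupport_mul_subset (f g : C_c(X, ℝ)) : tsupport (f * g : C_c(X, ℝ)) ⊆ tsupport f :=
  closure_mono fun x hx => by
    rw [Function.mem_support, CompactlySupportedContinuousMap.mul_apply] at hx
    exact left_ne_zero_of_mul hx

/-- Here χf = f, and ℰ(χ, f²) = 0 by strong locality: there is no killing, so the total mass of Γ(f)
will be ℰ(f, f). -/
theorem carre_of_eq_one (hloc : E.IsStronglyLocal) {f χ : E.core} {V : Set X} (hV : IsOpen V)
    (hfV : tsupport f.1 ⊆ V) (hχ : ∀ x ∈ V, χ.1 x = 1) : carre f χ = E.coreForm f f := by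
  have h1 : χ * f = f := core_ext fun x => by
    by_cases hx : f.1 x = 0
    · simp [hx]
    · simp [hχ x (hfV (subset_tsupport _ hx))]
  rw [carre, h1, hloc χ (f * f) ⟨V, hV, (tsupport_mul_subset _ _).trans hfV, 1, hχ⟩]
  ring

theorem carre_of_const (hloc : E.IsStronglyLocal) {f φ : E.core} {U : Set X} (hU : IsOpen U)
    (hφ : tsupport φ.1 ⊆ U) {c : ℝ} (hf : ∀ x ∈ U, f.1 x = c) : carre f φ = 0 := by
  rw [carre, coreForm_symm, hloc f (φ * f) ⟨U, hU, (tsupport_mul_subset _ _).trans hφ, c, hf⟩,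
    coreForm_symm, hloc (f * f) φ ⟨U, hU, hφ, c * c, fun x hx => by simp [hf x hx]⟩]
  ring

/-- Positivity is applied to Mχ - φ, where χ is a cutoff equal to 1 near the supports of f and φ. -/
theorem carre_le_mul (hreg : E.IsRegular) (hloc : E.IsStronglyLocal) (f : E.core) {φ : E.core}
    {M : ℝ} (hM : 0 ≤ M) (hφ : ∀ x, φ.1 x ≤ M) : carre f φ ≤ M * E.coreForm f f := by
  obtain ⟨χ, hχ0, -, ⟨V, hV, hKV, hχV⟩, -⟩ := exists_cutoff hreg
    (f.1.hasCompactSupport.isCompact.union φ.1.hasCompactSupport.isCompact) isOpen_univ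
    (Set.subset_univ _)
  have h1 := carre_nonneg f (φ := M • χ + (-1 : ℝ) • φ) (fun x => by
    simp only [core_add_apply, core_smul_apply]
    by_cases hx : φ.1 x = 0
    · rw [hx]
      have := hχ0 x
      simp only [mul_zero, add_zero]
      positivity
    · rw [hχV x (hKV (Or.inr (subset_tsupport _ hx)))]
      linarith [hφ x])
  rw [carre_add, carre_smul, carre_smul,
    carre_of_eq_one hloc hV (Set.subset_union_left.trans hKV) hχV] at h1
  linarith

/-- The positive part of an element of the core. -/
theorem exists_core_nonneg_approx (hreg : E.IsRegular) {g : C_c(X, ℝ)} (hg : ∀ x, 0 ≤ g x)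
    {ε : ℝ} (hε : 0 < ε) : ∃ φ : E.core, (∀ x, 0 ≤ φ.1 x) ∧ ∀ x, |φ.1 x - g x| ≤ ε := by
  obtain ⟨f, hf⟩ := hreg.1 g ε hε
  replace hf : ∀ x, |f.1 x - g x| < ε := hf
  set F : C(ℝ, ℝ) := ⟨fun t => max t 0, by fun_prop⟩ with hF
  have hF0 : F 0 = 0 := by simp [hF]
  have hFL : ∀ s t, |F s - F t| ≤ 1 * |s - t| := fun s t => by
    rw [one_mul]
    exact abs_max_sub_max_le_abs s t 0
  have happ : ∀ x, f.1.compLeft F x = max (f.1 x) 0 := fun x => by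
    rw [CompactlySupportedContinuousMap.compLeft_apply hF0]
    rfl
  refine ⟨⟨f.1.compLeft F, compLeft_mem_core hF0 hFL f⟩, fun x => ?_, fun x => ?_⟩
  · rw [happ]
    exact le_max_right _ _
  · rw [happ]
    calc |max (f.1 x) 0 - g x| = |max (f.1 x) 0 - max (g x) 0| := by rw [max_eq_left (hg x)]
      _ ≤ |f.1 x - g x| := abs_max_sub_max_le_abs _ _ _
      _ ≤ ε := (hf x).le

/-- The functional φ ↦ ℰ(φf, f) - ½ℰ(φ, f²) is bounded by ℰ(f, f) times the sup norm, so Hahn-Banach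
extends it from 𝒞 to C_c(X). The extension is positive because a nonnegative g is a uniform limit of
nonnegative elements of 𝒞, and Riesz-Markov gives the measure. -/
theorem exists_isEnergyMeasure (hreg : E.IsRegular) (hloc : E.IsStronglyLocal) (f : E.core) :
    ∃ ν, E.IsEnergyMeasure f ν := by
  have hC : 0 ≤ E.coreForm f f := E.nonneg _
  set N : C_c(X, ℝ) → ℝ := fun g => E.coreForm f f * ‖(g : BoundedContinuousFunction X ℝ)‖ with hN
  obtain ⟨Λ, hΛ, hΛN⟩ := exists_extension_of_le_sublinear
    ⟨E.core, { toFun := carre f, map_add' := carre_add f, map_smul' := fun c φ => carre_smul c f φ }⟩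
    N
    (fun c hc g => by
      have : ((c • g : C_c(X, ℝ)) : BoundedContinuousFunction X ℝ) = c • (g : BoundedContinuousFunction X ℝ) := by
        ext x
        rfl
      rw [hN]
      simp only [this, norm_smul, Real.norm_eq_abs, abs_of_pos hc]
      ring)
    (fun g h => by
      have : ((g + h : C_c(X, ℝ)) : BoundedContinuousFunction X ℝ) = (g : BoundedContinuousFunction X ℝ) + (h : BoundedContinuousFunction X ℝ) := by
        ext x
        rfl
      rw [hN]
      simp only [this, ← mul_add]
      exact mul_le_mul_of_nonneg_left (norm_add_le _ _) hC)
    (fun φ => (carre_le_mul hreg hloc f (norm_nonneg _) fun x =>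
      (le_abs_self _).trans ((φ.1 : BoundedContinuousFunction X ℝ).norm_coe_le_norm x)).trans_eq
        (mul_comm _ _))
  have hΛ' : ∀ φ : E.core, Λ φ.1 = carre f φ := hΛ
  have hpos : ∀ g : C_c(X, ℝ), 0 ≤ g → 0 ≤ Λ g := by
    intro g hg
    refine le_of_forall_pos_le_add fun ε hε => ?_
    obtain ⟨φ, hφ0, hφ⟩ := exists_core_nonneg_approx hreg (g := g) (fun x => hg x)
      (ε := ε / (E.coreForm f f + 1)) (by positivity)
    -- The bound at φ - g gives Λφ - Λg ≤ ε, while Λφ ≥ 0.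
    have h1 := hΛN (φ.1 - g)
    have h2 : ‖((φ.1 - g : C_c(X, ℝ)) : BoundedContinuousFunction X ℝ)‖ ≤ ε / (E.coreForm f f + 1) :=
      (BoundedContinuousFunction.norm_le (by positivity)).2 hφ
    have h3 : N (φ.1 - g) ≤ ε := by
      calc N (φ.1 - g) ≤ (E.coreForm f f + 1) * (ε / (E.coreForm f f + 1)) := by
            simp only [hN]
            gcongr
            linarith
        _ = ε := by field_simp
    rw [map_sub, hΛ'] at h1
    have := carre_nonneg f hφ0
    linarith
  set Λp : C_c(X, ℝ) →ₚ[ℝ] ℝ := PositiveLinearMap.mk₀ Λ hpos with hΛp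
  refine ⟨RealRMK.rieszMeasure Λp, inferInstance, fun φ p q hp hq => ?_⟩
  have hp' : p = φ * f := Subtype.ext hp
  have hq' : q = f * f := Subtype.ext hq
  rw [hp', hq']
  exact (RealRMK.integral_rieszMeasure Λp φ.1).trans (hΛ' φ)

theorem isEnergyMeasure_energyMeasure (hreg : E.IsRegular) (hloc : E.IsStronglyLocal)
    (f : E.core) : E.IsEnergyMeasure f (E.energyMeasure f) := by
  rw [energyMeasure, dif_pos (exists_isEnergyMeasure hreg hloc f)]
  exact (exists_isEnergyMeasure hreg hloc f).choose_spec

theorem integral_energyMeasure (hreg : E.IsRegular) (hloc : E.IsStronglyLocal) (f φ : E.core) :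
    ∫ x, φ.1 x ∂(E.energyMeasure f) = carre f φ :=
  (isEnergyMeasure_energyMeasure hreg hloc f).2 φ (φ * f) (f * f) rfl rfl

/-- By inner regularity it suffices to bound the mass of compact sets, and a cutoff dominates the
indicator of each. -/
theorem energyMeasure_univ_le (hreg : E.IsRegular) (hloc : E.IsStronglyLocal) (f : E.core) :
    E.energyMeasure f Set.univ ≤ ENNReal.ofReal (E.coreForm f f) := by
  have : (E.energyMeasure f).Regular := (isEnergyMeasure_energyMeasure hreg hloc f).1
  rw [isOpen_univ.measure_eq_iSup_isCompact]
  refine iSup₂_le fun K _ => iSup_le fun hK => ?_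
  obtain ⟨χ, hχ0, hχ1, ⟨V, -, hKV, hχV⟩, -⟩ := exists_cutoff hreg hK isOpen_univ
    (Set.subset_univ _)
  have hint : Integrable χ.1 (E.energyMeasure f) :=
    χ.1.continuous.integrable_of_hasCompactSupport χ.1.hasCompactSupport
  calc E.energyMeasure f K = ∫⁻ x, K.indicator 1 x ∂(E.energyMeasure f) := by
        rw [lintegral_indicator_one hK.measurableSet]
    _ ≤ ∫⁻ x, ENNReal.ofReal (χ.1 x) ∂(E.energyMeasure f) := by
        refine lintegral_mono fun x => ?_
        by_cases hx : x ∈ K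
        · simp [hx, hχV x (hKV hx)]
        · simp [hx]
    _ = ENNReal.ofReal (carre f χ) := by
        rw [← ofReal_integral_eq_lintegral_ofReal hint (ae_of_all _ hχ0),
          integral_energyMeasure hreg hloc]
    _ ≤ ENNReal.ofReal (E.coreForm f f) := by
        refine ENNReal.ofReal_le_ofReal ?_
        simpa using carre_le_mul hreg hloc f zero_le_one hχ1

theorem isFiniteMeasure_energyMeasure (hreg : E.IsRegular) (hloc : E.IsStronglyLocal)
    (f : E.core) : IsFiniteMeasure (E.energyMeasure f) :=
  ⟨(energyMeasure_univ_le hreg hloc f).trans_lt ENNReal.ofReal_lt_top⟩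

end EnergyMeasure

end DirichletForm

/-! ### Energy densities and the Leibniz rule. -/

namespace DirichletForm

section Density

variable {X : Type*} [MetricSpace X] [MeasurableSpace X] [BorelSpace X] {μ : Measure X}
  [μ.Regular]

/-- The standing assumptions: `E` is regular and strongly local and `μ` is energy dominant. -/
class IsAdmissible (E : DirichletForm μ) : Prop where
  regular : E.IsRegular
  stronglyLocal : E.IsStronglyLocal
  energyDominant : E.IsEnergyDominant μ

variable {E : DirichletForm μ} [LocallyCompactSpace X] [SecondCountableTopology X]

/-- Squares of cutoffs supported in shrinking neighbourhoods of a compact K converge to its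
indicator, so h has nonnegative integral over every compact subset of U. If {h < 0} met U in
positive measure, it would contain a compact set of positive measure, a contradiction. -/
theorem ae_nonneg_of_integral_sq_mul (hreg : E.IsRegular) {h : X → ℝ}
    (hh : LocallyIntegrable h μ) {U : Set X} (hU : IsOpen U)
    (H : ∀ f : E.core, tsupport f.1 ⊆ U → 0 ≤ ∫ x, f.1 x ^ 2 * h x ∂μ) :
    ∀ᵐ x ∂μ, x ∈ U → 0 ≤ h x := by
  have hcomp : ∀ K ⊆ U, IsCompact K → 0 ≤ ∫ x in K, h x ∂μ := by
    intro K hKU hK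
    obtain ⟨K', hK', hKK', hK'U⟩ := exists_compact_between hK hU hKU
    have hthick : ∀ n : ℕ, K ⊆ Metric.thickening (1 / ((n : ℝ) + 1)) K ∩ interior K' := fun n =>
      Set.subset_inter (Metric.self_subset_thickening (by positivity) K) hKK'
    choose f hf0 hf1 hfV hfs using fun n => exists_cutoff hreg hK
      (Metric.isOpen_thickening.inter isOpen_interior) (hthick n)
    have hlim : Tendsto (fun n => ∫ x, (f n).1 x ^ 2 * h x ∂μ) atTop
        (𝓝 (∫ x, K.indicator h x ∂μ)) := by
      refine tendsto_integral_of_dominated_convergence (K'.indicator fun x => ‖h x‖)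
        (fun n => ?_) ?_ (fun n => ae_of_all _ fun x => ?_) (ae_of_all _ fun x => ?_)
      · exact (((f n).1.continuous.pow 2).aestronglyMeasurable).mul hh.aestronglyMeasurable
      · rw [integrable_indicator_iff hK'.measurableSet]
        exact (hh.integrableOn_isCompact hK').norm
      · by_cases hx : x ∈ K'
        · rw [Set.indicator_of_mem hx, norm_mul, Real.norm_eq_abs, abs_of_nonneg (by positivity)]
          exact mul_le_of_le_one_left (norm_nonneg _) (pow_le_one₀ (hf0 n x) (hf1 n x))
        · have : (f n).1 x = 0 := by
            by_contra hc
            exact hx (interior_subset ((hfs n) (subset_tsupport _ hc)).2)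
          simp [this, Set.indicator_of_notMem hx]
      · by_cases hx : x ∈ K
        · rw [Set.indicator_of_mem hx]
          refine tendsto_const_nhds.congr fun n => ?_
          obtain ⟨V, -, hKV, hV⟩ := hfV n
          simp [hV x (hKV hx)]
        · rw [Set.indicator_of_notMem hx]
          have hpos : ∃ δ > 0, x ∉ Metric.thickening δ K := by
            by_contra! hc
            apply hx
            rw [← hK.isClosed.closure_eq, Metric.closure_eq_iInter_thickening]
            exact Set.mem_iInter₂.2 hc
          obtain ⟨δ, hδ, hxδ⟩ := hpos
          obtain ⟨N, hN⟩ := exists_nat_one_div_lt hδ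
          refine tendsto_const_nhds.congr' ?_
          filter_upwards [eventually_ge_atTop N] with n hn
          have : (f n).1 x = 0 := by
            by_contra hc
            refine hxδ (Metric.thickening_mono ?_ K ((hfs n) (subset_tsupport _ hc)).1)
            exact (Nat.one_div_le_one_div hn).trans hN.le
          simp [this]
    rw [← integral_indicator hK.measurableSet]
    exact ge_of_tendsto' hlim fun n => H _ (((hfs n).trans Set.inter_subset_right).trans
      (interior_subset.trans hK'U))
  rw [ae_iff]
  by_contra hne
  have hnull : NullMeasurableSet {x | ¬ (x ∈ U → 0 ≤ h x)} μ := by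
    have : {x | ¬ (x ∈ U → 0 ≤ h x)} = U ∩ {x | h x < 0} := by
      ext x
      simp
    rw [this]
    exact hU.measurableSet.nullMeasurableSet.inter
      (nullMeasurableSet_lt hh.aestronglyMeasurable.aemeasurable aemeasurable_const)
  obtain ⟨T, hTS, hT, hTeq⟩ := hnull.exists_measurable_subset_ae_eq
  rw [← measure_congr hTeq] at hne
  obtain ⟨K, hKT, hK, hμK⟩ := hT.exists_lt_isCompact (pos_iff_ne_zero.2 hne)
  have hKneg : ∀ x ∈ K, x ∈ U ∧ h x < 0 := fun x hx => by
    simpa using hTS (hKT hx)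
  have h1 := hcomp K (fun x hx => (hKneg x hx).1) hK
  have h2 : 0 < ∫ x in K, (-h x) ∂μ := by
    rw [setIntegral_pos_iff_support_of_nonneg_ae]
    · refine hμK.trans_le (measure_mono fun x hx => ⟨?_, hx⟩)
      simpa using (hKneg x hx).2.ne
    · filter_upwards [ae_restrict_mem hK.measurableSet] with x hx
      simpa using (hKneg x hx).2.le
    · exact (hh.integrableOn_isCompact hK).neg
  rw [integral_neg] at h2
  linarith

theorem ae_eq_of_integral_core (hreg : E.IsRegular) {h k : X → ℝ} (hh : Integrable h μ)
    (hk : Integrable k μ) (H : ∀ φ : E.core, ∫ x, φ.1 x * h x ∂μ = ∫ x, φ.1 x * k x ∂μ) :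
    h =ᵐ[μ] k := by
  have hint : ∀ (φ : E.core) {w : X → ℝ}, Integrable w μ → Integrable (fun x => φ.1 x * w x) μ := by
    intro φ w hw
    obtain ⟨C, -, hC⟩ := exists_abs_le φ.1
    exact hw.bdd_mul φ.1.continuous.aestronglyMeasurable (ae_of_all _ hC)
  have e : ∀ f : E.core, ∫ x, f.1 x ^ 2 * (h x - k x) ∂μ = 0 := fun f => by
    have h1 := H (f * f)
    have h2 : ∀ x, f.1 x ^ 2 * (h x - k x) = (f * f).1 x * h x - (f * f).1 x * k x := fun x => by
      rw [core_mul_apply]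
      ring
    simp_rw [h2]
    rw [integral_sub (hint _ hh) (hint _ hk), h1, sub_self]
  have h1 := ae_nonneg_of_integral_sq_mul hreg (hh.sub hk).locallyIntegrable isOpen_univ
    fun f _ => (e f).ge
  have h2 := ae_nonneg_of_integral_sq_mul hreg (hk.sub hh).locallyIntegrable isOpen_univ
    fun f _ => by
      refine (neg_eq_zero.2 (e f)).symm.le.trans_eq ?_
      rw [← integral_neg]
      congr 1
      ext x
      simp only [Pi.sub_apply]
      ring
  filter_upwards [h1, h2] with x h1 h2
  have h3 := h1 trivial
  have h4 := h2 trivial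
  simp only [Pi.sub_apply] at h3 h4
  linarith

/-- The density of the energy measure of `f` with respect to `μ`. -/
def density (f : E.core) (x : X) : ℝ := ((E.energyMeasure f).rnDeriv μ x).toReal

/-- The density of the mutual energy measure of `f` and `g` with respect to `μ`. -/
def mutualDensity (f g : E.core) (x : X) : ℝ := 1 / 4 * (density (f + g) x - density (f - g) x)

/-- The functional `φ ↦ ½ (ℰ(φ f, g) + ℰ(φ g, f) - ℰ(φ, f g))`. -/
def mutualCarre (f g φ : E.core) : ℝ :=
  1 / 2 * (E.coreForm (φ * f) g + E.coreForm (φ * g) f - E.coreForm φ (f * g))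

theorem carre_linear_comb (a b : ℝ) (f g φ : E.core) : carre (a • f + b • g) φ =
    a ^ 2 * carre f φ + 2 * a * b * mutualCarre f g φ + b ^ 2 * carre g φ := by
  have e1 : φ * (a • f + b • g) = a • (φ * f) + b • (φ * g) := core_ext fun x => by
    simp only [core_mul_apply, core_add_apply, core_smul_apply]
    ring
  have e2 : (a • f + b • g) * (a • f + b • g) =
      a ^ 2 • (f * f) + (2 * a * b) • (f * g) + b ^ 2 • (g * g) := core_ext fun x => by
    simp only [core_mul_apply, core_add_apply, core_smul_apply]
    ring
  simp only [carre, mutualCarre, e1, e2, coreForm_add_left, coreForm_add_right,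
    coreForm_smul_left, coreForm_smul_right]
  ring

theorem density_nonneg (f : E.core) (x : X) : 0 ≤ density f x := ENNReal.toReal_nonneg

variable [hE : E.IsAdmissible]

theorem integrable_density (f : E.core) : Integrable (density f) μ := by
  have := isFiniteMeasure_energyMeasure hE.regular hE.stronglyLocal f
  exact Measure.integrable_toReal_rnDeriv

theorem integral_mul_density (f : E.core) (φ : X → ℝ) :
    ∫ x, φ x * density f x ∂μ = ∫ x, φ x ∂(E.energyMeasure f) := by
  have := isFiniteMeasure_energyMeasure hE.regular hE.stronglyLocal f
  rw [← integral_rnDeriv_smul (hE.energyDominant.2.2 f)]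
  simp only [smul_eq_mul, mul_comm, density]

theorem integral_core_mul_density (f φ : E.core) :
    ∫ x, φ.1 x * density f x ∂μ = carre f φ := by
  rw [integral_mul_density, integral_energyMeasure hE.regular hE.stronglyLocal]

theorem integrable_core_mul (φ : E.core) {w : X → ℝ} (hw : Integrable w μ) :
    Integrable (fun x => φ.1 x * w x) μ := by
  obtain ⟨C, -, hC⟩ := exists_abs_le φ.1
  exact hw.bdd_mul φ.1.continuous.aestronglyMeasurable (ae_of_all _ hC)

theorem integrable_mutualDensity (f g : E.core) : Integrable (mutualDensity f g) μ :=
  ((integrable_density _).sub (integrable_density _)).const_mul _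

theorem integral_core_mul_mutualDensity (f g φ : E.core) :
    ∫ x, φ.1 x * mutualDensity f g x ∂μ = mutualCarre f g φ := by
  have e : ∀ x, φ.1 x * mutualDensity f g x =
      1 / 4 * (φ.1 x * density (f + g) x - φ.1 x * density (f - g) x) := fun x => by
    rw [mutualDensity]
    ring
  have e1 : f + g = (1 : ℝ) • f + (1 : ℝ) • g := by module
  have e2 : f - g = (1 : ℝ) • f + (-1 : ℝ) • g := by module
  simp_rw [e]
  rw [integral_const_mul, integral_sub (integrable_core_mul φ (integrable_density _))
    (integrable_core_mul φ (integrable_density _)), integral_core_mul_density,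
    integral_core_mul_density, e1, e2, carre_linear_comb, carre_linear_comb]
  ring

theorem mutualEnergy_eq (f g φ : E.core) :
    E.mutualEnergy f g φ.1 = ∫ x, φ.1 x * mutualDensity f g x ∂μ := by
  have e : ∀ x, φ.1 x * mutualDensity f g x =
      1 / 4 * (φ.1 x * density (f + g) x - φ.1 x * density (f - g) x) := fun x => by
    rw [mutualDensity]
    ring
  simp_rw [e]
  rw [integral_const_mul, integral_sub (integrable_core_mul φ (integrable_density _))
    (integrable_core_mul φ (integrable_density _)), integral_mul_density, integral_mul_density,
    mutualEnergy]

/-- Energy measures are known only through their integrals over 𝒞, so an identity between densities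
is proved by testing against 𝒞. There it becomes bilinear algebra for ℰ. -/
theorem density_linear_comb (a b : ℝ) (f g : E.core) : ∀ᵐ x ∂μ, density (a • f + b • g) x =
    a ^ 2 * density f x + 2 * a * b * mutualDensity f g x + b ^ 2 * density g x := by
  refine ae_eq_of_integral_core hE.regular (integrable_density _)
    ((((integrable_density f).const_mul _).add ((integrable_mutualDensity f g).const_mul _)).add
      ((integrable_density g).const_mul _)) fun φ => ?_
  have e : ∀ x, φ.1 x * (a ^ 2 * density f x + 2 * a * b * mutualDensity f g x +
      b ^ 2 * density g x) = a ^ 2 * (φ.1 x * density f x) +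
        2 * a * b * (φ.1 x * mutualDensity f g x) + b ^ 2 * (φ.1 x * density g x) := fun x => by
    ring
  have i1 := (integrable_core_mul φ (integrable_density f)).const_mul (a ^ 2)
  have i2 := (integrable_core_mul φ (integrable_mutualDensity f g)).const_mul (2 * a * b)
  have i3 := (integrable_core_mul φ (integrable_density g)).const_mul (b ^ 2)
  have i12 : Integrable (fun x => a ^ 2 * (φ.1 x * density f x) +
    2 * a * b * (φ.1 x * mutualDensity f g x)) μ := i1.add i2
  simp_rw [e]
  rw [integral_add i12 i3, integral_add i1 i2, integral_const_mul, integral_const_mul,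
    integral_const_mul, integral_core_mul_density, integral_core_mul_density,
    integral_core_mul_density, integral_core_mul_mutualDensity, carre_linear_comb]

theorem mutualDensity_add_left (f g h : E.core) : ∀ᵐ x ∂μ,
    mutualDensity (f + g) h x = mutualDensity f h x + mutualDensity g h x := by
  refine ae_eq_of_integral_core hE.regular (integrable_mutualDensity _ _)
    ((integrable_mutualDensity f h).add (integrable_mutualDensity g h)) fun φ => ?_
  have e : ∀ x, φ.1 x * (mutualDensity f h x + mutualDensity g h x) =
    φ.1 x * mutualDensity f h x + φ.1 x * mutualDensity g h x := fun x => mul_add _ _ _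
  simp_rw [e]
  rw [integral_add (integrable_core_mul φ (integrable_mutualDensity _ _))
    (integrable_core_mul φ (integrable_mutualDensity _ _)), integral_core_mul_mutualDensity,
    integral_core_mul_mutualDensity, integral_core_mul_mutualDensity]
  have e1 : φ * (f + g) = φ * f + φ * g := core_ext fun x => by simp [mul_add]
  have e2 : (f + g) * h = f * h + g * h := core_ext fun x => by simp [add_mul]
  simp only [mutualCarre, e1, e2, coreForm_add_left, coreForm_add_right]
  ring

theorem mutualDensity_smul_left (c : ℝ) (f h : E.core) : ∀ᵐ x ∂μ,
    mutualDensity (c • f) h x = c * mutualDensity f h x := by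
  refine ae_eq_of_integral_core hE.regular (integrable_mutualDensity _ _)
    ((integrable_mutualDensity f h).const_mul c) fun φ => ?_
  have e : ∀ x, φ.1 x * (c * mutualDensity f h x) = c * (φ.1 x * mutualDensity f h x) :=
    fun x => mul_left_comm _ _ _
  simp_rw [e]
  rw [integral_const_mul, integral_core_mul_mutualDensity, integral_core_mul_mutualDensity]
  have e1 : φ * (c • f) = c • (φ * f) := core_ext fun x => by
    simp only [core_mul_apply, core_smul_apply]
    ring
  have e2 : (c • f) * h = c • (f * h) := core_ext fun x => by
    simp only [core_mul_apply, core_smul_apply]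
    ring
  simp only [mutualCarre, e1, e2, coreForm_smul_left, coreForm_smul_right]
  ring

theorem mutualDensity_comm (f g : E.core) : mutualDensity f g =ᵐ[μ] mutualDensity g f := by
  refine ae_eq_of_integral_core hE.regular (integrable_mutualDensity _ _)
    (integrable_mutualDensity _ _) fun φ => ?_
  rw [integral_core_mul_mutualDensity, integral_core_mul_mutualDensity]
  have e : f * g = g * f := core_ext fun x => by simp [mul_comm]
  simp only [mutualCarre, e]
  ring

theorem mutualDensity_self (f : E.core) : mutualDensity f f =ᵐ[μ] density f := by
  refine ae_eq_of_integral_core hE.regular (integrable_mutualDensity _ _)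
    (integrable_density _) fun φ => ?_
  rw [integral_core_mul_mutualDensity, integral_core_mul_density]
  simp only [mutualCarre, carre]
  ring

/-- This is the Cauchy-Schwarz inequality in additive form: the densities of f + εg and f - εg are
both nonnegative. -/
theorem two_mul_abs_mutualDensity_le (ε : ℝ) (f g : E.core) : ∀ᵐ x ∂μ,
    2 * ε * |mutualDensity f g x| ≤ density f x + ε ^ 2 * density g x := by
  filter_upwards [density_linear_comb 1 ε f g, density_linear_comb 1 (-ε) f g] with x h1 h2
  have h3 := density_nonneg ((1 : ℝ) • f + ε • g) x
  have h4 := density_nonneg ((1 : ℝ) • f + (-ε) • g) x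
  rcases abs_cases (mutualDensity f g x) with ⟨h, -⟩ | ⟨h, -⟩ <;> rw [h] <;> nlinarith

theorem density_add_le (f g : E.core) : ∀ᵐ x ∂μ,
    density (f + g) x ≤ 2 * density f x + 2 * density g x := by
  have e : f + g = (1 : ℝ) • f + (1 : ℝ) • g := by module
  rw [e]
  filter_upwards [density_linear_comb 1 1 f g, two_mul_abs_mutualDensity_le 1 f g] with x h1 h2
  have := le_abs_self (mutualDensity f g x)
  linarith

/-- By strong locality Γ(f) integrates to zero against φ² for every φ in 𝒞 supported in U. -/
theorem density_eq_zero_of_const {f : E.core} {U : Set X} (hU : IsOpen U) {c : ℝ}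
    (hf : ∀ x ∈ U, f.1 x = c) : ∀ᵐ x ∂μ, x ∈ U → density f x = 0 := by
  have h1 := ae_nonneg_of_integral_sq_mul hE.regular (integrable_density f).neg.locallyIntegrable
    hU fun φ hφ => by
      have e : ∀ x, φ.1 x ^ 2 * (-density f) x = -((φ * φ).1 x * density f x) := fun x => by
        rw [core_mul_apply, Pi.neg_apply]
        ring
      simp_rw [e]
      have e2 : carre f (φ * φ) = 0 := carre_of_const hE.stronglyLocal hU
        ((tsupport_mul_subset φ.1 φ.1).trans hφ) hf
      rw [integral_neg, integral_core_mul_density, e2, neg_zero]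
  filter_upwards [h1] with x h1 hx
  have h2 := h1 hx
  have h3 := density_nonneg f x
  simp only [Pi.neg_apply] at h2
  linarith

theorem IsDominated.density_le {A B : ℝ} {f g u : E.core} (h : IsDominated A B f.1 g.1 u.1) :
    ∀ᵐ x ∂μ, density u x ≤ A * density f x + B * density g x := by
  have i1 := (integrable_density f).const_mul A
  have i2 := (integrable_density g).const_mul B
  have i3 := integrable_density u
  have h1 := ae_nonneg_of_integral_sq_mul hE.regular ((i1.add i2).sub i3).locallyIntegrable
    isOpen_univ fun φ _ => by
      have e : ∀ x, φ.1 x ^ 2 * (A * density f x + B * density g x - density u x) =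
          A * ((φ * φ).1 x * density f x) + B * ((φ * φ).1 x * density g x)
            - (φ * φ).1 x * density u x := fun x => by
        rw [core_mul_apply]
        ring
      have j1 := (integrable_core_mul (φ * φ) (integrable_density f)).const_mul A
      have j2 := (integrable_core_mul (φ * φ) (integrable_density g)).const_mul B
      have j3 := integrable_core_mul (φ * φ) (integrable_density u)
      have j12 : Integrable (fun x => A * ((φ * φ).1 x * density f x) +
        B * ((φ * φ).1 x * density g x)) μ := j1.add j2
      simp_rw [Pi.sub_apply, Pi.add_apply, e]
      rw [integral_sub j12 j3, integral_add j1 j2, integral_const_mul, integral_const_mul,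
        integral_core_mul_density, integral_core_mul_density, integral_core_mul_density]
      have := h.carre_le (φ := φ * φ) fun x => mul_self_nonneg _
      linarith
  filter_upwards [h1] with x h1
  have h2 := h1 trivial
  simp only [Pi.sub_apply, Pi.add_apply] at h2
  linarith

/-- Locally a function of the core minus its value at a point agrees with a small function. -/
theorem exists_local_clip (f : E.core) (y : X) {ε : ℝ} (hε : 0 < ε) :
    ∃ f' : E.core, ∃ U : Set X, IsOpen U ∧ y ∈ U ∧ (∀ x, |f'.1 x| ≤ ε) ∧
      (∀ x ∈ U, f'.1 x = f.1 x - f.1 y) ∧ (∀ x ∈ U, |f.1 x - f.1 y| ≤ ε) := by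
  -- The constant f(y) need not lie in 𝒞, so f(y)χ with χ = 1 near y stands in for it. Clipping to
  -- [-ε, ε] then changes nothing near y.
  obtain ⟨χ, -, -, ⟨V, hV, hKV, hχV⟩, -⟩ := exists_cutoff hE.regular (isCompact_singleton (x := y))
    isOpen_univ (Set.subset_univ _)
  set F : C(ℝ, ℝ) := ⟨fun t => max (min t ε) (-ε), by fun_prop⟩ with hF
  have hF0 : F 0 = 0 := by simp [hF, hε.le]
  have hFL : ∀ s t, |F s - F t| ≤ 1 * |s - t| := fun s t => by
    rw [one_mul]
    exact (abs_max_sub_max_le_abs _ _ _).trans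
      ((abs_min_sub_min_le_max _ _ _ _).trans (max_le le_rfl (by simp)))
  have happ : ∀ x, (f - f.1 y • χ).1.compLeft F x = F ((f - f.1 y • χ).1 x) := fun x => by
    rw [CompactlySupportedContinuousMap.compLeft_apply hF0]
  have hcont : Continuous fun x => |f.1 x - f.1 y| := (f.1.continuous.sub continuous_const).abs
  refine ⟨⟨(f - f.1 y • χ).1.compLeft F, compLeft_mem_core hF0 hFL _⟩,
    V ∩ {x | |f.1 x - f.1 y| < ε}, hV.inter (isOpen_lt hcont continuous_const),
    ⟨hKV rfl, by simpa using hε⟩, fun x => ?_, fun x hx => ?_, fun x hx => le_of_lt hx.2⟩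
  · rw [happ, hF, abs_le]
    exact ⟨le_max_right _ _, max_le (min_le_right _ _) (by linarith)⟩
  · have h1 : (f - f.1 y • χ).1 x = f.1 x - f.1 y := by
      simp [hχV x hx.1]
    have h2 : |f.1 x - f.1 y| < ε := hx.2
    rw [abs_lt] at h2
    rw [happ, h1, hF]
    simp only [ContinuousMap.coe_mk]
    rw [min_eq_left h2.2.le, max_eq_left h2.1.le]

/-- The difference u - v is constant on U and so has no energy there. The factor 2 comes from
`density_add_le` and is harmless. -/
theorem density_le_two_mul_of_sub_const {u v : E.core} {U : Set X} (hU : IsOpen U) {c : ℝ}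
    (h : ∀ x ∈ U, u.1 x = v.1 x + c) : ∀ᵐ x ∂μ, x ∈ U → density u x ≤ 2 * density v x := by
  have e : u = v + (u + (-1 : ℝ) • v) := by module
  filter_upwards [density_add_le v (u + (-1 : ℝ) • v),
    density_eq_zero_of_const (f := u + (-1 : ℝ) • v) hU (c := c) fun x hx => by
      simp [h x hx]] with x h1 h2 hx
  rw [← e, h2 hx] at h1
  linarith

theorem ae_of_locally_ae {p : X → Prop} (h : ∀ y, ∃ U, IsOpen U ∧ y ∈ U ∧ ∀ᵐ x ∂μ, x ∈ U → p x) :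
    ∀ᵐ x ∂μ, p x := by
  rw [ae_iff]
  refine measure_null_of_locally_null _ fun y _ => ?_
  obtain ⟨U, hU, hyU, hp⟩ := h y
  refine ⟨{x | ¬ p x} ∩ U, inter_mem self_mem_nhdsWithin
    (mem_nhdsWithin_of_mem_nhds (hU.mem_nhds hyU)), ?_⟩
  rw [ae_iff] at hp
  refine measure_mono_null (fun x hx => ?_) hp
  exact fun hc => hx.1 (hc hx.2)

/-- Let a = f(y) and b = g(y). The function w = fg - bf - ag differs from (f - a)(g - b) by a
constant, and near y both factors are at most ε, so Γ(w) ≤ 8ε²(Γ(f) + Γ(g)). Cauchy-Schwarz with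
weight ε makes Γ(w, h) of order ε. Replacing a and b by f(x) and g(x) costs another ε in each
remaining term. The constant 9 leaves room. -/
theorem abs_mutualDensity_mul_sub_le (f g h : E.core) {ε : ℝ} (hε : 0 < ε) : ∀ᵐ x ∂μ,
    |mutualDensity (f * g) h x - (f.1 x * mutualDensity g h x + g.1 x * mutualDensity f h x)| ≤
      9 * ε * (density f x + density g x + density h x) := by
  refine ae_of_locally_ae fun y => ?_
  obtain ⟨f', U, hU, hyU, hf'ε, hf', hfε⟩ := exists_local_clip f y hε
  obtain ⟨g', V, hV, hyV, hg'ε, hg', hgε⟩ := exists_local_clip g y hε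
  set a := f.1 y
  set b := g.1 y
  refine ⟨U ∩ V, hU.inter hV, ⟨hyU, hyV⟩, ?_⟩
  set w : E.core := f * g + ((-b) • f + (-a) • g) with hw
  have d1 : ∀ᵐ x ∂μ, x ∈ U ∩ V → density w x ≤ 2 * density (f' * g') x :=
    density_le_two_mul_of_sub_const (hU.inter hV) (c := -(a * b)) fun x hx => by
      simp only [hw, core_add_apply, core_mul_apply, core_smul_apply, hf' x hx.1, hg' x hx.2]
      ring
  have d2 : ∀ᵐ x ∂μ, x ∈ U → density f' x ≤ 2 * density f x :=
    density_le_two_mul_of_sub_const hU (c := -a) fun x hx => by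
      rw [hf' x hx, sub_eq_add_neg]
  have d3 : ∀ᵐ x ∂μ, x ∈ V → density g' x ≤ 2 * density g x :=
    density_le_two_mul_of_sub_const hV (c := -b) fun x hx => by
      rw [hg' x hx, sub_eq_add_neg]
  have d4 := IsDominated.density_le (u := f' * g') (isDominated_mul hf'ε hg'ε)
  filter_upwards [d1, d2, d3, d4, mutualDensity_add_left (f * g) ((-b) • f + (-a) • g) h,
    mutualDensity_add_left ((-b) • f) ((-a) • g) h, mutualDensity_smul_left (-b) f h,
    mutualDensity_smul_left (-a) g h, two_mul_abs_mutualDensity_le ε w h,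
    two_mul_abs_mutualDensity_le 1 f h, two_mul_abs_mutualDensity_le 1 g h]
    with x d1 d2 d3 d4 m1 m2 m3 m4 c1 c2 c3 hx
  replace d1 := d1 hx
  replace d2 := d2 hx.1
  replace d3 := d3 hx.2
  have hfx := hfε x hx.1
  have hgx := hgε x hx.2
  have pf := density_nonneg f x
  have pg := density_nonneg g x
  have ph := density_nonneg h x
  rw [← hw] at m1
  have e : mutualDensity (f * g) h x - (f.1 x * mutualDensity g h x + g.1 x * mutualDensity f h x) =
      mutualDensity w h x + (-((g.1 x - b) * mutualDensity f h x) +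
        -((f.1 x - a) * mutualDensity g h x)) := by
    rw [m1, m2, m3, m4]
    ring
  have b0 : density w x ≤ ε * (8 * ε * (density f x + density g x)) := by
    have h1 : 2 * ε ^ 2 * density f' x ≤ 2 * ε ^ 2 * (2 * density f x) := by gcongr
    have h2 : 2 * ε ^ 2 * density g' x ≤ 2 * ε ^ 2 * (2 * density g x) := by gcongr
    linarith
  have b1 : |mutualDensity w h x| ≤ 4 * ε * (density f x + density g x) + ε * density h x := by
    have h1 : ε * (2 * |mutualDensity w h x|) ≤
        ε * (8 * ε * (density f x + density g x) + ε * density h x) := by linarith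
    have h2 := le_of_mul_le_mul_left h1 hε
    have h3 : 0 ≤ ε * density h x := by positivity
    linarith
  have b2 : |(g.1 x - b) * mutualDensity f h x| ≤ ε * (density f x + density h x) := by
    rw [abs_mul]
    gcongr
    have := abs_nonneg (mutualDensity f h x)
    linarith
  have b3 : |(f.1 x - a) * mutualDensity g h x| ≤ ε * (density g x + density h x) := by
    rw [abs_mul]
    gcongr
    have := abs_nonneg (mutualDensity g h x)
    linarith
  rw [e]
  calc _ ≤ |mutualDensity w h x| + (|(g.1 x - b) * mutualDensity f h x| +
        |(f.1 x - a) * mutualDensity g h x|) := by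
        refine (abs_add_le _ _).trans (add_le_add le_rfl ((abs_add_le _ _).trans ?_))
        rw [abs_neg, abs_neg]
    _ ≤ _ := by
        have h1 : 0 ≤ ε * density f x := by positivity
        have h2 : 0 ≤ ε * density g x := by positivity
        have h3 : 0 ≤ ε * density h x := by positivity
        linarith

/-- The Leibniz rule for energy densities of a strongly local form. -/
theorem mutualDensity_mul_left (f g h : E.core) : ∀ᵐ x ∂μ, mutualDensity (f * g) h x =
    f.1 x * mutualDensity g h x + g.1 x * mutualDensity f h x := by
  have h1 : ∀ n : ℕ, ∀ᵐ x ∂μ, |mutualDensity (f * g) h x -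
      (f.1 x * mutualDensity g h x + g.1 x * mutualDensity f h x)| ≤
      9 * (1 / ((n : ℝ) + 1)) * (density f x + density g x + density h x) := fun n =>
    abs_mutualDensity_mul_sub_le f g h (by positivity)
  filter_upwards [ae_all_iff.2 h1] with x hx
  have h2 : Tendsto (fun n : ℕ => 9 * (1 / ((n : ℝ) + 1)) *
      (density f x + density g x + density h x)) atTop (𝓝 0) := by
    simpa using ((tendsto_one_div_add_atTop_nhds_zero_nat (𝕜 := ℝ)).const_mul 9).mul_const
      (density f x + density g x + density h x)
  exact sub_eq_zero.1 (abs_eq_zero.1 (le_antisymm (ge_of_tendsto' h2 hx) (abs_nonneg _)))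

end Density

end DirichletForm

/-- A bounded linear map given on a dense set of parameters extends to the whole space. -/
theorem exists_clm_of_denseRange {V N F : Type*} [AddCommMonoid V] [Module ℝ V]
    [NormedAddCommGroup N] [NormedSpace ℝ N] [NormedAddCommGroup F] [NormedSpace ℝ F]
    [CompleteSpace F] (T₀ : V →ₗ[ℝ] F) (e : V →ₗ[ℝ] N) (he : DenseRange e) {C : ℝ}
    (h : ∀ v, ‖T₀ v‖ ≤ C * ‖e v‖) :
    ∃ T : N →L[ℝ] F, (∀ v, T (e v) = T₀ v) ∧ ∀ x, ‖T x‖ ≤ C * ‖x‖ := by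
  let _ : AddCommGroup V := Module.addCommMonoidToAddCommGroup ℝ
  exact ⟨T₀.extendOfNorm e, LinearMap.extendOfNorm_eq he ⟨C, h⟩,
    LinearMap.norm_extendOfNorm_apply_le he C h⟩

/-! ### One-forms: the tensor form, the action of 𝒞 and the derivation. -/

namespace DirichletForm

section OneForms

variable {X : Type*} [MetricSpace X] [MeasurableSpace X] [BorelSpace X] {μ : Measure X}
  [μ.Regular] {E : DirichletForm μ} [LocallyCompactSpace X] [SecondCountableTopology X]

theorem mutualCarre_comm (f g φ : E.core) : mutualCarre f g φ = mutualCarre g f φ := by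
  have e : f * g = g * f := core_ext fun x => by simp [mul_comm]
  simp only [mutualCarre, e]
  ring

theorem mutualCarre_self (f φ : E.core) : mutualCarre f f φ = carre f φ := by
  simp only [mutualCarre, carre]
  ring

theorem mutualCarre_add_left (f g h φ : E.core) :
    mutualCarre (f + g) h φ = mutualCarre f h φ + mutualCarre g h φ := by
  have e1 : φ * (f + g) = φ * f + φ * g := core_ext fun x => by simp [mul_add]
  have e2 : (f + g) * h = f * h + g * h := core_ext fun x => by simp [add_mul]
  simp only [mutualCarre, e1, e2, coreForm_add_left, coreForm_add_right]
  ring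

theorem mutualCarre_smul_left (c : ℝ) (f h φ : E.core) :
    mutualCarre (c • f) h φ = c * mutualCarre f h φ := by
  have e1 : φ * (c • f) = c • (φ * f) := core_ext fun x => by
    simp only [core_mul_apply, core_smul_apply]
    ring
  have e2 : (c • f) * h = c • (f * h) := core_ext fun x => by
    simp only [core_mul_apply, core_smul_apply]
    ring
  simp only [mutualCarre, e1, e2, coreForm_smul_left, coreForm_smul_right]
  ring

theorem mutualCarre_add_right (f g h φ : E.core) :
    mutualCarre f (g + h) φ = mutualCarre f g φ + mutualCarre f h φ := by
  rw [mutualCarre_comm, mutualCarre_add_left, mutualCarre_comm g, mutualCarre_comm h]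

theorem mutualCarre_smul_right (c : ℝ) (f h φ : E.core) :
    mutualCarre f (c • h) φ = c * mutualCarre f h φ := by
  rw [mutualCarre_comm, mutualCarre_smul_left, mutualCarre_comm h]

theorem mutualCarre_test_add (f g φ ψ : E.core) :
    mutualCarre f g (φ + ψ) = mutualCarre f g φ + mutualCarre f g ψ := by
  have e (h : E.core) : (φ + ψ) * h = φ * h + ψ * h := core_ext fun x => by simp [add_mul]
  simp only [mutualCarre, e, coreForm_add_left]
  ring

theorem mutualCarre_test_smul (c : ℝ) (f g φ : E.core) :
    mutualCarre f g (c • φ) = c * mutualCarre f g φ := by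
  have e (h : E.core) : (c • φ) * h = c • (φ * h) := core_ext fun x => by simp [mul_assoc]
  simp only [mutualCarre, e, coreForm_smul_left]
  ring

theorem core_mul_comm (f g : E.core) : f * g = g * f := core_ext fun x => by simp [mul_comm]

theorem core_mul_assoc (f g h : E.core) : f * g * h = f * (g * h) :=
  core_ext fun x => by simp [mul_assoc]

theorem core_mul_add (f g h : E.core) : f * (g + h) = f * g + f * h :=
  core_ext fun x => by simp [mul_add]

theorem core_mul_smul (c : ℝ) (f g : E.core) : f * (c • g) = c • (f * g) :=
  core_ext fun x => by simp [mul_left_comm]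

/-- The functional `c ⊗ d ↦ ∫ b d dΓ(a, c)`. -/
def tensorFunctional (a b : E.core) : (E.core ⊗[ℝ] E.core) →ₗ[ℝ] ℝ :=
  TensorProduct.lift (LinearMap.mk₂ ℝ (fun c d => mutualCarre a c (b * d))
    (fun c c' d => mutualCarre_add_right _ _ _ _)
    (fun r c d => mutualCarre_smul_right _ _ _ _)
    (fun c d d' => by rw [core_mul_add, mutualCarre_test_add])
    (fun r c d => by rw [core_mul_smul, mutualCarre_test_smul, smul_eq_mul]))

theorem tensorFunctional_tmul (a b c d : E.core) :
    tensorFunctional a b (c ⊗ₜ[ℝ] d) = mutualCarre a c (b * d) := rfl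

/-- The bilinear form `⟨a ⊗ b, c ⊗ d⟩ = ∫ b d dΓ(a, c)`. -/
def energyTensor : (E.core ⊗[ℝ] E.core) →ₗ[ℝ] (E.core ⊗[ℝ] E.core) →ₗ[ℝ] ℝ :=
  TensorProduct.lift (LinearMap.mk₂ ℝ tensorFunctional
    (fun a a' b => TensorProduct.ext' fun c d => by
      simp only [LinearMap.add_apply, tensorFunctional_tmul, mutualCarre_add_left])
    (fun r a b => TensorProduct.ext' fun c d => by
      simp only [LinearMap.smul_apply, tensorFunctional_tmul, mutualCarre_smul_left, smul_eq_mul])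
    (fun a b b' => TensorProduct.ext' fun c d => by
      simp only [LinearMap.add_apply, tensorFunctional_tmul, core_mul_comm _ d, core_mul_add,
        mutualCarre_test_add])
    (fun r a b => TensorProduct.ext' fun c d => by
      simp only [LinearMap.smul_apply, tensorFunctional_tmul, core_mul_comm _ d, core_mul_smul,
        mutualCarre_test_smul, smul_eq_mul]))

theorem energyTensor_tmul (a b c d : E.core) :
    energyTensor (a ⊗ₜ[ℝ] b) (c ⊗ₜ[ℝ] d) = mutualCarre a c (b * d) := rfl

theorem energyTensor_comm (v w : E.core ⊗[ℝ] E.core) : energyTensor v w = energyTensor w v := by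
  induction v using TensorProduct.induction_on with
  | zero => simp
  | add v v' hv hv' => simp only [map_add, LinearMap.add_apply, hv, hv']
  | tmul a b =>
    induction w using TensorProduct.induction_on with
    | zero => simp
    | add v v' hv hv' => simp only [map_add, LinearMap.add_apply, hv, hv']
    | tmul c d => rw [energyTensor_tmul, energyTensor_tmul, mutualCarre_comm, core_mul_comm]

variable [hE : E.IsAdmissible]

theorem mutualDensity_sum_left {ι : Type*} (s : Finset ι) (q : ι → ℝ) (a : ι → E.core)
    (h : E.core) : ∀ᵐ x ∂μ, mutualDensity (∑ i ∈ s, q i • a i) h x =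
      ∑ i ∈ s, q i * mutualDensity (a i) h x := by
  classical
  induction s using Finset.induction_on with
  | empty =>
    filter_upwards [mutualDensity_smul_left 0 h h] with x hx
    rw [zero_smul, zero_mul] at hx
    simpa using hx
  | insert i s hi ih =>
    rw [Finset.sum_insert hi]
    filter_upwards [ih, mutualDensity_add_left (q i • a i) (∑ i ∈ s, q i • a i) h,
      mutualDensity_smul_left (q i) (a i) h] with x h1 h2 h3
    rw [h2, h1, h3, Finset.sum_insert hi]

theorem density_sum {ι : Type*} [Fintype ι] (q : ι → ℝ) (a : ι → E.core) :
    ∀ᵐ x ∂μ, density (∑ i, q i • a i) x =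
      ∑ i, ∑ j, q i * q j * mutualDensity (a i) (a j) x := by
  have h1 : ∀ᵐ x ∂μ, ∀ i, mutualDensity (a i) (∑ j, q j • a j) x =
      ∑ j, q j * mutualDensity (a i) (a j) x := by
    rw [ae_all_iff]
    intro i
    have h3 : ∀ᵐ x ∂μ, ∀ j, mutualDensity (a j) (a i) x = mutualDensity (a i) (a j) x :=
      ae_all_iff.2 fun j => mutualDensity_comm _ _
    filter_upwards [mutualDensity_comm (a i) (∑ j, q j • a j),
      mutualDensity_sum_left Finset.univ q a (a i), h3] with x h1 h2 h3
    rw [h1, h2]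
    exact Finset.sum_congr rfl fun j _ => by rw [h3 j]
  filter_upwards [mutualDensity_self (∑ i, q i • a i),
    mutualDensity_sum_left Finset.univ q a (∑ i, q i • a i), h1] with x h2 h3 h4
  rw [← h2, h3]
  refine Finset.sum_congr rfl fun i _ => ?_
  rw [h4 i, Finset.mul_sum]
  exact Finset.sum_congr rfl fun j _ => by ring

/-- For one vector r the sum is the density of Γ(∑ rᵢaᵢ), up to a null set depending on r. Rational
vectors require only countably many null sets, and continuity in r gives the rest. -/
theorem mutualDensity_posSemidef {ι : Type*} [Fintype ι] (a : ι → E.core) :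
    ∀ᵐ x ∂μ, ∀ r : ι → ℝ, 0 ≤ ∑ i, ∑ j, r i * r j * mutualDensity (a i) (a j) x := by
  have h1 : ∀ᵐ x ∂μ, ∀ q : ι → ℚ,
      0 ≤ ∑ i, ∑ j, (q i : ℝ) * (q j : ℝ) * mutualDensity (a i) (a j) x := by
    rw [ae_all_iff]
    intro q
    filter_upwards [density_sum (fun i => (q i : ℝ)) a] with x hx
    rw [← hx]
    exact density_nonneg _ _
  filter_upwards [h1] with x hx r
  have hd : DenseRange fun (q : ι → ℚ) (i : ι) => (q i : ℝ) :=
    DenseRange.piMap fun _ => Rat.denseRange_cast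
  refine hd.induction_on (p := fun r : ι → ℝ =>
    0 ≤ ∑ i, ∑ j, r i * r j * mutualDensity (a i) (a j) x) r ?_ hx
  exact isClosed_le continuous_const (by fun_prop)

/-- Multiplication of the second factor by `c`. -/
def tensorMul (c : E.core) : (E.core ⊗[ℝ] E.core) →ₗ[ℝ] (E.core ⊗[ℝ] E.core) :=
  LinearMap.lTensor E.core
    { toFun := fun b => c * b, map_add' := core_mul_add c, map_smul' := fun r => core_mul_smul r c }

theorem tensorMul_tmul (c a b : E.core) : tensorMul c (a ⊗ₜ[ℝ] b) = a ⊗ₜ[ℝ] (c * b) := rfl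

/-- For v = ∑ aᵢ ⊗ bᵢ the density is ρ = ∑ bᵢbⱼ Γ(aᵢ, aⱼ), the squared fibre norm. It is nonnegative
by the pointwise Gram matrix with coefficients bᵢ(x), and multiplication by c scales it by c². Hence
both the positivity of the tensor form and the boundedness of the action. -/
theorem exists_energyTensor_density (v : E.core ⊗[ℝ] E.core) : ∃ ρ : X → ℝ, Integrable ρ μ ∧
    (∀ᵐ x ∂μ, 0 ≤ ρ x) ∧ energyTensor v v = ∫ x, ρ x ∂μ ∧
      ∀ c : E.core, energyTensor (tensorMul c v) (tensorMul c v) = ∫ x, c.1 x ^ 2 * ρ x ∂μ := by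
  obtain ⟨S, rfl⟩ := TensorProduct.exists_finset v
  have hint (i j : E.core × E.core) :
      Integrable (fun x => (i.2 * j.2).1 x * mutualDensity i.1 j.1 x) μ :=
    integrable_core_mul _ (integrable_mutualDensity _ _)
  have hint' (c : E.core) (i j : E.core × E.core) :
      Integrable (fun x => ((c * i.2) * (c * j.2)).1 x * mutualDensity i.1 j.1 x) μ :=
    integrable_core_mul _ (integrable_mutualDensity _ _)
  refine ⟨fun x => ∑ i ∈ S, ∑ j ∈ S, (i.2 * j.2).1 x * mutualDensity i.1 j.1 x,
    integrable_finsetSum _ fun i _ => integrable_finsetSum _ fun j _ => hint i j, ?_, ?_, ?_⟩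
  · filter_upwards [mutualDensity_posSemidef fun i : S => i.1.1] with x hx
    have h1 := hx fun i => i.1.2.1 x
    rw [← Finset.sum_coe_sort]
    simp_rw [← Finset.sum_coe_sort S (fun j => (_ : ℝ)), core_mul_apply]
    exact h1
  · rw [integral_finsetSum _ fun i _ => integrable_finsetSum _ fun j _ => hint i j]
    simp_rw [integral_finsetSum _ fun j _ => hint _ j, map_sum, LinearMap.sum_apply,
      energyTensor_tmul, integral_core_mul_mutualDensity]
    exact Finset.sum_comm
  · intro c
    have e (x : X) : c.1 x ^ 2 * ∑ i ∈ S, ∑ j ∈ S, (i.2 * j.2).1 x * mutualDensity i.1 j.1 x =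
        ∑ i ∈ S, ∑ j ∈ S, ((c * i.2) * (c * j.2)).1 x * mutualDensity i.1 j.1 x := by
      simp_rw [Finset.mul_sum, core_mul_apply]
      exact Finset.sum_congr rfl fun i _ => Finset.sum_congr rfl fun j _ => by ring
    simp_rw [e]
    rw [integral_finsetSum _ fun i _ => integrable_finsetSum _ fun j _ => hint' c i j]
    simp_rw [integral_finsetSum _ fun j _ => hint' c _ j, map_sum, LinearMap.sum_apply,
      tensorMul_tmul, energyTensor_tmul, integral_core_mul_mutualDensity]
    exact Finset.sum_comm

theorem isTensorForm_energyTensor : E.IsTensorForm energyTensor := by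
  refine ⟨energyTensor_comm, fun v => ?_, fun a b c d => ?_⟩
  · obtain ⟨ρ, -, h0, h1, -⟩ := exists_energyTensor_density v
    rw [h1]
    exact integral_nonneg_of_ae h0
  · rw [energyTensor_tmul, ← integral_core_mul_mutualDensity, ← mutualEnergy_eq]
    rfl

theorem tensorForm_eq : E.tensorForm = energyTensor := by
  have h : ∃ B, E.IsTensorForm B := ⟨_, isTensorForm_energyTensor⟩
  rw [tensorForm, dif_pos h]
  refine TensorProduct.ext' fun a b => TensorProduct.ext' fun c d => ?_
  rw [h.choose_spec.2.2, isTensorForm_energyTensor.2.2]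

theorem energyTensor_tensorMul_le (c : E.core) {M : ℝ} (hc : ∀ x, |c.1 x| ≤ M)
    (v : E.core ⊗[ℝ] E.core) :
    energyTensor (tensorMul c v) (tensorMul c v) ≤ M ^ 2 * energyTensor v v := by
  obtain ⟨ρ, hρ, h0, h1, h2⟩ := exists_energyTensor_density v
  rw [h1, h2, ← integral_const_mul]
  have h3 : ∀ x, c.1 x ^ 2 ≤ M ^ 2 := fun x =>
    sq_le_sq' (by linarith [neg_le_of_abs_le (hc x)]) (le_of_abs_le (hc x))
  refine integral_mono_ae ?_ (hρ.const_mul _) ?_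
  · exact hρ.bdd_mul (c := M ^ 2) (c.1.continuous.pow 2).aestronglyMeasurable (ae_of_all _ fun x => by
      simpa using h3 x)
  · filter_upwards [h0] with x hx
    exact mul_le_mul_of_nonneg_right (h3 x) hx

/-- The canonical map `𝒞 ⊗ 𝒞 → ℋ`. -/
def toOneForms : (E.core ⊗[ℝ] E.core) →ₗ[ℝ] E.OneForms :=
  (UniformSpace.Completion.toComplL (𝕜 := ℝ) (E := E.PreOneForms)).toLinearMap ∘ₗ E.toPreOneForms

theorem toOneForms_tmul (a b : E.core) : toOneForms (a ⊗ₜ[ℝ] b) = E.tens a b := rfl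

theorem denseRange_toOneForms : DenseRange (toOneForms (E := E)) :=
  UniformSpace.Completion.denseRange_coe (α := E.PreOneForms)

theorem inner_toOneForms (v w : E.core ⊗[ℝ] E.core) :
    inner ℝ (toOneForms v) (toOneForms w) = energyTensor v w := by
  rw [← tensorForm_eq]
  exact UniformSpace.Completion.inner_coe _ _

theorem norm_toOneForms_sq (v : E.core ⊗[ℝ] E.core) :
    ‖toOneForms v‖ ^ 2 = energyTensor v v := by
  rw [← real_inner_self_eq_norm_sq, inner_toOneForms]

theorem inner_tens (a b c d : E.core) :
    inner ℝ (E.tens a b) (E.tens c d) = mutualCarre a c (b * d) :=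
  inner_toOneForms _ _

theorem oneForms_clm_ext {F : Type*} [NormedAddCommGroup F] [NormedSpace ℝ F]
    {S T : E.OneForms →L[ℝ] F} (h : ∀ a b, S (E.tens a b) = T (E.tens a b)) : S = T := by
  have h1 : ∀ v, S (toOneForms v) = T (toOneForms v) := fun v => by
    induction v using TensorProduct.induction_on with
    | zero => simp
    | add v w hv hw => simp only [map_add, hv, hw]
    | tmul a b => exact h a b
  ext1 ω
  exact congrFun (denseRange_toOneForms.equalizer S.continuous T.continuous (funext h1)) ω

theorem oneForms_ext {ω η : E.OneForms}
    (h : ∀ c d, inner ℝ ω (E.tens c d) = inner ℝ η (E.tens c d)) : ω = η := by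
  refine ext_inner_right ℝ fun v => ?_
  have := oneForms_clm_ext (S := innerSL ℝ ω) (T := innerSL ℝ η) h
  exact congrArg (fun S : E.OneForms →L[ℝ] ℝ => S v) this

theorem mutualCarre_mul_left (a f c d : E.core) : mutualCarre (a * f) c d =
    mutualCarre f c (a * d) + mutualCarre a c (f * d) := by
  rw [← integral_core_mul_mutualDensity, ← integral_core_mul_mutualDensity,
    ← integral_core_mul_mutualDensity, ← integral_add
    (integrable_core_mul _ (integrable_mutualDensity _ _))
    (integrable_core_mul _ (integrable_mutualDensity _ _))]
  refine integral_congr_ae ?_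
  filter_upwards [mutualDensity_mul_left a f c] with x hx
  rw [hx, core_mul_apply, core_mul_apply]
  ring

/-- This is b ∂(ca) - ab ∂c = cb ∂a, the Leibniz rule. The prescribed left action is therefore
multiplication of the second factor, for which boundedness and symmetry are clear. -/
theorem tens_sub_tens (c a b : E.core) :
    E.tens (c * a) b - E.tens c (a * b) = E.tens a (c * b) := by
  refine oneForms_ext fun e d => ?_
  rw [inner_sub_left, inner_tens, inner_tens, inner_tens, mutualCarre_mul_left, core_mul_assoc,
    core_mul_assoc]
  ring

theorem exists_isLeftAction (c : E.core) : ∃ T, E.IsLeftAction c T := by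
  obtain ⟨M, hM0, hM⟩ := exists_abs_le c.1
  have hb : ∀ v, ‖(toOneForms ∘ₗ tensorMul c) v‖ ≤ M * ‖toOneForms (E := E) v‖ := fun v => by
    refine le_of_sq_le_sq ?_ (by positivity)
    rw [mul_pow, norm_toOneForms_sq, LinearMap.comp_apply, norm_toOneForms_sq]
    exact energyTensor_tensorMul_le c hM v
  obtain ⟨T, hT, -⟩ := exists_clm_of_denseRange _ _ denseRange_toOneForms hb
  refine ⟨T, fun a b p q hp hq => ?_⟩
  have hp' : p = c * a := Subtype.ext hp
  have hq' : q = a * b := Subtype.ext hq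
  rw [hp', hq', tens_sub_tens, ← toOneForms_tmul, hT]
  rfl

theorem leftAction_tens (c a b : E.core) : E.leftAction c (E.tens a b) = E.tens a (c * b) := by
  rw [leftAction, dif_pos (exists_isLeftAction c),
    (exists_isLeftAction c).choose_spec a b (c * a) (a * b) rfl rfl, tens_sub_tens]

theorem inner_leftAction (c : E.core) (ω η : E.OneForms) :
    inner ℝ (E.leftAction c ω) η = inner ℝ ω (E.leftAction c η) := by
  have h : ContinuousLinearMap.adjoint (E.leftAction c) = E.leftAction c := by
    refine oneForms_clm_ext fun a b => oneForms_ext fun e d => ?_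
    rw [ContinuousLinearMap.adjoint_inner_left, leftAction_tens, leftAction_tens, inner_tens,
      inner_tens]
    congr 1
    exact core_ext fun x => by
      simp only [core_mul_apply]
      ring
  rw [← ContinuousLinearMap.adjoint_inner_right, h]

theorem norm_leftAction_le (c : E.core) {M : ℝ} (hM : 0 ≤ M) (hc : ∀ x, |c.1 x| ≤ M)
    (ω : E.OneForms) : ‖E.leftAction c ω‖ ≤ M * ‖ω‖ := by
  have h1 : ∀ v, E.leftAction c (toOneForms v) = toOneForms (tensorMul c v) := fun v => by
    induction v using TensorProduct.induction_on with
    | zero => simp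
    | add v w hv hw => simp only [map_add, hv, hw]
    | tmul a b => exact leftAction_tens c a b
  refine denseRange_toOneForms.induction_on (p := fun ω => ‖E.leftAction c ω‖ ≤ M * ‖ω‖) ω
    (isClosed_le (by fun_prop) (by fun_prop)) fun v => ?_
  refine le_of_sq_le_sq ?_ (by positivity)
  rw [h1, mul_pow, norm_toOneForms_sq, norm_toOneForms_sq]
  exact energyTensor_tensorMul_le c hc v

/-- By strong locality a cutoff χ equal to 1 near the support of a acts as the constant 1, so a ⊗ χ
serves as a ⊗ 1. -/
theorem mutualCarre_eq_one_mul {a c d χ : E.core} {V : Set X} (hV : IsOpen V)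
    (haV : tsupport a.1 ⊆ V) (hχ : ∀ x ∈ V, χ.1 x = 1) :
    mutualCarre a c (χ * d) = mutualCarre a c d := by
  have h1 : χ * d * a = d * a := core_ext fun x => by
    by_cases hx : a.1 x = 0
    · simp [hx]
    · simp [hχ x (haV (subset_tsupport _ hx))]
  have h2 : E.coreForm (χ * d * c - d * c) a = 0 :=
    hE.stronglyLocal _ _ ⟨V, hV, haV, 0, fun x hx => by simp [hχ x hx]⟩
  have h3 : E.coreForm (χ * d - d) (a * c) = 0 :=
    hE.stronglyLocal _ _ ⟨V, hV, (tsupport_mul_subset _ _).trans haV, 0, fun x hx => by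
      simp [hχ x hx]⟩
  rw [coreForm_sub_left] at h2 h3
  simp only [mutualCarre, h1]
  linarith

theorem denseRange_core : DenseRange ((FormSpace.equiv E 0).symm.toLinearMap ∘ₗ E.coreToDom) := by
  intro u
  rw [Metric.mem_closure_range_iff]
  intro ε hε
  obtain ⟨f, hf⟩ := hE.regular.2 (FormSpace.equiv E 0 u) (ε ^ 2) (by positivity)
  refine ⟨f, ?_⟩
  rw [dist_eq_norm]
  refine lt_of_pow_lt_pow_left₀ 2 hε.le ?_
  rw [FormSpace.norm_sq]
  simpa [formOne] using hf

/-- On 𝒞 one sets ∂a = a ⊗ χₐ with χₐ = 1 near the support of a. Its pairings with c ⊗ d do not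
involve χₐ, so the map is linear, and ‖∂a‖² = ℰ(a, a). The ℰ₁-density of 𝒞 extends it to ℱ. -/
theorem exists_isDerivation : ∃ T, E.IsDerivation T := by
  choose χ _ _ hχ _ using fun a : E.core => exists_cutoff hE.regular
    a.1.hasCompactSupport.isCompact isOpen_univ (Set.subset_univ (tsupport a.1))
  have hin : ∀ a c d : E.core, inner ℝ (E.tens a (χ a)) (E.tens c d) = mutualCarre a c d :=
    fun a c d => by
      obtain ⟨V, hV, haV, hχV⟩ := hχ a
      rw [inner_tens, mutualCarre_eq_one_mul hV haV hχV]
  set T₀ : E.core →ₗ[ℝ] E.OneForms :=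
    { toFun := fun a => E.tens a (χ a)
      map_add' := fun a b => oneForms_ext fun c d => by
        rw [inner_add_left, hin, hin, hin, mutualCarre_add_left]
      map_smul' := fun r a => oneForms_ext fun c d => by
        rw [RingHom.id_apply, real_inner_smul_left, hin, hin, mutualCarre_smul_left] } with hT₀
  have hnorm : ∀ a, ‖T₀ a‖ ^ 2 = E.form (E.coreToDom a) (E.coreToDom a) := fun a => by
    obtain ⟨V, hV, haV, hχV⟩ := hχ a
    rw [← real_inner_self_eq_norm_sq]
    refine (hin a a (χ a)).trans ?_
    rw [mutualCarre_self, carre_of_eq_one hE.stronglyLocal hV haV hχV]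
    rfl
  set e : E.core →ₗ[ℝ] FormSpace E 0 := (FormSpace.equiv E 0).symm.toLinearMap ∘ₗ E.coreToDom
    with he
  have hb : ∀ a, ‖T₀ a‖ ≤ 1 * ‖e a‖ := fun a => by
    rw [one_mul]
    refine le_of_sq_le_sq ?_ (norm_nonneg _)
    rw [hnorm, FormSpace.norm_sq]
    simp [he]
  obtain ⟨T, hT, -⟩ := exists_clm_of_denseRange T₀ e denseRange_core hb
  -- ℰ(u, u) is written as ℰ₁(u) - ‖u‖² so that the inequality is a closed condition on the form
  -- space.
  have hTle : ∀ u : FormSpace E 0, ‖T u‖ ^ 2 ≤ ‖u‖ ^ 2 - ‖FormSpace.incl E 0 u‖ ^ 2 := fun u => by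
    refine denseRange_core.induction_on (p := fun u : FormSpace E 0 =>
      ‖T u‖ ^ 2 ≤ ‖u‖ ^ 2 - ‖FormSpace.incl E 0 u‖ ^ 2) u
      (isClosed_le (by fun_prop) (by fun_prop)) fun a => ?_
    change ‖T (e a)‖ ^ 2 ≤ ‖e a‖ ^ 2 - ‖FormSpace.incl E 0 (e a)‖ ^ 2
    rw [hT, hnorm, FormSpace.norm_sq, FormSpace.incl_apply]
    simp [he]
  refine ⟨T.toLinearMap ∘ₗ (FormSpace.equiv E 0).symm.toLinearMap, fun u => ?_, fun a c d => ?_⟩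
  · refine (hTle ((FormSpace.equiv E 0).symm u)).trans ?_
    rw [FormSpace.norm_sq, FormSpace.incl_apply]
    simp
  · rw [mutualEnergy_eq, integral_core_mul_mutualDensity, ← hin]
    exact congrArg (inner ℝ · (E.tens c d)) (hT a)

theorem isDerivation_derivation : E.IsDerivation E.derivation := by
  rw [derivation, dif_pos exists_isDerivation]
  exact exists_isDerivation.choose_spec

theorem inner_derivation_tens (a c d : E.core) :
    inner ℝ (E.derivation (E.coreToDom a)) (E.tens c d) = mutualCarre a c d := by
  rw [isDerivation_derivation.2, mutualEnergy_eq, integral_core_mul_mutualDensity]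

theorem norm_derivation_core_sq (a : E.core) :
    ‖E.derivation (E.coreToDom a)‖ ^ 2 = E.coreForm a a := by
  obtain ⟨χ, -, -, ⟨V, hV, haV, hχV⟩, -⟩ := exists_cutoff hE.regular
    a.1.hasCompactSupport.isCompact isOpen_univ (Set.subset_univ (tsupport a.1))
  have h : E.derivation (E.coreToDom a) = E.tens a χ := oneForms_ext fun c d => by
    rw [inner_derivation_tens, inner_tens, mutualCarre_eq_one_mul hV haV hχV]
  rw [← real_inner_self_eq_norm_sq]
  nth_rewrite 2 [h]
  rw [inner_derivation_tens, mutualCarre_self, carre_of_eq_one hE.stronglyLocal hV haV hχV]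

theorem derivation_mul (a f : E.core) : E.derivation (E.coreToDom (a * f)) =
    E.leftAction a (E.derivation (E.coreToDom f)) + E.tens a f := by
  refine oneForms_ext fun c d => ?_
  rw [inner_add_left, inner_leftAction, leftAction_tens, inner_derivation_tens,
    inner_derivation_tens, inner_tens, mutualCarre_mul_left]

end OneForms

end DirichletForm

/-! ### Multiplication by a gradient and the domain of the Dirac operator. -/

namespace DirichletForm

section Commutator

variable {X : Type*} [MetricSpace X] [MeasurableSpace X] [BorelSpace X] {μ : Measure X}
  [μ.Regular]

theorem coeFn_mulLp (a : C_c(X, ℝ)) (f : Lp ℝ 2 μ) :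
    (mulLp μ a f : X → ℝ) =ᵐ[μ] fun x => a x * f x :=
  MemLp.coeFn_toLp ((Lp.memLp f).mul' (r := 2) (p := ∞) (q := 2)
    (a.continuous.memLp_of_hasCompactSupport a.hasCompactSupport))

theorem norm_mulLp_le (a : C_c(X, ℝ)) {K : ℝ} (hK : 0 ≤ K) (ha : ∀ x, |a x| ≤ K)
    (f : Lp ℝ 2 μ) : ‖mulLp μ a f‖ ≤ K * ‖f‖ := by
  rw [← abs_of_nonneg hK, ← Real.norm_eq_abs, ← norm_smul]
  refine Lp.norm_le_norm_of_ae_le ?_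
  filter_upwards [coeFn_mulLp a f, Lp.coeFn_smul K f] with x h1 h2
  rw [h1, h2, Pi.smul_apply, smul_eq_mul, norm_mul, norm_mul]
  gcongr
  rw [Real.norm_eq_abs, Real.norm_eq_abs, abs_of_nonneg hK]
  exact ha x

theorem inner_mulLp (a : C_c(X, ℝ)) (f g : Lp ℝ 2 μ) :
    inner ℝ (mulLp μ a f) g = inner ℝ f (mulLp μ a g) := by
  rw [L2.inner_def, L2.inner_def]
  refine integral_congr_ae ?_
  filter_upwards [coeFn_mulLp a f, coeFn_mulLp a g] with x h1 h2
  rw [h1, h2]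
  simp only [RCLike.inner_apply, conj_trivial]
  ring

theorem mulLp_ccToLp (a f : C_c(X, ℝ)) : mulLp μ a (ccToLp μ f) = ccToLp μ (a * f) := by
  apply Lp.ext
  filter_upwards [coeFn_mulLp (μ := μ) a (ccToLp μ f), coeFn_ccToLp (μ := μ) f,
    coeFn_ccToLp (μ := μ) (a * f)] with x h1 h2 h3
  rw [h1, h2, h3, CompactlySupportedContinuousMap.mul_apply]

variable {E : DirichletForm μ} [LocallyCompactSpace X] [SecondCountableTopology X]

/-- The inclusion of `𝒞` into `L²`. -/
def coreToLp (E : DirichletForm μ) : E.core →ₗ[ℝ] Lp ℝ 2 μ := E.dom.subtype ∘ₗ E.coreToDom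

theorem coreToLp_apply (f : E.core) : E.coreToLp f = ccToLp μ f.1 := rfl

variable [hE : E.IsAdmissible]

theorem denseRange_coreToLp : DenseRange E.coreToLp := by
  have h1 : DenseRange (FormSpace.incl E 0) := by
    have : Set.range (FormSpace.incl E 0) = (E.dom : Set (Lp ℝ 2 μ)) := by
      ext u
      constructor
      · rintro ⟨v, rfl⟩
        exact (FormSpace.equiv E 0 v).2
      · intro hu
        exact ⟨(FormSpace.equiv E 0).symm ⟨u, hu⟩, rfl⟩
    rw [DenseRange, this]
    exact E.dense_dom
  exact h1.comp denseRange_core (FormSpace.incl E 0).continuous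

theorem norm_coreToLp_sq (f : E.core) : ‖E.coreToLp f‖ ^ 2 = ∫ x, f.1 x ^ 2 ∂μ := by
  rw [← real_inner_self_eq_norm_sq, coreToLp_apply, inner_ccToLp]
  refine integral_congr_ae ?_
  filter_upwards [coeFn_ccToLp (μ := μ) f.1] with x hx
  rw [hx, sq]

theorem norm_tens_sq (a f : E.core) : ‖E.tens a f‖ ^ 2 = carre a (f * f) := by
  rw [← real_inner_self_eq_norm_sq, inner_tens, mutualCarre_self]

theorem integrable_sq (f : E.core) : Integrable (fun x => f.1 x ^ 2) μ := by
  have := (f * f).1.continuous.integrable_of_hasCompactSupport (μ := μ) (f * f).1.hasCompactSupport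
  refine this.congr (ae_of_all _ fun x => ?_)
  exact (sq (f.1 x)).symm

theorem carre_add_carre_eq (u v f : E.core) : carre u (f * f) + carre v (f * f) =
    ∫ x, f.1 x ^ 2 * (density u x + density v x) ∂μ := by
  rw [← integral_core_mul_density, ← integral_core_mul_density, ← integral_add
    (integrable_core_mul _ (integrable_density _)) (integrable_core_mul _ (integrable_density _))]
  refine integral_congr_ae (ae_of_all _ fun x => ?_)
  simp only [core_mul_apply]
  ring

theorem integrable_sq_mul_density (u v f : E.core) :
    Integrable (fun x => f.1 x ^ 2 * (density u x + density v x)) μ := by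
  refine (integrable_core_mul (f * f) ((integrable_density u).add (integrable_density v))).congr
    (ae_of_all _ fun x => ?_)
  simp only [core_mul_apply, Pi.add_apply, sq]

theorem carre_add_carre_le {u v : E.core} {C : ℝ} (h : ∀ᵐ x ∂μ, density u x + density v x ≤ C)
    (f : E.core) : carre u (f * f) + carre v (f * f) ≤ C * ‖E.coreToLp f‖ ^ 2 := by
  rw [carre_add_carre_eq, norm_coreToLp_sq, ← integral_const_mul]
  refine integral_mono_ae (integrable_sq_mul_density u v f) ((integrable_sq f).const_mul C) ?_
  filter_upwards [h] with x hx
  have := mul_le_mul_of_nonneg_left hx (sq_nonneg (f.1 x))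
  linarith

/-- This converse of `carre_add_carre_le` turns an operator bound into a pointwise one, and yields
the lower bound for the norm of the commutator. -/
theorem density_add_density_le_of_carre_le {u v : E.core} {C : ℝ}
    (h : ∀ f : E.core, carre u (f * f) + carre v (f * f) ≤ C * ‖E.coreToLp f‖ ^ 2) :
    ∀ᵐ x ∂μ, density u x + density v x ≤ C := by
  have h1 := ae_nonneg_of_integral_sq_mul hE.regular (h := fun x => C - (density u x + density v x))
    ((locallyIntegrable_const C).sub
      ((integrable_density u).add (integrable_density v)).locallyIntegrable) isOpen_univ
    fun f _ => by
      have e : ∀ x, f.1 x ^ 2 * (C - (density u x + density v x)) =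
        C * f.1 x ^ 2 - f.1 x ^ 2 * (density u x + density v x) := fun x => by ring
      simp_rw [e]
      rw [integral_sub ((integrable_sq f).const_mul C) (integrable_sq_mul_density u v f),
        integral_const_mul, ← norm_coreToLp_sq, ← carre_add_carre_eq]
      linarith [h f]
  filter_upwards [h1] with x hx
  linarith [hx trivial]

/-- `M` is the extension to `L²` of the map `f ↦ a ⊗ f = f ∂a` on `𝒞`. -/
def IsGradientMul (a : E.core) (M : Lp ℝ 2 μ →L[ℝ] E.OneForms) : Prop :=
  ∀ f : E.core, M (E.coreToLp f) = E.tens a f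

theorem exists_isGradientMul {a : E.core} {C : ℝ} (hC : 0 ≤ C) (h : ∀ᵐ x ∂μ, density a x ≤ C) :
    ∃ M, IsGradientMul a M := by
  set T₀ : E.core →ₗ[ℝ] E.OneForms :=
    { toFun := fun f => E.tens a f
      map_add' := fun f g => by
        simp only [← toOneForms_tmul, TensorProduct.tmul_add, map_add]
      map_smul' := fun r f => by
        simp only [← toOneForms_tmul, TensorProduct.tmul_smul, map_smul, RingHom.id_apply] }
    with hT₀
  obtain ⟨M, hM, -⟩ := exists_clm_of_denseRange T₀ E.coreToLp denseRange_coreToLp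
    (C := Real.sqrt C) (fun f => by
      refine le_of_sq_le_sq ?_ (by positivity)
      rw [mul_pow, Real.sq_sqrt hC]
      change ‖E.tens a f‖ ^ 2 ≤ _
      rw [norm_tens_sq]
      have h1 := carre_nonneg a (φ := f * f) fun x => mul_self_nonneg _
      have h2 : ∀ᵐ x ∂μ, density a x + density (0 : E.core) x ≤ C := by
        filter_upwards [h, density_eq_zero_of_const (f := (0 : E.core)) isOpen_univ (c := 0)
          fun x _ => rfl] with x h1 h2
        rw [h2 trivial, add_zero]
        exact h1
      have h3 := carre_nonneg (0 : E.core) (φ := f * f) fun x => mul_self_nonneg _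
      linarith [carre_add_carre_le h2 f])
  exact ⟨M, hM⟩

section GradientMul

variable {u v : E.core} {M N : Lp ℝ 2 μ →L[ℝ] E.OneForms}

/-- The left side is ‖(M + iN)(f + ig)‖². Its cross terms are -2∫ fg dΓ(u, v) and +2∫ gf dΓ(u, v),
and they cancel. -/
theorem norm_sq_gradientMul_le (hM : IsGradientMul u M) (hN : IsGradientMul v N) {C : ℝ}
    (h : ∀ᵐ x ∂μ, density u x + density v x ≤ C) (f g : Lp ℝ 2 μ) :
    ‖M f - N g‖ ^ 2 + ‖M g + N f‖ ^ 2 ≤ C * (‖f‖ ^ 2 + ‖g‖ ^ 2) := by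
  refine (denseRange_coreToLp (E := E)).induction_on₂ (p := fun f g : Lp ℝ 2 μ =>
    ‖M f - N g‖ ^ 2 + ‖M g + N f‖ ^ 2 ≤ C * (‖f‖ ^ 2 + ‖g‖ ^ 2))
    (isClosed_le (by fun_prop) (by fun_prop)) (fun f g => ?_) f g
  rw [hM, hM, hN, hN, norm_sub_sq_real, norm_add_sq_real, inner_tens, inner_tens, norm_tens_sq,
    norm_tens_sq, norm_tens_sq, norm_tens_sq, core_mul_comm g f]
  linarith [carre_add_carre_le h f, carre_add_carre_le h g]

/-- M* + iN* is the adjoint of M - iN, whose bound is the previous lemma at the conjugate (f, -g).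
The squared norm of the image f + ig is ⟨ω, Mf + Ng⟩ + ⟨η, Mg - Nf⟩. -/
theorem norm_sq_adjoint_gradientMul_le (hM : IsGradientMul u M) (hN : IsGradientMul v N) {C : ℝ}
    (hC : 0 ≤ C) (h : ∀ᵐ x ∂μ, density u x + density v x ≤ C) (ω η : E.OneForms) :
    ‖ContinuousLinearMap.adjoint M ω - ContinuousLinearMap.adjoint N η‖ ^ 2 +
      ‖ContinuousLinearMap.adjoint M η + ContinuousLinearMap.adjoint N ω‖ ^ 2 ≤
        C * (‖ω‖ ^ 2 + ‖η‖ ^ 2) := by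
  set f := ContinuousLinearMap.adjoint M ω - ContinuousLinearMap.adjoint N η with hf
  set g := ContinuousLinearMap.adjoint M η + ContinuousLinearMap.adjoint N ω with hg
  have e : ‖f‖ ^ 2 + ‖g‖ ^ 2 = inner ℝ ω (M f + N g) + inner ℝ η (M g - N f) := by
    rw [← real_inner_self_eq_norm_sq, ← real_inner_self_eq_norm_sq]
    nth_rewrite 1 [hf]
    nth_rewrite 3 [hg]
    rw [inner_sub_left, inner_add_left, ContinuousLinearMap.adjoint_inner_left,
      ContinuousLinearMap.adjoint_inner_left, ContinuousLinearMap.adjoint_inner_left,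
      ContinuousLinearMap.adjoint_inner_left, inner_add_right, inner_sub_right]
    ring
  have h1 := norm_sq_gradientMul_le hM hN h f (-g)
  rw [map_neg, map_neg, sub_neg_eq_add, norm_neg, neg_add_eq_sub, norm_sub_rev] at h1
  have h2 := real_inner_le_norm ω (M f + N g)
  have h3 := real_inner_le_norm η (M g - N f)
  have h4 : C * (2 * (‖ω‖ * ‖M f + N g‖)) ≤ C ^ 2 * ‖ω‖ ^ 2 + ‖M f + N g‖ ^ 2 := by
    nlinarith [sq_nonneg (C * ‖ω‖ - ‖M f + N g‖)]
  have h5 : C * (2 * (‖η‖ * ‖M g - N f‖)) ≤ C ^ 2 * ‖η‖ ^ 2 + ‖M g - N f‖ ^ 2 := by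
    nlinarith [sq_nonneg (C * ‖η‖ - ‖M g - N f‖)]
  -- The weighted estimates h4 and h5 finish the proof after division by C. For C = 0 the vectors Mf
  -- + Ng and Mg - Nf vanish.
  rcases hC.eq_or_lt with h0 | h0
  · rw [← h0] at h1 ⊢
    have h6 : ‖M f + N g‖ = 0 := by nlinarith [norm_nonneg (M f + N g), sq_nonneg ‖M g - N f‖]
    have h7 : ‖M g - N f‖ = 0 := by nlinarith [norm_nonneg (M g - N f), sq_nonneg ‖M f + N g‖]
    rw [h6] at h2
    rw [h7] at h3
    rw [e]
    linarith
  · refine le_of_mul_le_mul_left ?_ h0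
    have h6 := mul_le_mul_of_nonneg_left (add_le_add h2 h3) hC
    rw [← e] at h6
    nlinarith

/-- The derivation as a bounded operator on the form space. -/
def derivationCLM (E : DirichletForm μ) [hE : E.IsAdmissible] : FormSpace E 0 →L[ℝ] E.OneForms :=
  (E.derivation ∘ₗ (FormSpace.equiv E 0).toLinearMap).mkContinuous 1 fun u => by
    rw [one_mul]
    refine le_of_sq_le_sq ?_ (norm_nonneg _)
    rw [FormSpace.norm_sq]
    refine (isDerivation_derivation.1 (FormSpace.equiv E 0 u)).trans ?_
    simp

/-- Multiplication by `a` as a bounded operator on `L²`. -/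
def mulLpCLM (μ : Measure X) [μ.Regular] (a : C_c(X, ℝ)) : Lp ℝ 2 μ →L[ℝ] Lp ℝ 2 μ :=
  (mulLp μ a).mkContinuous (exists_abs_le a).choose
    (norm_mulLp_le a (exists_abs_le a).choose_spec.1 (exists_abs_le a).choose_spec.2)

/-- On 𝒞 the rule ∂(uf) = u ∂f + Mf, with M bounded, makes multiplication by u continuous for ℰ₁. It
extends to the form space, and both identities persist because they are closed conditions. -/
theorem exists_mul_mem_dom (hM : IsGradientMul u M) (f : E.dom) : ∃ g : E.dom,
    (g : Lp ℝ 2 μ) = mulLp μ u.1 f ∧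
      E.derivation g = E.leftAction u (E.derivation f) + M f := by
  obtain ⟨K, hK0, hK⟩ := exists_abs_le u.1
  set e : E.core →ₗ[ℝ] FormSpace E 0 := (FormSpace.equiv E 0).symm.toLinearMap ∘ₗ E.coreToDom
    with he
  have hec : ∀ f, FormSpace.equiv E 0 (e f) = E.coreToDom f := fun f => rfl
  set T₀ : E.core →ₗ[ℝ] FormSpace E 0 := e ∘ₗ
    { toFun := fun f => u * f, map_add' := core_mul_add u,
      map_smul' := fun r => core_mul_smul r u } with hT₀
  have hT₀a : ∀ f, T₀ f = e (u * f) := fun f => rfl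
  obtain ⟨T, hT, -⟩ := exists_clm_of_denseRange T₀ e denseRange_core (C := K + ‖M‖ + K)
    (fun f => by
      refine le_of_sq_le_sq ?_ (by positivity)
      have h1 : ‖E.derivationCLM (e f)‖ ≤ ‖e f‖ := by
        simpa using (E.derivationCLM.le_opNorm (e f)).trans (mul_le_mul_of_nonneg_right
          (LinearMap.mkContinuous_norm_le _ zero_le_one _) (norm_nonneg _))
      have h2 : ‖E.coreToLp f‖ ≤ ‖e f‖ := by
        refine le_of_sq_le_sq ?_ (norm_nonneg _)
        rw [FormSpace.norm_sq]
        have := div_nonneg (E.nonneg (E.coreToDom f)) (by positivity : (0 : ℝ) ≤ (0 : ℕ) + 1)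
        exact le_add_of_nonneg_left this
      have h3 : ‖E.derivation (E.coreToDom (u * f))‖ ≤ (K + ‖M‖) * ‖e f‖ := by
        rw [derivation_mul, ← hM, add_mul]
        refine (norm_add_le _ _).trans (add_le_add ?_ ?_)
        · refine (norm_leftAction_le u hK0 hK _).trans ?_
          gcongr
          exact h1
        · refine (M.le_opNorm _).trans ?_
          gcongr
      have h4 : ‖(E.coreToDom (u * f) : Lp ℝ 2 μ)‖ ≤ K * ‖e f‖ := by
        refine (le_of_eq ?_).trans ((norm_mulLp_le u.1 hK0 hK (E.coreToLp f)).trans ?_)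
        · rw [coreToLp_apply, mulLp_ccToLp]
          rfl
        · gcongr
      rw [hT₀a, FormSpace.norm_sq, hec, Nat.cast_zero, zero_add, div_one]
      have h5 : E.form (E.coreToDom (u * f)) (E.coreToDom (u * f)) ≤
          ((K + ‖M‖) * ‖e f‖) ^ 2 := by
        refine (norm_derivation_core_sq (u * f)).symm.le.trans ?_
        gcongr
      have h6 : ‖(E.coreToDom (u * f) : Lp ℝ 2 μ)‖ ^ 2 ≤ (K * ‖e f‖) ^ 2 := by gcongr
      have h7 : 0 ≤ (K + ‖M‖) * ‖e f‖ * (K * ‖e f‖) := by positivity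
      nlinarith)
  have hL : ∀ w : FormSpace E 0, FormSpace.incl E 0 (T w) =
      mulLpCLM μ u.1 (FormSpace.incl E 0 w) := fun w => by
    refine denseRange_core.induction_on (p := fun w : FormSpace E 0 => FormSpace.incl E 0 (T w) =
      mulLpCLM μ u.1 (FormSpace.incl E 0 w)) w (isClosed_eq (by fun_prop) (by fun_prop)) fun f => ?_
    change FormSpace.incl E 0 (T (e f)) = _
    rw [hT, hT₀a]
    exact (mulLp_ccToLp u.1 f.1).symm
  have hD : ∀ w : FormSpace E 0, E.derivationCLM (T w) =
      E.leftAction u (E.derivationCLM w) + M (FormSpace.incl E 0 w) := fun w => by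
    refine denseRange_core.induction_on (p := fun w : FormSpace E 0 => E.derivationCLM (T w) =
      E.leftAction u (E.derivationCLM w) + M (FormSpace.incl E 0 w)) w
      (isClosed_eq (by fun_prop) (by fun_prop)) fun f => ?_
    change E.derivationCLM (T (e f)) = E.leftAction u (E.derivationCLM (e f)) + M (E.coreToLp f)
    rw [hT, hT₀a, hM]
    exact derivation_mul u f
  exact ⟨FormSpace.equiv E 0 (T ((FormSpace.equiv E 0).symm f)),
    hL ((FormSpace.equiv E 0).symm f), hD ((FormSpace.equiv E 0).symm f)⟩

/-- The function part is the product rule on ℱ. For ω in dom ∂* and x in ℱ, ⟨uω, ∂x⟩ = ⟨ω, ∂(ux) -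
Mx⟩ = ⟨u ∂*ω - M*ω, x⟩, which puts uω in dom ∂* and identifies its image. -/
theorem realMul_mem_domain (hM : IsGradientMul u M) (w : E.realDirac.domain) :
    ∃ h : E.realMul u w ∈ E.realDirac.domain, E.realDirac ⟨E.realMul u w, h⟩ =
      E.realMul u (E.realDirac w) + WithLp.toLp 2
        (-ContinuousLinearMap.adjoint M w.1.snd, M w.1.fst) := by
  obtain ⟨w, hw1, hw2⟩ := w
  obtain ⟨g, hg1, hg2⟩ := exists_mul_mem_dom hM ⟨w.fst, hw1⟩
  have hdense : Dense (E.partialOp.domain : Set (Lp ℝ 2 μ)) := E.dense_dom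
  have key : ∀ x : E.partialOp.domain,
      inner ℝ (mulLp μ u.1 (E.partialOp.adjoint ⟨w.snd, hw2⟩) -
        ContinuousLinearMap.adjoint M w.snd) (x : Lp ℝ 2 μ) =
      inner ℝ (E.leftAction u w.snd) (E.partialOp x) := by
    intro x
    obtain ⟨y, hy1, hy2⟩ := exists_mul_mem_dom hM x
    have h1 := LinearPMap.adjoint_isFormalAdjoint hdense ⟨w.snd, hw2⟩ y
    rw [inner_sub_left, inner_mulLp, ← hy1, h1, ContinuousLinearMap.adjoint_inner_left,
      inner_leftAction]
    change inner ℝ w.snd (E.derivation y) - _ = inner ℝ w.snd (E.leftAction u (E.derivation x))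
    rw [hy2, inner_add_right]
    ring
  have hmem : E.leftAction u w.snd ∈ E.partialOp.adjoint.domain :=
    LinearPMap.mem_adjoint_domain_of_exists _ ⟨_, key⟩
  have hval := LinearPMap.adjoint_apply_eq hdense ⟨_, hmem⟩ key
  have hmem1 : mulLp μ u.1 w.fst ∈ E.dom := hg1 ▸ g.2
  refine ⟨⟨hmem1, hmem⟩, ?_⟩
  have hg : g = ⟨mulLp μ u.1 w.fst, hmem1⟩ := Subtype.ext hg1
  rw [hg] at hg2
  refine congrArg (WithLp.toLp 2) (Prod.ext (hval.trans (sub_eq_add_neg _ _)) hg2)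

end GradientMul

end Commutator

end DirichletForm

/-! ### The complex commutator and its norm. -/

namespace Cplx

variable {V : Type*} [NormedAddCommGroup V] [InnerProductSpace ℝ V]

theorem norm_sq_eq (x : Cplx V) : ‖x‖ ^ 2 = ‖x.re‖ ^ 2 + ‖x.im‖ ^ 2 := by
  rw [← real_inner_self_eq_norm_sq x.re, ← real_inner_self_eq_norm_sq x.im,
    ← inner_self_eq_norm_sq (𝕜 := ℂ)]
  rfl

/-- The complex linear operator `S + i T` obtained from two real linear operators. -/
def combine (S T : V →ₗ[ℝ] V) : Cplx V →ₗ[ℂ] Cplx V where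
  toFun x := ⟨S x.re - T x.im, S x.im + T x.re⟩
  map_add' x y := by
    ext
    · simp only [add_re, add_im, map_add]
      abel
    · simp only [add_re, add_im, map_add]
      abel
  map_smul' z x := by
    ext
    · simp only [smul_re, smul_im, map_add, map_sub, map_smul, RingHom.id_apply]
      module
    · simp only [smul_re, smul_im, map_add, map_sub, map_smul, RingHom.id_apply]
      module

end Cplx

namespace DirichletForm

section Commutator

variable {X : Type*} [MetricSpace X] [MeasurableSpace X] [BorelSpace X] {μ : Measure X}
  [μ.Regular] {E : DirichletForm μ} [LocallyCompactSpace X] [SecondCountableTopology X]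
  [hE : E.IsAdmissible] {a : Cplx E.core} {M N : Lp ℝ 2 μ →L[ℝ] E.OneForms}

/-- The operator `(f, ω) ↦ (-M* ω, M f)`. -/
def realCommutator (M : Lp ℝ 2 μ →L[ℝ] E.OneForms) : E.RealDiracSpace →ₗ[ℝ] E.RealDiracSpace where
  toFun w := WithLp.toLp 2 (-ContinuousLinearMap.adjoint M w.snd, M w.fst)
  map_add' v w := congrArg (WithLp.toLp 2) (Prod.ext
    (by
      change -ContinuousLinearMap.adjoint M (v.snd + w.snd) =
        -ContinuousLinearMap.adjoint M v.snd + -ContinuousLinearMap.adjoint M w.snd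
      rw [map_add, neg_add])
    (M.map_add v.fst w.fst))
  map_smul' r w := congrArg (WithLp.toLp 2) (Prod.ext
    (by
      change -ContinuousLinearMap.adjoint M (r • w.snd) = r • -ContinuousLinearMap.adjoint M w.snd
      rw [map_smul, smul_neg])
    (M.map_smul r w.fst))

theorem norm_sq_realDiracSpace (w : E.RealDiracSpace) :
    ‖w‖ ^ 2 = ‖w.fst‖ ^ 2 + ‖w.snd‖ ^ 2 := WithLp.prod_norm_sq_eq_of_L2 w

theorem norm_combine_realCommutator_le (hM : IsGradientMul a.re M) (hN : IsGradientMul a.im N)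
    {C : ℝ} (hC : 0 ≤ C) (h : ∀ᵐ x ∂μ, density a.re x + density a.im x ≤ C)
    (v : E.DiracSpace) :
    ‖Cplx.combine (realCommutator M) (realCommutator N) v‖ ≤ Real.sqrt C * ‖v‖ := by
  refine le_of_sq_le_sq ?_ (by positivity)
  rw [mul_pow, Real.sq_sqrt hC, Cplx.norm_sq_eq, Cplx.norm_sq_eq, norm_sq_realDiracSpace,
    norm_sq_realDiracSpace, norm_sq_realDiracSpace, norm_sq_realDiracSpace]
  have h1 := norm_sq_gradientMul_le hM hN h v.re.fst v.im.fst
  have h2 := norm_sq_adjoint_gradientMul_le hM hN hC h v.re.snd v.im.snd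
  have e1 : (Cplx.combine (realCommutator M) (realCommutator N) v).re.fst =
      -ContinuousLinearMap.adjoint M v.re.snd - -ContinuousLinearMap.adjoint N v.im.snd := rfl
  have e2 : (Cplx.combine (realCommutator M) (realCommutator N) v).im.fst =
      -ContinuousLinearMap.adjoint M v.im.snd + -ContinuousLinearMap.adjoint N v.re.snd := rfl
  have e3 : (Cplx.combine (realCommutator M) (realCommutator N) v).re.snd =
      M v.re.fst - N v.im.fst := rfl
  have e4 : (Cplx.combine (realCommutator M) (realCommutator N) v).im.snd =
      M v.im.fst + N v.re.fst := rfl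
  rw [e1, e2, e3, e4, ← neg_sub', norm_neg, ← neg_add, norm_neg]
  linarith

/-- The commutator of the Dirac operator with `a`. -/
def commutator (M N : Lp ℝ 2 μ →L[ℝ] E.OneForms) {K : ℝ}
    (h : ∀ v : E.DiracSpace, ‖Cplx.combine (realCommutator M) (realCommutator N) v‖ ≤ K * ‖v‖) :
    E.DiracSpace →L[ℂ] E.DiracSpace :=
  (Cplx.combine (realCommutator M) (realCommutator N)).mkContinuous K h

theorem isCommutator_combine (hM : IsGradientMul a.re M) (hN : IsGradientMul a.im N) {K : ℝ}
    (h : ∀ v : E.DiracSpace, ‖Cplx.combine (realCommutator M) (realCommutator N) v‖ ≤ K * ‖v‖) :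
    E.IsCommutator a (commutator M N h) := by
  intro v
  obtain ⟨v, hre, him⟩ := v
  obtain ⟨h1, e1⟩ := realMul_mem_domain hM ⟨v.re, hre⟩
  obtain ⟨h2, e2⟩ := realMul_mem_domain hM ⟨v.im, him⟩
  obtain ⟨h3, e3⟩ := realMul_mem_domain hN ⟨v.re, hre⟩
  obtain ⟨h4, e4⟩ := realMul_mem_domain hN ⟨v.im, him⟩
  refine ⟨⟨Submodule.sub_mem _ h1 h4, Submodule.add_mem _ h2 h3⟩, ?_⟩
  have s1 := E.realDirac.map_sub ⟨_, h1⟩ ⟨_, h4⟩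
  have s2 := E.realDirac.map_add ⟨_, h2⟩ ⟨_, h3⟩
  rw [e1, e4] at s1
  rw [e2, e3] at s2
  rw [eq_sub_iff_add_eq]
  ext1
  · refine Eq.trans ?_ s1.symm
    change (realCommutator M v.re - realCommutator N v.im) +
      (E.realMul a.re (E.realDirac ⟨v.re, hre⟩) - E.realMul a.im (E.realDirac ⟨v.im, him⟩)) =
      (E.realMul a.re (E.realDirac ⟨v.re, hre⟩) + realCommutator M v.re) -
      (E.realMul a.im (E.realDirac ⟨v.im, him⟩) + realCommutator N v.im)
    abel
  · refine Eq.trans ?_ s2.symm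
    change (realCommutator M v.im + realCommutator N v.re) +
      (E.realMul a.re (E.realDirac ⟨v.im, him⟩) + E.realMul a.im (E.realDirac ⟨v.re, hre⟩)) =
      (E.realMul a.re (E.realDirac ⟨v.im, him⟩) + realCommutator M v.im) +
      (E.realMul a.im (E.realDirac ⟨v.re, hre⟩) + realCommutator N v.re)
    abel

/-- The element `(f, 0)` of the domain of the Dirac operator. -/
def coreVector (f : E.core) : E.DiracSpace := ⟨WithLp.toLp 2 (E.coreToLp f, 0), 0⟩

theorem coreVector_mem (f : E.core) : coreVector f ∈ E.dirac.domain :=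
  ⟨⟨(E.coreToDom f).2, Submodule.zero_mem _⟩, Submodule.zero_mem E.realDirac.domain⟩

theorem norm_coreVector_sq (f : E.core) : ‖coreVector f‖ ^ 2 = ‖E.coreToLp f‖ ^ 2 := by
  rw [Cplx.norm_sq_eq, norm_sq_realDiracSpace]
  simp [coreVector]

theorem norm_combine_coreVector_sq (hM : IsGradientMul a.re M) (hN : IsGradientMul a.im N)
    (f : E.core) : ‖Cplx.combine (realCommutator M) (realCommutator N) (coreVector f)‖ ^ 2 =
      carre a.re (f * f) + carre a.im (f * f) := by
  rw [← norm_tens_sq, ← norm_tens_sq, ← hM, ← hN, Cplx.norm_sq_eq, norm_sq_realDiracSpace,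
    norm_sq_realDiracSpace]
  have e1 : (Cplx.combine (realCommutator M) (realCommutator N) (coreVector f)).re.fst =
      -ContinuousLinearMap.adjoint M 0 - -ContinuousLinearMap.adjoint N 0 := rfl
  have e2 : (Cplx.combine (realCommutator M) (realCommutator N) (coreVector f)).im.fst =
      -ContinuousLinearMap.adjoint M 0 + -ContinuousLinearMap.adjoint N 0 := rfl
  have e3 : (Cplx.combine (realCommutator M) (realCommutator N) (coreVector f)).re.snd =
      M (E.coreToLp f) - N 0 := rfl
  have e4 : (Cplx.combine (realCommutator M) (realCommutator N) (coreVector f)).im.snd =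
      M 0 + N (E.coreToLp f) := rfl
  simp [e1, e2, e3, e4]

theorem exists_gradientMul_pair {C : ℝ} (hC : 0 ≤ C)
    (h : ∀ᵐ x ∂μ, density a.re x + density a.im x ≤ C) :
    (∃ M, IsGradientMul a.re M) ∧ ∃ N, IsGradientMul a.im N := by
  constructor
  · refine exists_isGradientMul hC ?_
    filter_upwards [h] with x hx
    linarith [density_nonneg a.im x]
  · refine exists_isGradientMul hC ?_
    filter_upwards [h] with x hx
    linarith [density_nonneg a.re x]

/-- On the vectors (f, 0) with f in 𝒞, every bounded extension T agrees with the explicit operator,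
where the squared norm is ∫ f² dΓ(a). Thus ∫ f² dΓ(a) ≤ ‖T‖² ‖f‖² for all such f. -/
theorem density_le_of_isCommutator {C : ℝ} (hC : 0 ≤ C)
    (h : ∀ᵐ x ∂μ, density a.re x + density a.im x ≤ C) {T : E.DiracSpace →L[ℂ] E.DiracSpace}
    (hT : E.IsCommutator a T) : ∀ᵐ x ∂μ, density a.re x + density a.im x ≤ ‖T‖ ^ 2 := by
  obtain ⟨⟨M, hM⟩, N, hN⟩ := exists_gradientMul_pair hC h
  have hb := norm_combine_realCommutator_le hM hN hC h
  refine density_add_density_le_of_carre_le fun f => ?_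
  obtain ⟨h1, e1⟩ := hT ⟨_, coreVector_mem f⟩
  obtain ⟨h2, e2⟩ := isCommutator_combine hM hN hb ⟨_, coreVector_mem f⟩
  have e3 : T (coreVector f) = Cplx.combine (realCommutator M) (realCommutator N) (coreVector f) :=
    e1.trans e2.symm
  rw [← norm_combine_coreVector_sq hM hN, ← e3, ← norm_coreVector_sq, ← mul_pow]
  gcongr
  exact T.le_opNorm _

theorem exists_isCommutator {C : ℝ} (hC : 0 ≤ C)
    (h : ∀ᵐ x ∂μ, density a.re x + density a.im x ≤ C) :
    ∃ T, E.IsCommutator a T ∧ ‖T‖ ^ 2 ≤ C := by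
  obtain ⟨⟨M, hM⟩, N, hN⟩ := exists_gradientMul_pair hC h
  have hb := norm_combine_realCommutator_le hM hN hC h
  refine ⟨_, isCommutator_combine hM hN hb, ?_⟩
  calc ‖commutator M N hb‖ ^ 2 ≤ Real.sqrt C ^ 2 := by
        gcongr
        exact LinearMap.mkContinuous_norm_le _ (Real.sqrt_nonneg _) _
    _ = C := Real.sq_sqrt hC

theorem rnDeriv_complexEnergyMeasure (a : Cplx E.core) : ∀ᵐ x ∂μ,
    (E.complexEnergyMeasure a).rnDeriv μ x = ENNReal.ofReal (density a.re x + density a.im x) := by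
  have h1 := isFiniteMeasure_energyMeasure hE.regular hE.stronglyLocal a.re
  have h2 := isFiniteMeasure_energyMeasure hE.regular hE.stronglyLocal a.im
  filter_upwards [Measure.rnDeriv_add' (E.energyMeasure a.re) (E.energyMeasure a.im) μ,
    Measure.rnDeriv_lt_top (E.energyMeasure a.re) μ, Measure.rnDeriv_lt_top (E.energyMeasure a.im) μ]
    with x h3 h4 h5
  rw [complexEnergyMeasure, h3, Pi.add_apply, ENNReal.ofReal_add (density_nonneg _ _)
    (density_nonneg _ _), density, density, ENNReal.ofReal_toReal h4.ne, ENNReal.ofReal_toReal h5.ne]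

theorem energySup_le_ofReal {C : ℝ} (h : ∀ᵐ x ∂μ, density a.re x + density a.im x ≤ C) :
    E.energySup a ≤ ENNReal.ofReal C := by
  refine essSup_le_of_ae_le _ ?_
  filter_upwards [h, rnDeriv_complexEnergyMeasure a] with x h1 h2
  rw [h2]
  exact ENNReal.ofReal_le_ofReal h1

theorem density_le_energySup (h : E.energySup a < ∞) :
    ∀ᵐ x ∂μ, density a.re x + density a.im x ≤ (E.energySup a).toReal := by
  filter_upwards [rnDeriv_complexEnergyMeasure a,
    ENNReal.ae_le_essSup ((E.complexEnergyMeasure a).rnDeriv μ)] with x h1 h2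
  rw [h1] at h2
  exact (ENNReal.ofReal_le_iff_le_toReal h.ne).1 h2

theorem mem_connesAlgebra {C : ℝ} (h : ∀ᵐ x ∂μ, density a.re x + density a.im x ≤ C) :
    a ∈ E.connesAlgebra :=
  ⟨(hE.energyDominant.2.2 a.re).add_left (hE.energyDominant.2.2 a.im),
    (energySup_le_ofReal h).trans_lt ENNReal.ofReal_lt_top⟩

theorem exists_isCommutator_norm_sq_eq (ha : a ∈ E.connesAlgebra) :
    ∃ T, E.IsCommutator a T ∧ ENNReal.ofReal (‖T‖ ^ 2) = E.energySup a := by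
  have h := density_le_energySup ha.2
  obtain ⟨T, hT, hle⟩ := exists_isCommutator ENNReal.toReal_nonneg h
  refine ⟨T, hT, le_antisymm ?_ (energySup_le_ofReal
    (density_le_of_isCommutator ENNReal.toReal_nonneg h hT))⟩
  rw [← ENNReal.ofReal_toReal ha.2.ne]
  exact ENNReal.ofReal_le_ofReal hle

end Commutator

/-! ### Comparison of the two distances. -/

section Distances

variable {X : Type*} [MetricSpace X] [MeasurableSpace X] [BorelSpace X] {μ : Measure X}
  [μ.Regular] {E : DirichletForm μ} [LocallyCompactSpace X] [SecondCountableTopology X]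
  [hE : E.IsAdmissible]

theorem densityLEOne_iff (f : E.core) :
    DensityLEOne (E.energyMeasure f) μ ↔ ∀ᵐ x ∂μ, density f x ≤ 1 := by
  have h1 := isFiniteMeasure_energyMeasure hE.regular hE.stronglyLocal f
  have key : ∀ᵐ x ∂μ, ((E.energyMeasure f).rnDeriv μ x ≤ 1 ↔ density f x ≤ 1) := by
    filter_upwards [Measure.rnDeriv_lt_top (E.energyMeasure f) μ] with x hx
    rw [density, ← ENNReal.toReal_one, ENNReal.toReal_le_toReal hx.ne ENNReal.one_ne_top]
  constructor
  · rintro ⟨-, h⟩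
    filter_upwards [h, key] with x h k
    exact k.1 h
  · intro h
    refine ⟨hE.energyDominant.2.2 f, ?_⟩
    filter_upwards [h, key] with x h k
    exact k.2 h

theorem integral_density_le (f : E.core) : ∫ x, density f x ∂μ ≤ E.coreForm f f := by
  have h := integral_mul_density f fun _ => 1
  simp only [one_mul, integral_const, smul_eq_mul, mul_one] at h
  rw [h]
  exact ENNReal.toReal_le_of_le_ofReal (E.nonneg _)
    (energyMeasure_univ_le hE.regular hE.stronglyLocal f)

theorem setIntegral_density (f : E.core) {A : Set X} (hA : MeasurableSet A) :
    ∫ x in A, density f x ∂μ = (E.energyMeasure f).real A := by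
  have h := integral_mul_density f (A.indicator 1)
  rw [integral_indicator_one hA] at h
  rw [← h, ← integral_indicator hA]
  congr 1
  ext x
  by_cases hx : x ∈ A <;> simp [hx]

/-- The expansion Γ(g) = Γ(f) - 2Γ(f, f - g) + Γ(f - g) is combined with Cauchy-Schwarz of weight ε.
The estimate shows that f ↦ Γ(f)(A) is continuous for the energy, so the measure defined by limits
on ℱ agrees with Γ on 𝒞. -/
theorem abs_energyMeasure_sub_le (f g : E.core) {ε : ℝ} (hε : 0 < ε) {A : Set X}
    (hA : MeasurableSet A) : |(E.energyMeasure g).real A - (E.energyMeasure f).real A| ≤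
      ε * E.coreForm f f + (1 / ε + 1) * E.coreForm (f - g) (f - g) := by
  have hpt : ∀ᵐ x ∂μ, |density g x - density f x| ≤
      ε * density f x + (1 / ε + 1) * density (f - g) x := by
    have e : g = (1 : ℝ) • f + (-1 : ℝ) • (f - g) := by module
    have hlin := density_linear_comb 1 (-1) f (f - g)
    rw [← e] at hlin
    filter_upwards [hlin, two_mul_abs_mutualDensity_le ε (f - g) f,
      mutualDensity_comm f (f - g)] with x h1 h2 h3
    rw [h1, h3]
    have h4 := density_nonneg (f - g) x
    have h5 : 2 * |mutualDensity (f - g) f x| ≤ ε * density f x + 1 / ε * density (f - g) x := by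
      have h6 : ε * (2 * |mutualDensity (f - g) f x|) ≤
          ε * (ε * density f x + 1 / ε * density (f - g) x) := by
        have : ε * (ε * density f x + 1 / ε * density (f - g) x) =
          density (f - g) x + ε ^ 2 * density f x := by
            field_simp
            ring
        rw [this]
        linarith
      exact le_of_mul_le_mul_left h6 hε
    have h7 : 0 ≤ ε * density f x := mul_nonneg hε.le (density_nonneg f x)
    have h8 : 0 ≤ 1 / ε * density (f - g) x := mul_nonneg (by positivity) h4
    have h9 := le_abs_self (mutualDensity (f - g) f x)
    have h10 := neg_abs_le (mutualDensity (f - g) f x)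
    rw [abs_le]
    constructor <;> linarith
  have hint := ((integrable_density f).const_mul ε).add
    ((integrable_density (f - g)).const_mul (1 / ε + 1))
  rw [← setIntegral_density g hA, ← setIntegral_density f hA, ← integral_sub
    (integrable_density g).integrableOn (integrable_density f).integrableOn]
  calc |∫ x in A, (density g x - density f x) ∂μ| ≤ ∫ x in A, |density g x - density f x| ∂μ :=
        abs_integral_le_integral_abs
    _ ≤ ∫ x, |density g x - density f x| ∂μ :=
        setIntegral_le_integral ((integrable_density g).sub (integrable_density f)).abs
          (ae_of_all _ fun x => abs_nonneg _)
    _ ≤ ∫ x, (ε * density f x + (1 / ε + 1) * density (f - g) x) ∂μ :=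
        integral_mono_ae ((integrable_density g).sub (integrable_density f)).abs hint hpt
    _ = ε * ∫ x, density f x ∂μ + (1 / ε + 1) * ∫ x, density (f - g) x ∂μ := by
        rw [integral_add ((integrable_density f).const_mul ε)
          ((integrable_density (f - g)).const_mul (1 / ε + 1)), integral_const_mul,
          integral_const_mul]
    _ ≤ _ := by
        gcongr
        · exact integral_density_le f
        · exact integral_density_le (f - g)

theorem isEnergyMeasureDom_core (f : E.core) :
    E.IsEnergyMeasureDom (E.coreToDom f) (E.energyMeasure f) := by
  intro g hg A hA
  have hfin := fun f => isFiniteMeasure_energyMeasure hE.regular hE.stronglyLocal (E := E) f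
  have h0 : Tendsto (fun n => E.coreForm (f - g n) (f - g n)) atTop (𝓝 0) := by
    refine squeeze_zero (fun n => E.nonneg _) (fun n => ?_) hg
    rw [formOne]
    exact le_add_of_nonneg_right (sq_nonneg _)
  have h1 : Tendsto (fun n => (E.energyMeasure (g n)).real A) atTop
      (𝓝 ((E.energyMeasure f).real A)) := by
    rw [Metric.tendsto_atTop]
    intro ε hε
    have hf : 0 ≤ E.coreForm f f := E.nonneg _
    set δ := ε / (2 * (E.coreForm f f + 1)) with hδ
    have hδ0 : 0 < δ := by positivity
    obtain ⟨N, hN⟩ := Metric.tendsto_atTop.1 h0 (ε / (2 * (1 / δ + 1))) (by positivity)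
    refine ⟨N, fun n hn => ?_⟩
    have h2 := hN n hn
    rw [Real.dist_eq, sub_zero] at h2
    replace h2 := (le_abs_self _).trans_lt h2
    rw [Real.dist_eq]
    refine (abs_energyMeasure_sub_le f (g n) hδ0 hA).trans_lt ?_
    have h3 : δ * E.coreForm f f ≤ ε / 2 := by
      calc δ * E.coreForm f f ≤ δ * (E.coreForm f f + 1) := by gcongr; linarith
        _ = ε / 2 := by
          rw [hδ]
          field_simp
    have h4 : (1 / δ + 1) * E.coreForm (f - g n) (f - g n) < ε / 2 := by
      calc (1 / δ + 1) * E.coreForm (f - g n) (f - g n) <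
            (1 / δ + 1) * (ε / (2 * (1 / δ + 1))) := by gcongr
        _ = ε / 2 := by field_simp
    linarith
  have h2 := (ENNReal.continuous_ofReal.tendsto _).comp h1
  simpa [Function.comp_def, ofReal_measureReal] using h2

theorem energyMeasureDom_core (f : E.core) :
    E.energyMeasureDom (E.coreToDom f) = E.energyMeasure f := by
  have h : ∃ ν, E.IsEnergyMeasureDom (E.coreToDom f) ν := ⟨_, isEnergyMeasureDom_core f⟩
  rw [energyMeasureDom, dif_pos h]
  refine Measure.ext fun A hA => ?_
  have h0 : Tendsto (fun _ : ℕ => E.formOne (E.coreToDom f - E.coreToDom f)) atTop (𝓝 0) := by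
    simp [formOne]
  exact tendsto_nhds_unique (h.choose_spec (fun _ => f) h0 A hA) tendsto_const_nhds

theorem ofReal_abs_sub_le_connesDist {f : E.core} (hf : DensityLEOne (E.energyMeasure f) μ)
    (x y : X) : ENNReal.ofReal |f.1 x - f.1 y| ≤ E.connesDist x y := by
  set a : Cplx E.core := ⟨f, 0⟩ with ha
  have h : ∀ᵐ x ∂μ, density a.re x + density a.im x ≤ 1 := by
    filter_upwards [(densityLEOne_iff f).1 hf,
      density_eq_zero_of_const (f := (0 : E.core)) isOpen_univ (c := 0) fun x _ => rfl] with x h1 h2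
    rw [ha, h2 trivial, add_zero]
    exact h1
  obtain ⟨T, hT, hT1⟩ := exists_isCommutator zero_le_one h
  have hT2 : ‖T‖ ≤ 1 := by
    by_contra! hlt
    nlinarith
  refine le_trans ?_ (le_iSup₂_of_le a (mem_connesAlgebra h) (le_iSup_of_le ⟨T, hT, hT2⟩ le_rfl))
  refine ENNReal.ofReal_le_ofReal ?_
  exact Complex.abs_re_le_norm (E.eval a x - E.eval a y)

theorem isMetricInWideSense_connesDist
    (hcoord : ∃ f : ℕ → E.core, E.IsCoordinateSequence μ f ∧
      ∀ x y : X, x ≠ y → ∃ n, (f n).1 x ≠ (f n).1 y) : IsMetricInWideSense E.connesDist := by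
  refine ⟨fun x y => ⟨fun h => ?_, ?_⟩, fun x y => ?_, fun x y z => ?_⟩
  · by_contra hxy
    -- A coordinate function that separates x and y has Γ(fₙ) ≤ μ and so competes in the supremum.
    obtain ⟨f, hf, hsep⟩ := hcoord
    obtain ⟨n, hn⟩ := hsep x y hxy
    have h1 := ofReal_abs_sub_le_connesDist (hf.2 n) x y
    rw [h, nonpos_iff_eq_zero, ENNReal.ofReal_eq_zero] at h1
    exact hn (sub_eq_zero.1 (abs_eq_zero.1 (le_antisymm h1 (abs_nonneg _))))
  · rintro rfl
    simp [connesDist]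
  · simp only [connesDist, norm_sub_rev]
  · refine iSup_le fun a => iSup₂_le fun ha hT => ?_
    refine (ENNReal.ofReal_le_ofReal (norm_sub_le_norm_sub_add_norm_sub _ (E.eval a y) _)).trans ?_
    rw [ENNReal.ofReal_add (norm_nonneg _) (norm_nonneg _)]
    exact add_le_add (le_iSup₂_of_le a ha (le_iSup_of_le hT le_rfl))
      (le_iSup₂_of_le a ha (le_iSup_of_le hT le_rfl))

theorem isLocalEnergyMeasure_core (f : E.core) :
    E.IsLocalEnergyMeasure f.1 (E.energyMeasure f) := fun K _ =>
  ⟨E.coreToDom f, ae_restrict_of_ae (coeFn_ccToLp f.1), by rw [energyMeasureDom_core]⟩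

/-- For a = u + iv and d = a(x) - a(y), the real function f = cu + sv with c + is = d / |d|
satisfies f(x) - f(y) = |d|. Moreover Γ(cu + sv) + Γ(su - cv) = Γ(u) + Γ(v), so Γ(f) ≤ Γ(a) ≤ μ. -/
theorem connesDist_le_intrinsicDist (x y : X) : E.connesDist x y ≤ E.intrinsicDist μ x y := by
  refine iSup_le fun a => iSup₂_le fun ha hT => ?_
  obtain ⟨T, hT, hT1⟩ := hT
  have hle : ∀ᵐ x ∂μ, density a.re x + density a.im x ≤ 1 := by
    filter_upwards [density_le_of_isCommutator ENNReal.toReal_nonneg (density_le_energySup ha.2) hT]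
      with x hx
    exact hx.trans (pow_le_one₀ T.opNorm_nonneg hT1)
  set d := E.eval a x - E.eval a y with hd
  by_cases hd0 : d = 0
  · rw [hd0]
    simp
  have hn : 0 < ‖d‖ := norm_pos_iff.2 hd0
  set c := d.re / ‖d‖ with hc
  set s := d.im / ‖d‖ with hs
  have hsq : ‖d‖ ^ 2 = d.re ^ 2 + d.im ^ 2 := by
    rw [← Complex.normSq_eq_norm_sq, Complex.normSq_apply]
    ring
  have hcs : c ^ 2 + s ^ 2 = 1 := by
    rw [hc, hs, div_pow, div_pow, ← add_div, ← hsq]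
    field_simp
  set f : E.core := c • a.re + s • a.im with hf
  have hfd : f.1 x - f.1 y = ‖d‖ := by
    have h1 : d.re = a.re.1 x - a.re.1 y := rfl
    have h2 : d.im = a.im.1 x - a.im.1 y := rfl
    have h3 : f.1 x - f.1 y = c * d.re + s * d.im := by
      rw [h1, h2, hf]
      simp only [core_add_apply, core_smul_apply]
      ring
    rw [h3, hc, hs]
    field_simp
    exact hsq.symm
  have hfle : DensityLEOne (E.energyMeasure f) μ := by
    rw [densityLEOne_iff]
    filter_upwards [hle, density_linear_comb c s a.re a.im, density_linear_comb s (-c) a.re a.im]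
      with x h1 h2 h3
    have h4 := density_nonneg (s • a.re + (-c) • a.im) x
    rw [h3] at h4
    rw [hf, h2]
    have h5 : (c ^ 2 + s ^ 2) * (density a.re x + density a.im x) ≤ 1 := by rwa [hcs, one_mul]
    nlinarith
  rw [← hfd]
  exact le_iSup₂_of_le f.1.toContinuousMap (E.energyMeasure f)
    (le_iSup₂_of_le (isLocalEnergyMeasure_core f) hfle le_rfl)

/-- With K = X, a competitor f agrees almost everywhere with an element of ℱ and is compactly
supported, so it lies in 𝒞 and its local energy measure is Γ(f). -/
theorem intrinsicDist_le_connesDist [CompactSpace X] (x y : X) :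
    E.intrinsicDist μ x y ≤ E.connesDist x y := by
  refine iSup₂_le fun f ν => iSup₂_le fun hν hle => ?_
  obtain ⟨u, hu, hνu⟩ := hν Set.univ isCompact_univ
  rw [Measure.restrict_univ] at hu
  rw [Measure.restrict_univ, Measure.restrict_univ] at hνu
  set g : C_c(X, ℝ) := ⟨f, HasCompactSupport.of_compactSpace f⟩ with hg
  have hgu : ccToLp μ g = u := by
    apply Lp.ext
    filter_upwards [coeFn_ccToLp (μ := μ) g, hu] with x h1 h2
    rw [h1, h2]
    rfl
  have hgmem : g ∈ E.core := by
    change ccToLp μ g ∈ E.dom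
    rw [hgu]
    exact u.2
  have hu' : u = E.coreToDom ⟨g, hgmem⟩ := Subtype.ext hgu.symm
  rw [hνu, hu', energyMeasureDom_core] at hle
  exact (ENNReal.ofReal_le_ofReal (le_abs_self _)).trans
    (ofReal_abs_sub_le_connesDist (f := ⟨g, hgmem⟩) hle x y)

end Distances

end DirichletForm

end

theorem mainTheorem4 {X : Type*} [MetricSpace X] [LocallyCompactSpace X]
    [TopologicalSpace.SeparableSpace X] [MeasurableSpace X] [BorelSpace X]
    (μ : Measure X) [μ.Regular] [μ.IsOpenPosMeasure] (E : DirichletForm μ)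
    (hreg : E.IsRegular) (hloc : E.IsStronglyLocal) (hdom : E.IsEnergyDominant μ)
    (hcoord : ∃ f : ℕ → E.core, E.IsCoordinateSequence μ f ∧
      ∀ x y : X, x ≠ y → ∃ n, (f n).1 x ≠ (f n).1 y) :
    (∀ a ∈ E.connesAlgebra, ∃ T, E.IsCommutator a T ∧
      ENNReal.ofReal (‖T‖ ^ 2) = E.energySup a) ∧
    IsMetricInWideSense E.connesDist ∧
    (∀ x y, E.connesDist x y ≤ E.intrinsicDist μ x y) ∧
    (CompactSpace X → ∀ x y, E.connesDist x y = E.intrinsicDist μ x y) := by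
  have : SecondCountableTopology X := UniformSpace.secondCountable_of_separable X
  have : E.IsAdmissible := ⟨hreg, hloc, hdom⟩
  exact ⟨fun _ => DirichletForm.exists_isCommutator_norm_sq_eq,
    DirichletForm.isMetricInWideSense_connesDist hcoord,
    DirichletForm.connesDist_le_intrinsicDist, fun _ x y => le_antisymm
      (DirichletForm.connesDist_le_intrinsicDist x y)
      (DirichletForm.intrinsicDist_le_connesDist x y)⟩
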